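/- Let $k$ be an algebraically closed field of arbitrary characteristic and let $X$ be an algebraic curve over $k$, i.e. a reduced separated scheme of finite type over $k$ all of whose irreducible components have dimension one. Let $f:X'\to X$ be the normalization of $X$. Let $\mathrm{Jac}(X/k)=\mathrm{Fitt}^1(\Omega^1_{X/k})\subseteq\mathcal O_X$ be the Jacobian ideal of $X$ and $\mathrm{Jac}(X'/X)=\mathrm{Fitt}^0(\Omega^1_{X'/X})\subseteq\mathcal O_{X'}$ the relative Jacobian ideal of $f$. Then there are (unique) effective divisors $\widehat K_{X'/X}$ and $J_{X'/X}$ on $X'$ with $$\mathrm{Jac}(X'/X)=\mathcal O_{X'}(-\widehat K_{X'/X}),\qquad \mathrm{Jac}(X/k)\cdot\mathcal O_{X'}=\mathcal O_{X'}(-J_{X'/X}),$$ and, as subsheaves of the sheaf of total fractions $f_*\mathcal K_{X'}$, $$\widehat{\mathcal I}(\mathcal O_X):=f_*\mathcal O_{X'}(\widehat K_{X'/X}-J_{X'/X})\subseteq\mathcal O_X .$$ Consequently, for every quasi-coherent ideal sheaf $\mathfrak a\subseteq\mathcal O_X$ that is nonzero at the generic point of every irreducible component of $X$, there is a (unique)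 effective divisor $Z$ on $X'$ with $\mathfrak a\cdot\mathcal O_{X'}=\mathcal O_{X'}(-Z)$, and for every real $t\ge 0$ the Mather-Jacobian multiplier sheaf $$\widehat{\mathcal I}(X,\mathfrak a^t):=f_*\mathcal O_{X'}(\widehat K_{X'/X}-J_{X'/X}-\lfloor tZ\rfloor)$$ is an ideal of $\mathcal O_X$: over each open $U\subseteq X$ its sections form an ideal of $\mathcal O_X(U)$. -/

import Mathlib

open CategoryTheory AlgebraicGeometry

universe u

/-- The `i`-th Fitting ideal of a finitely generated module `M`: it is generated by the maximal
minors (of size `n - i`, with `n = m + i`) of the relation matrices among the finite generating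
families `x₁, …, xₙ` of `M`.  All generating families give the same ideal; taking them all
together avoids a choice. -/
def fittingIdeal (R : Type*) [CommRing R] (M : Type*) [AddCommGroup M] [Module R M] (i : ℕ) :
    Ideal R :=
  Ideal.span {d | ∃ (m : ℕ) (x : Fin (m + i) → M) (A : Matrix (Fin m) (Fin (m + i)) R)
    (c : Fin m → Fin (m + i)), Submodule.span R (Set.range x) = ⊤ ∧
      (∀ r, ∑ j, A r j • x j = 0) ∧ d = (A.submatrix id c).det}

/-- For a homomorphism `φ : A → B` of commutative rings, the ideal `Fitt_d(Ω_{B/A})` of `B`. -/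
noncomputable def differentialFitting {A B : Type u} [CommRing A] [CommRing B] (φ : A →+* B)
    (d : ℕ) : Ideal B :=
  letI : Algebra A B := φ.toAlgebra
  fittingIdeal B (KaehlerDifferential A B) d

namespace AlgebraicGeometry.Scheme

/-- A family of ideals, one in each local ring of a scheme.  The ideal sheaves below are described
by their stalks. -/
abbrev StalkIdeals (X : Scheme.{u}) : Type u := ∀ x : X, Ideal (X.presheaf.stalk x)

/-- The relative Jacobian ideal `Fitt_d(Ω_{X/Y})` of a morphism `f : X ⟶ Y` of relative
dimension `d`, given by its stalks; the stalk of `Ω_{X/Y}` at `x` is the module of differentials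
of `𝒪_{Y, f x} → 𝒪_{X, x}`. -/
noncomputable def jacobianIdeal {X Y : Scheme.{u}} (f : X ⟶ Y) (d : ℕ) : StalkIdeals X :=
  fun x => differentialFitting (f.stalkMap x).hom d

/-- The stalks of a quasi-coherent ideal sheaf. -/
noncomputable def idealStalks {X : Scheme.{u}} (I : X.IdealSheafData) : StalkIdeals X :=
  fun x => ⨆ (U : X.affineOpens) (h : x ∈ U.1), (I.ideal U).map (X.presheaf.germ U.1 x h).hom

/-- The inverse image ideal `I · 𝒪_{X'}` for `f : X' ⟶ X`. -/
noncomputable def pullbackIdeal {X' X : Scheme.{u}} (f : X' ⟶ X) (I : StalkIdeals X) :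
    StalkIdeals X' :=
  fun p => (I (f p)).map (f.stalkMap p).hom

/-- `f : X' ⟶ X` is the normalization of `X`: it is integral, `X'` is normal, and `f` is
birational, i.e. an isomorphism over a dense open subset of `X` with dense preimage. -/
structure IsNormalization {X' X : Scheme.{u}} (f : X' ⟶ X) : Prop where
  isIntegralHom : IsIntegralHom f
  isDomain : ∀ p : X', IsDomain (X'.presheaf.stalk p)
  isIntegrallyClosed : ∀ p : X', IsIntegrallyClosed (X'.presheaf.stalk p)
  birational : ∃ U : X.Opens, Dense (U : Set X) ∧ Dense ((f ⁻¹ᵁ U : X'.Opens) : Set X') ∧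
    IsIso (f ∣_ U)

/-- On a normal curve, `D` is the effective divisor with `𝒪(-D) = I`: it is a locally finite
combination of closed points with nonnegative coefficients, and `I` is the power of the maximal
ideal with exponent `D p` at every point `p`. -/
structure IsDivisorOf {X : Scheme.{u}} (D : AlgebraicCycle X ℤ) (I : StalkIdeals X) : Prop where
  isClosed : ∀ p : X, D p ≠ 0 → IsClosed ({p} : Set X)
  nonneg : ∀ p : X, 0 ≤ D p
  eq_pow : ∀ p : X, I p = IsLocalRing.maximalIdeal (X.presheaf.stalk p) ^ (D p).toNat

/-- The sections over `V` of the sheaf of total rings of fractions of a reduced locally Noetherian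
scheme: the product of the local rings (fields) at the generic points of the irreducible
components of the scheme that meet `V`. -/
abbrev RationalFunctions (X : Scheme.{u}) (V : X.Opens) : Type u :=
  ∀ η : {η : X // η ∈ V ∧ closure {η} ∈ irreducibleComponents X}, X.presheaf.stalk η.1

/-- The rational function defined by a regular function on `V`. -/
noncomputable def toRationalFunctions (X : Scheme.{u}) (V : X.Opens) :
    Γ(X, V) →+* RationalFunctions X V :=
  RingHom.pi fun η => (X.presheaf.germ V η.1 η.2.1).hom

noncomputable instance (X : Scheme.{u}) (V : X.Opens) : Module Γ(X, V) (RationalFunctions X V) :=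
  Module.compHom _ (toRationalFunctions X V)

/-- The sections over `V` of the sheaf `𝒪_X(D)` on a normal curve `X`, for a divisor `D`: the
rational functions `z` on `V` with `v_p(z) ≥ -D(p)` for all points `p` of `V`.  The inequality is
written `v_p(z) + D(p)⁺ ≥ D(p)⁻`, that is `z · 𝔪_p ^ D(p)⁺ ⊆ 𝔪_p ^ D(p)⁻`; it is void at the
generic points, where `D` vanishes. -/
def divisorSections {X : Scheme.{u}} (D : X → ℤ) (V : X.Opens) :
    Submodule Γ(X, V) (RationalFunctions X V) where
  carrier := {z | ∀ p : X, p ∈ V → ∀ η (h : η.1 ⤳ p),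
    ∀ a ∈ IsLocalRing.maximalIdeal (X.presheaf.stalk p) ^ (D p).toNat,
      ∃ b ∈ IsLocalRing.maximalIdeal (X.presheaf.stalk p) ^ (-D p).toNat,
        (X.presheaf.stalkSpecializes h).hom b = (X.presheaf.stalkSpecializes h).hom a * z η}
  zero_mem' := fun p _ η h a _ => ⟨0, zero_mem _, by simp⟩
  add_mem' := by
    intro z w hz hw p hp η h a ha
    obtain ⟨b, hb, e⟩ := hz p hp η h a ha
    obtain ⟨c, hc, e'⟩ := hw p hp η h a ha
    exact ⟨b + c, add_mem hb hc, by rw [map_add, e, e', Pi.add_apply, mul_add]⟩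
  smul_mem' := by
    intro s z hz p hp η h a ha
    obtain ⟨b, hb, e⟩ := hz p hp η h a ha
    refine ⟨(X.presheaf.germ V p hp).hom s * b, Ideal.mul_mem_left _ _ hb, ?_⟩
    have h1 : (X.presheaf.stalkSpecializes h).hom ((X.presheaf.germ V p hp).hom s) =
        (X.presheaf.germ V η.1 η.2.1).hom s := by
      rw [← CommRingCat.comp_apply, TopCat.Presheaf.germ_stalkSpecializes]
    have h2 : (s • z) η = (X.presheaf.germ V η.1 η.2.1).hom s * z η := rfl
    rw [map_mul, e, h1, h2]
    ring

/-- The inclusion `𝒪_X(U) → f_* 𝒦_{X'}(U)` into the rational functions, for a normalization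
`f : X' ⟶ X`. -/
noncomputable def regularToRational {X' X : Scheme.{u}} (f : X' ⟶ X) (U : X.Opens) :
    Γ(X, U) →+* RationalFunctions X' (f ⁻¹ᵁ U) :=
  (toRationalFunctions X' (f ⁻¹ᵁ U)).comp (f.app U).hom

/-- The sections over `U` of the Mather-Jacobian multiplier sheaf
`f_* 𝒪_{X'}(K - J - ⌊t Z⌋)`, for divisors `K`, `J`, `Z` on `X'` and a real number `t`. -/
def mjSections {X' X : Scheme.{u}} (f : X' ⟶ X) (K J Z : AlgebraicCycle X' ℤ) (t : ℝ)
    (U : X.Opens) : Set (RationalFunctions X' (f ⁻¹ᵁ U)) :=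
  divisorSections (fun p => K p - J p - ⌊t * (Z p : ℝ)⌋) (f ⁻¹ᵁ U)

end AlgebraicGeometry.Scheme

/-! ### The Noether different contains the determinants of square relation matrices of differentials
-/

section
open TensorProduct

/-! The inclusion is a local statement at a closed point `x`. Let `O` be the local ring there, `V p`
the discrete valuation rings of `X'` at the finitely many points over `x`, with uniformizers `τ p`,
and `K p`, `J p` the multiplicities of the two divisors. With `D = d/dτ`
(`exists_derivation_uniformizer`), the module of differentials of `V` over `O` is generated by `dτ`,
and `K p` is the least valuation of `D o` for `o` in `O`. What has to be shown is that elements of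
valuation at least `J p - K p` come from `O`.

Since `k` is infinite, one `t` in `O` attains the valuation `K p` of `D t` at all `p` at once. Take
a relation matrix of the differentials of `O` over `k` with a minor of valuation at most `J p`, and
border it by the coordinates of `dt`: the result is a square relation matrix over `k[t]`. By
Cramer's rule its determinant has valuation at most `J p`, and it is the image of some `δ` in `O ⊗
O` killed by the diagonal ideal (`KaehlerDifferential.exists_noetherDifferent`,
`exists_noetherDifferent_not_dvd`). A second generic choice gives one such `δ`, with product `d`,
good for all `p`.

On the other side, `V / t ^ N` is `k[t] / t ^ N` with a root `τ` of a monic `F` adjoined. It is a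
Frobenius algebra whose dual bases, the powers of `τ` and the Horner quotients of `F`, have product
sum `h = F'(τ)`; differentiating `F(τ) ≡ 0` shows that `h` is a multiple of `dt/dτ` up to `t ^ (N -
1)` (`exists_frobenius_quotient`). Contracting the second factor of `δ` with the Frobenius
functional gives a map from the product of the quotients `V / t ^ N` to the image of `O` which, up
to a conductor element, is multiplication by `d / h` (`noetherDifferent_mul_frobenius`). As `h` is
divisible by `τ ^ K` and `d` divides `τ ^ J`, this yields `exists_approximation`: the required
elements are approximated by `O` to any order. An error that lies in the conductor is harmless, so
approximation suffices. No completion, flatness or separability of `O` over `k[t]` enters, hence no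
restriction on the characteristic.

The globalization rests on finiteness of the normalization (`IsNormalization.isFinite`), which
supplies a conductor element; on the local rings at closed points of `X'` being discrete valuation
rings; and on gluing the local solutions along closed points (`divisorSections_subset_range`). The
last assertion follows because `⌊tZ⌋` is effective, so that subtracting it only shrinks the sheaf.
-/

/-- A square matrix of relations modulo `I ^ 2` between elements generating `I` modulo `I ^ 2`
has a determinant which, modulo `I`, annihilates `I`. -/
theorem Ideal.exists_annihilator_of_relations {E : Type*} [CommRing E] {I : Ideal E} (hI : I.FG)
    {n : ℕ} (ξ : Fin n → E) (hgen : I ≤ Ideal.span (Set.range ξ) ⊔ I ^ 2)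
    (A : Matrix (Fin n) (Fin n) E) (hA : ∀ r, ∑ j, A r j * ξ j ∈ I ^ 2) :
    ∃ δ : E, (∀ y ∈ I, δ * y = 0) ∧ δ - A.det ∈ I := by
  -- Nakayama: `r ≡ 1` modulo `I` and `r I` lies in the span of `ξ`.
  obtain ⟨r, hr, hrI⟩ := Submodule.exists_sub_one_mem_and_smul_le_of_fg_of_le_sup
    (N := Ideal.span (Set.range ξ)) (N' := I) hI le_rfl
    (by simpa [pow_two, smul_eq_mul, Ideal.mul_eq_inf_of_coprime] using hgen)
  have hrI' : ∀ y ∈ I, r * y ∈ Ideal.span (Set.range ξ) := fun y hy =>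
    hrI (Submodule.smul_mem_pointwise_smul y r I hy)
  have h2 : ∀ y ∈ I ^ 2, ∃ c : Fin n → E, (∀ j, c j ∈ I) ∧ r * y = ∑ j, c j * ξ j := by
    intro y hy
    rw [pow_two] at hy
    have : r * y ∈ I • Ideal.span (Set.range ξ) := by
      induction hy using Submodule.mul_induction_on' with
      | mem_mul_mem a ha b hb =>
        rw [mul_left_comm]
        exact Submodule.smul_mem_smul ha (hrI' b hb)
      | add a _ b _ ha hb => rw [mul_add]; exact add_mem ha hb
    rw [Ideal.span, Submodule.mem_ideal_smul_span_iff_exists_sum] at this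
    obtain ⟨c, hc, e⟩ := this
    refine ⟨c, hc, ?_⟩
    rw [← e, Finsupp.sum_fintype _ _ (by simp)]
    rfl
  choose c hc hcr using fun i => h2 _ (hA i)
  -- A correction with entries in `I` turns the relations modulo `I ^ 2` into exact ones; the
  -- determinant is unchanged modulo `I`, and the adjugate shows that it kills every `ξ j`.
  let B : Matrix (Fin n) (Fin n) E := r • A - Matrix.of c
  have hB : B.mulVec ξ = 0 := by
    funext i
    simp only [B, Matrix.mulVec, dotProduct, Matrix.sub_apply, Matrix.smul_apply, Matrix.of_apply,
      smul_eq_mul, sub_mul, Finset.sum_sub_distrib, ← hcr i, Finset.mul_sum, mul_assoc,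
      sub_self, Pi.zero_apply]
  have hdet : ∀ j, B.det * ξ j = 0 := by
    intro j
    have := congrArg (fun v => B.adjugate.mulVec v j) hB
    simpa [Matrix.mulVec_mulVec, Matrix.adjugate_mul, Matrix.smul_mulVec] using this
  refine ⟨B.det * r, fun y hy => ?_, ?_⟩
  · have := hrI' y hy
    rw [mul_assoc]
    generalize r * y = w at this
    induction this using Submodule.span_induction with
    | mem z hz => obtain ⟨j, rfl⟩ := hz; exact hdet j
    | zero => simp
    | add a b _ _ ha hb => rw [mul_add, ha, hb, add_zero]
    | smul a b _ hb => rw [smul_eq_mul, mul_left_comm, hb, mul_zero]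
  · have hr1 : Ideal.Quotient.mk I r = 1 := by
      rwa [← map_one (Ideal.Quotient.mk I), Ideal.Quotient.eq]
    rw [← Ideal.Quotient.eq, map_mul, hr1, mul_one, RingHom.map_det, RingHom.map_det]
    congr 1
    ext i j
    simp [B, hr1, Ideal.Quotient.eq_zero_iff_mem.mpr (hc i j)]

/-- The determinant of a square matrix of relations on generators of `Ω_{B/A}` belongs to the
Noether different of `B` over `A`. -/
theorem KaehlerDifferential.exists_noetherDifferent {A B : Type*} [CommRing A] [CommRing B]
    [Algebra A B] [Algebra.EssFiniteType A B] {n : ℕ} (x : Fin n → Ω[B⁄A])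
    (hx : Submodule.span B (Set.range x) = ⊤) (M : Matrix (Fin n) (Fin n) B)
    (hM : ∀ r, ∑ j, M r j • x j = 0) :
    ∃ δ : B ⊗[A] B, (∀ b : B, δ * (b ⊗ₜ[A] 1) = δ * (1 ⊗ₜ[A] b)) ∧
      Algebra.TensorProduct.lmul' A δ = M.det := by
  choose ξ hξ using fun j => KaehlerDifferential.fromIdeal_surjective A B (x j)
  have hker : ∀ y : KaehlerDifferential.ideal A B, KaehlerDifferential.fromIdeal A B y = 0 →
      (y : B ⊗[A] B) ∈ KaehlerDifferential.ideal A B ^ 2 := fun y hy =>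
    (Ideal.toCotangent_eq_zero _ y).1 hy
  have hsm : ∀ (b : B) (y : KaehlerDifferential.ideal A B),
      b • KaehlerDifferential.fromIdeal A B y =
        KaehlerDifferential.fromIdeal A B ((b ⊗ₜ[A] (1 : B)) • y) := by
    intro b y
    rw [map_smul, ← algebraMap_smul (B ⊗[A] B) b]
    rfl
  obtain ⟨δ, h1, h2⟩ := Ideal.exists_annihilator_of_relations
    (KaehlerDifferential.ideal_fg A B) (fun j => (ξ j : B ⊗[A] B))
    (by
      intro y hy
      have : KaehlerDifferential.fromIdeal A B ⟨y, hy⟩ ∈ Submodule.span B (Set.range x) :=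
        hx ▸ Submodule.mem_top
      rw [Submodule.mem_span_range_iff_exists_fun] at this
      obtain ⟨c, hc⟩ := this
      have h0 := hker (⟨y, hy⟩ - ∑ j, (c j ⊗ₜ[A] (1 : B)) • ξ j) (by
        rw [map_sub, ← hc, map_sum, sub_eq_zero]
        exact Finset.sum_congr rfl fun j _ => by rw [← hsm, hξ])
      refine Submodule.mem_sup.2 ⟨∑ j, (c j ⊗ₜ[A] (1 : B)) * (ξ j : B ⊗[A] B),
        Ideal.sum_mem _ fun j _ => Ideal.mul_mem_left _ _ (Ideal.subset_span ⟨j, rfl⟩), _, h0, ?_⟩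
      simp)
    (M.map fun b => b ⊗ₜ[A] (1 : B))
    (fun r => by
      have := hker (∑ j, (M r j ⊗ₜ[A] (1 : B)) • ξ j) (by
        rw [map_sum, ← hM r]
        exact Finset.sum_congr rfl fun j _ => by rw [← hsm, hξ])
      simpa using this)
  refine ⟨δ, fun b => ?_, ?_⟩
  · rw [eq_comm, ← sub_eq_zero, ← mul_sub]
    exact h1 _ (KaehlerDifferential.one_smul_sub_smul_one_mem_ideal A b)
  · have h3 : Algebra.TensorProduct.lmul' A δ = Algebra.TensorProduct.lmul' A
        (M.map fun b => b ⊗ₜ[A] (1 : B)).det := by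
      rw [← sub_eq_zero, ← map_sub]
      exact h2
    rw [h3, AlgHom.map_det]
    congr 1
    ext i j
    simp

end

/-! ### Dual bases of `R[X] / F` for a monic polynomial `F` -/

section
open Polynomial

section HornerDual

variable {R : Type*} [CommRing R]

theorem Polynomial.coeff_divX_iterate (F : R[X]) (j i : ℕ) :
    (divX^[j] F).coeff i = F.coeff (i + j) := by
  induction j generalizing i with
  | zero => simp
  | succ j ih => rw [Function.iterate_succ_apply', coeff_divX, ih]; congr 1; ring

/-- Horner's scheme. The iterates of `divX` form the basis dual to the powers of `X`; both the
duality and the later telescoping sum for `dt/dτ` run on this recursion. -/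
theorem Polynomial.divX_iterate_succ_mul_X_add (F : R[X]) (j : ℕ) :
    divX^[j + 1] F * X + C (F.coeff j) = divX^[j] F := by
  conv_rhs => rw [← divX_mul_X_add (divX^[j] F)]
  rw [Function.iterate_succ_apply', coeff_divX_iterate, zero_add]

theorem Polynomial.divX_iterate_eq_one {F : R[X]} (hF : F.Monic) :
    divX^[F.natDegree] F = 1 := by
  ext i
  rw [coeff_divX_iterate, coeff_one]
  split_ifs with h
  · rw [h, zero_add]; exact hF
  · exact coeff_eq_zero_of_natDegree_lt (by omega)

/-- The coefficient of `X ^ (deg F - 1)` in the remainder of the division by `F`. -/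
noncomputable def Polynomial.topCoeffMod (F : R[X]) : R[X] →ₗ[R] R :=
  lcoeff R (F.natDegree - 1) ∘ₗ modByMonicHom F

theorem Polynomial.topCoeffMod_mul_self {F : R[X]} (hF : F.Monic) (g : R[X]) :
    topCoeffMod F (F * g) = 0 := by
  simp [topCoeffMod, modByMonicHom, (modByMonic_eq_zero_iff_dvd hF).2 (dvd_mul_right F g)]

theorem Polynomial.topCoeffMod_of_degree_lt {F : R[X]} (hF : F.Monic) {g : R[X]}
    (hg : g.degree < F.degree) : topCoeffMod F g = g.coeff (F.natDegree - 1) := by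
  nontriviality R
  simp [topCoeffMod, modByMonicHom, (modByMonic_eq_self_iff hF).2 hg]

/-- The powers of `X` and the Horner quotients of a monic polynomial `F` are dual bases of
`R[X] / F` for the functional `topCoeffMod F`. -/
theorem Polynomial.dvd_sub_sum_topCoeffMod {F : R[X]} (hF : F.Monic) (hd : 0 < F.natDegree)
    (g : R[X]) :
    F ∣ g - ∑ j ∈ Finset.range F.natDegree, C (topCoeffMod F (divX^[j + 1] F * g)) * X ^ j := by
  nontriviality R
  have key : ∀ n : ℕ, F ∣ X ^ n -
      ∑ j ∈ Finset.range F.natDegree, C (topCoeffMod F (divX^[j + 1] F * X ^ n)) * X ^ j := by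
    intro n
    induction n with
    | zero =>
      have : ∀ j ∈ Finset.range F.natDegree,
          C (topCoeffMod F (divX^[j + 1] F * X ^ 0)) * X ^ j = if j = 0 then 1 else 0 := by
        intro j hj
        rw [Finset.mem_range] at hj
        rw [pow_zero, mul_one, topCoeffMod_of_degree_lt hF, coeff_divX_iterate]
        · split_ifs with h
          · subst h
            rw [show F.natDegree - 1 + (0 + 1) = F.natDegree by omega, hF.coeff_natDegree]
            simp
          · rw [coeff_eq_zero_of_natDegree_lt (by omega)]
            simp
        · rw [degree_eq_natDegree hF.ne_zero, degree_lt_iff_coeff_zero]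
          intro m hm
          rw [coeff_divX_iterate]
          exact coeff_eq_zero_of_natDegree_lt (by omega)
      rw [Finset.sum_congr rfl this]
      simp [hd]
    | succ n ih =>
      set Λ := topCoeffMod F
      -- By Horner's recursion, multiplication by `X` shifts the index and subtracts `Λ (X ^ n)`
      -- times the lower terms of `F`; together with the boundary term of the shift this is a
      -- multiple of `F`.
      have e1 : ∀ j, C (Λ (divX^[j + 1] F * X ^ (n + 1))) * X ^ j =
          C (Λ (divX^[j] F * X ^ n)) * X ^ j - C (Λ (X ^ n)) * (C (F.coeff j) * X ^ j) := by
        intro j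
        have : divX^[j + 1] F * X ^ (n + 1) = divX^[j] F * X ^ n - F.coeff j • X ^ n := by
          rw [← divX_iterate_succ_mul_X_add F j, smul_eq_C_mul]; ring
        rw [this, map_sub, map_smul, C_sub, smul_eq_mul, C_mul]
        ring
      have e2 : ∑ j ∈ Finset.range F.natDegree, C (F.coeff j) * X ^ j = F - X ^ F.natDegree := by
        have := F.as_sum_range_C_mul_X_pow
        rw [Finset.sum_range_succ, hF.coeff_natDegree, C_1, one_mul] at this
        rw [eq_sub_iff_add_eq, ← this]
      have e3 : ∑ j ∈ Finset.range F.natDegree, C (Λ (divX^[j] F * X ^ n)) * X ^ j =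
          X * (∑ j ∈ Finset.range F.natDegree, C (Λ (divX^[j + 1] F * X ^ n)) * X ^ j) -
            C (Λ (X ^ n)) * X ^ F.natDegree := by
        rw [eq_sub_iff_add_eq]
        have h1 := Finset.sum_range_succ (fun j => C (Λ (divX^[j] F * X ^ n)) * X ^ j) F.natDegree
        rw [divX_iterate_eq_one hF, one_mul] at h1
        rw [← h1, Finset.sum_range_succ', Function.iterate_zero, id, topCoeffMod_mul_self hF,
          Finset.mul_sum]
        simp only [map_zero, zero_mul, add_zero]
        exact Finset.sum_congr rfl fun j _ => by ring
      rw [Finset.sum_congr rfl fun j _ => e1 j, Finset.sum_sub_distrib, ← Finset.mul_sum, e2, e3]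
      have := (ih.mul_left X).add (dvd_mul_left F (C (Λ (X ^ n))))
      refine this.trans (dvd_of_eq ?_)
      ring
  induction g using Polynomial.induction_on' with
  | add p q hp hq =>
    have := hp.add hq
    refine this.trans (dvd_of_eq ?_)
    simp only [mul_add, map_add, add_mul, Finset.sum_add_distrib]
    ring
  | monomial n a =>
    refine ((key n).mul_left (C a)).trans (dvd_of_eq ?_)
    rw [mul_sub, Finset.mul_sum, C_mul_X_pow_eq_monomial]
    congr 1
    refine Finset.sum_congr rfl fun j _ => ?_
    have : divX^[j + 1] F * (C a * X ^ n) = a • (divX^[j + 1] F * X ^ n) := by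
      rw [smul_eq_C_mul]; ring
    rw [← C_mul_X_pow_eq_monomial, this, map_smul, smul_eq_mul, C_mul, mul_assoc]

end HornerDual

/-! ### The Frobenius structure of `V / t ^ N` over `k[t] / t ^ N` -/

section Uniformizer

variable {k V : Type*} [Field k] [CommRing V] [Algebra k V] {τ : V}

/-- A nonzero constant of `k` is a unit of `V`, hence not divisible by `τ`; so a polynomial in `τ`
loses its constant term and one factor `τ` can be cancelled. -/
theorem X_pow_dvd_of_pow_dvd_aeval [IsDomain V] (hτ : Prime τ) (e : ℕ) (p : k[X])
    (h : τ ^ e ∣ aeval τ p) : X ^ e ∣ p := by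
  induction e generalizing p with
  | zero => simp
  | succ e ih =>
    have h0 : p.coeff 0 = 0 := by
      by_contra hc
      have h1 : τ ∣ aeval τ p := (dvd_pow_self τ e.succ_ne_zero).trans h
      rw [← divX_mul_X_add p, map_add, map_mul, aeval_X, aeval_C] at h1
      have h2 := (dvd_add_right (dvd_mul_left τ _)).1 h1
      exact hτ.not_isUnit (isUnit_of_dvd_unit h2 ((IsUnit.mk0 _ hc).map _))
    have hp := divX_mul_X_add p
    rw [h0, C_0, add_zero] at hp
    rw [← hp, map_mul, aeval_X, pow_succ] at h
    rw [← hp, pow_succ]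
    exact mul_dvd_mul_right (ih _ ((mul_dvd_mul_iff_right hτ.ne_zero).1 h)) X

theorem exists_sum_pow_dvd_sub (hres : ∀ a : V, ∃ c : k, τ ∣ a - algebraMap k V c) (e : ℕ)
    (a : V) : ∃ c : ℕ → k, τ ^ e ∣ a - ∑ i ∈ Finset.range e, algebraMap k V (c i) * τ ^ i := by
  induction e generalizing a with
  | zero => simp
  | succ e ih =>
    obtain ⟨c, b, hb⟩ := hres a
    obtain ⟨c', b', hb'⟩ := ih b
    refine ⟨fun i => Nat.casesOn i c c', b', ?_⟩
    rw [Finset.sum_range_succ']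
    have : ∑ i ∈ Finset.range e, algebraMap k V (c' i) * τ ^ (i + 1) =
        τ * ∑ i ∈ Finset.range e, algebraMap k V (c' i) * τ ^ i := by
      rw [Finset.mul_sum]
      exact Finset.sum_congr rfl fun i _ => by ring
    simp only [this, pow_zero, mul_one]
    linear_combination hb + τ * hb'

variable [Algebra k[X] V] [IsScalarTower k k[X] V]

/-- Blocks of `e` consecutive digits of the `τ`-adic expansion are digits in base `t`. Hence `1, τ,
…, τ ^ (e - 1)` generate `V / t ^ N` over `k[t]`. -/
theorem exists_sum_polynomial_pow_dvd_sub
    (hres : ∀ a : V, ∃ c : k, τ ∣ a - algebraMap k V c) {e : ℕ}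
    (ht : Associated (algebraMap k[X] V X) (τ ^ e)) (N : ℕ) (a : V) :
    ∃ r : ℕ → k[X], algebraMap k[X] V X ^ N ∣
      a - ∑ i ∈ Finset.range e, algebraMap k[X] V (r i) * τ ^ i := by
  induction N generalizing a with
  | zero => simp
  | succ N ih =>
    obtain ⟨c, hc⟩ := exists_sum_pow_dvd_sub hres e a
    obtain ⟨b, hb⟩ := ht.dvd.trans hc
    obtain ⟨r, b', hb'⟩ := ih b
    refine ⟨fun i => C (c i) + X * r i, b', ?_⟩
    simp only [map_add, map_mul, add_mul, Finset.sum_add_distrib]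
    have e1 : ∑ i ∈ Finset.range e, algebraMap k[X] V X * algebraMap k[X] V (r i) * τ ^ i =
        algebraMap k[X] V X * ∑ i ∈ Finset.range e, algebraMap k[X] V (r i) * τ ^ i := by
      rw [Finset.mul_sum]
      exact Finset.sum_congr rfl fun i _ => by ring
    have e2 : ∀ i, algebraMap k[X] V (C (c i)) = algebraMap k V (c i) := fun i => by
      rw [IsScalarTower.algebraMap_apply k k[X] V, Polynomial.algebraMap_eq]
    simp only [e1, e2]
    linear_combination hb + algebraMap k[X] V X * hb'

/-- Independence of the same generators: modulo `t` only the constant terms of the `r i` survive,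
and they form a polynomial of degree less than `e` in `τ` divisible by `τ ^ e`, so they vanish and a
factor `t` can be cancelled. -/
theorem X_pow_dvd_of_pow_dvd_sum [IsDomain V] (hτ : Prime τ) {e : ℕ}
    (ht : Associated (algebraMap k[X] V X) (τ ^ e)) (N : ℕ) (r : ℕ → k[X])
    (h : algebraMap k[X] V X ^ N ∣ ∑ i ∈ Finset.range e, algebraMap k[X] V (r i) * τ ^ i)
    (i : ℕ) (hi : i < e) : X ^ N ∣ r i := by
  induction N generalizing r with
  | zero => simp
  | succ N ih =>
    set t := algebraMap k[X] V X with t_def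
    have ht0 : t ≠ 0 := fun h0 => pow_ne_zero e hτ.ne_zero (ht.eq_zero_iff.1 h0)
    have e1 : ∑ i ∈ Finset.range e, algebraMap k[X] V (r i) * τ ^ i =
        t * (∑ i ∈ Finset.range e, algebraMap k[X] V (divX (r i)) * τ ^ i) +
          aeval τ (∑ i ∈ Finset.range e, C ((r i).coeff 0) * X ^ i) := by
      simp only [map_sum, map_mul, map_pow, aeval_C, aeval_X, Finset.mul_sum,
        ← Finset.sum_add_distrib]
      refine Finset.sum_congr rfl fun i _ => ?_
      conv_lhs => rw [← divX_mul_X_add (r i)]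
      rw [map_add, map_mul, ← t_def, IsScalarTower.algebraMap_apply k k[X] V,
        Polynomial.algebraMap_eq]
      ring
    have h1 : τ ^ e ∣ aeval τ (∑ i ∈ Finset.range e, C ((r i).coeff 0) * X ^ i) := by
      refine ht.symm.dvd.trans ?_
      have := (dvd_pow_self t N.succ_ne_zero).trans h
      rw [e1] at this
      exact (dvd_add_right (dvd_mul_right t _)).1 this
    have h2 := X_pow_dvd_of_pow_dvd_aeval hτ e _ h1
    have h3 : ∀ i < e, (r i).coeff 0 = 0 := by
      intro i hi
      have := (X_pow_dvd_iff.1 h2) i hi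
      simpa [finsetSum_coeff, coeff_C_mul, coeff_X_pow, hi] using this
    have h4 : ∑ i ∈ Finset.range e, C ((r i).coeff 0) * X ^ i = 0 :=
      Finset.sum_eq_zero fun i hi => by rw [h3 i (Finset.mem_range.1 hi), C_0, zero_mul]
    rw [e1, h4, map_zero, add_zero, pow_succ', mul_dvd_mul_iff_left ht0] at h
    have := ih _ h
    rw [← divX_mul_X_add (r i), h3 i hi, C_0, add_zero, pow_succ]
    exact mul_dvd_mul_right this X

open Ideal in
/-- For a discrete valuation ring `V` over `k`, with residue field `k` and uniformizer `τ`, and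
for `t ∈ V` of valuation `e`, the ring `V / t ^ N` is a Frobenius algebra over `k[t] / t ^ N`, and
the product of its dual bases is, up to `t ^ (N - 1)`, a multiple of `dt / dτ`. -/
theorem exists_frobenius_quotient [IsDomain V] (hτ : Prime τ)
    (hres : ∀ a : V, ∃ c : k, τ ∣ a - algebraMap k V c) {e : ℕ} (he : 0 < e)
    (ht : Associated (algebraMap k[X] V X) (τ ^ e)) {N : ℕ} (hN : 0 < N)
    (D : Derivation k V V) (hD : D τ = 1) :
    ∃ (l : (V ⧸ span {algebraMap k[X] V X ^ N}) →ₗ[k[X]] k[X] ⧸ span {(X : k[X]) ^ N})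
      (u v : Fin e → V) (a b : V),
      (∀ q : V ⧸ span {algebraMap k[X] V X ^ N}, ∀ r : Fin e → k[X],
        (∀ j, Ideal.Quotient.mk _ (r j) = l (Ideal.Quotient.mk _ (v j) * q)) →
          ∑ j, algebraMap k[X] _ (r j) * Ideal.Quotient.mk _ (u j) = q) ∧
      ∑ j, u j * v j = a * D (algebraMap k[X] V X) + algebraMap k[X] V X ^ (N - 1) * b := by
  set t := algebraMap k[X] V X with t_def
  -- The expansion of `τ ^ e` gives the monic equation `F` of `τ` modulo `t ^ N`.
  obtain ⟨r, hr⟩ := exists_sum_polynomial_pow_dvd_sub hres ht N (τ ^ e)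
  let G : k[X][X] := ∑ i ∈ Finset.range e, C (r i) * X ^ i
  have hG : G.degree < e := by
    refine (degree_sum_le _ _).trans_lt ((Finset.sup_lt_iff (by exact WithBot.bot_lt_coe e)).2 ?_)
    intro i hi
    exact (degree_C_mul_X_pow_le i (r i)).trans_lt (by exact_mod_cast Finset.mem_range.1 hi)
  let F : k[X][X] := X ^ e - G
  have hF : F.Monic := monic_X_pow_sub (by exact hG)
  have hdeg : F.natDegree = e := by
    rw [natDegree_sub_eq_left_of_natDegree_lt, natDegree_X_pow]
    rw [natDegree_X_pow]
    by_cases hG0 : G = 0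
    · simpa [hG0] using he
    · exact (natDegree_lt_iff_degree_lt hG0).2 hG
  let ev : k[X][X] →ₐ[k[X]] V := aeval τ
  have hevF : t ^ N ∣ ev F := by
    refine hr.trans (dvd_of_eq ?_)
    simp [ev, F, G]
  have hevlt : ∀ g : k[X][X], g.degree < e →
      ev g = ∑ i ∈ Finset.range e, algebraMap k[X] V (g.coeff i) * τ ^ i := by
    intro g hg
    by_cases hg0 : g = 0
    · simp [hg0]
    conv_lhs => rw [g.as_sum_range' e ((natDegree_lt_iff_degree_lt hg0).2 hg)]
    simp [ev, ← C_mul_X_pow_eq_monomial]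
  let π : k[X][X] →ₗ[k[X]] (V ⧸ span {t ^ N}) :=
    (Ideal.Quotient.mkₐ k[X] (span {t ^ N})).toLinearMap ∘ₗ ev.toLinearMap
  have hπ : Function.Surjective π := by
    intro q
    obtain ⟨q, rfl⟩ := Ideal.Quotient.mk_surjective q
    obtain ⟨s, hs⟩ := exists_sum_polynomial_pow_dvd_sub hres ht N q
    refine ⟨∑ i ∈ Finset.range e, C (s i) * X ^ i, ?_⟩
    symm
    change Ideal.Quotient.mk _ q = Ideal.Quotient.mk _ (ev _)
    rw [Ideal.Quotient.eq, Ideal.mem_span_singleton]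
    refine hs.trans (dvd_of_eq ?_)
    simp [ev]
  let l0 : k[X][X] →ₗ[k[X]] k[X] ⧸ span {(X : k[X]) ^ N} :=
    (Ideal.Quotient.mkₐ k[X] (span {(X : k[X]) ^ N})).toLinearMap ∘ₗ topCoeffMod F
  -- If `g(τ)` is divisible by `t ^ N`, so is the value at `τ` of the remainder of `g` by `F`, and
  -- independence bounds its coefficients. Thus the top coefficient descends to `V / t ^ N`.
  have hker : LinearMap.ker π ≤ LinearMap.ker l0 := by
    intro g hg
    have hg1 : t ^ N ∣ ev g := by
      rw [← Ideal.mem_span_singleton, ← Ideal.Quotient.eq_zero_iff_mem]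
      exact hg
    change Ideal.Quotient.mk _ ((g %ₘ F).coeff (F.natDegree - 1)) = 0
    rw [Ideal.Quotient.eq_zero_iff_mem, Ideal.mem_span_singleton, hdeg]
    have hlt : (g %ₘ F).degree < e := by
      have := degree_modByMonic_lt g hF
      rwa [degree_eq_natDegree hF.ne_zero, hdeg] at this
    refine X_pow_dvd_of_pow_dvd_sum hτ ht N (g %ₘ F).coeff ?_ _ (by omega)
    rw [← hevlt _ hlt, modByMonic_eq_sub_mul_div, map_sub, map_mul]
    exact hg1.sub (hevF.mul_right _)
  let l : (V ⧸ span {t ^ N}) →ₗ[k[X]] k[X] ⧸ span {(X : k[X]) ^ N} :=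
    (LinearMap.ker π).liftQ l0 hker ∘ₗ (π.quotKerEquivOfSurjective hπ).symm.toLinearMap
  have hl : ∀ g, l (Ideal.Quotient.mk _ (ev g)) = Ideal.Quotient.mk _ (topCoeffMod F g) := by
    intro g
    have : (π.quotKerEquivOfSurjective hπ).symm (Ideal.Quotient.mk _ (ev g)) =
        (LinearMap.ker π).mkQ g := by
      rw [LinearEquiv.symm_apply_eq]
      rfl
    change (LinearMap.ker π).liftQ l0 hker _ = _
    erw [this]
    rfl
  -- Telescoping from `F` at `j = 0` to `1` at `j = e` computes `D (F(τ))` as the sum of the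
  -- products of dual basis elements plus a multiple of `D t`. Since `F(τ) = t ^ N * w`, its
  -- derivative is a multiple of `D t` plus `t ^ N * D w`.
  have htel := Finset.sum_range_sub' (fun j => τ ^ j * D (ev (divX^[j] F))) e
  have hstep : ∀ j, τ ^ j * D (ev (divX^[j] F)) - τ ^ (j + 1) * D (ev (divX^[j + 1] F)) =
      τ ^ j * ev (divX^[j + 1] F) +
        τ ^ j * aeval t (derivative (F.coeff j)) * D t := by
    intro j
    have h1 : D (algebraMap k[X] V (F.coeff j)) =
        aeval t (derivative (F.coeff j)) * D t := by
      have : ∀ p : k[X], algebraMap k[X] V p = aeval t p := fun p => by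
        have : (IsScalarTower.toAlgHom k k[X] V) = aeval t := by
          ext; simp [t_def]
        exact DFunLike.congr_fun this p
      rw [this, Derivation.map_aeval, smul_eq_mul]
    rw [← divX_iterate_succ_mul_X_add F j, map_add, map_mul]
    simp only [ev, aeval_X, aeval_C, map_add, h1, Derivation.leibniz, hD, smul_eq_mul]
    ring
  obtain ⟨w, hw⟩ := hevF
  refine ⟨l, fun j => τ ^ (j : ℕ), fun j => ev (divX^[(j : ℕ) + 1] F),
    N * t ^ (N - 1) * w - ∑ j ∈ Finset.range e, τ ^ j * aeval t (derivative (F.coeff j)), t * D w,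
    ?_, ?_⟩
  · intro q s hs
    obtain ⟨g, rfl⟩ := hπ q
    change _ = Ideal.Quotient.mk _ (ev g)
    have hdual := dvd_sub_sum_topCoeffMod hF (by omega) g
    have h1 : t ^ N ∣ ev g - ∑ j : Fin e,
        algebraMap k[X] V (topCoeffMod F (divX^[(j : ℕ) + 1] F * g)) * τ ^ (j : ℕ) := by
      have := (Dvd.intro _ hw.symm).trans (map_dvd ev hdual)
      rw [hdeg, Finset.sum_range] at this
      simpa [ev] using this
    rw [← Ideal.mem_span_singleton, ← Ideal.Quotient.eq] at h1
    rw [h1, map_sum]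
    refine Finset.sum_congr rfl fun j _ => ?_
    rw [map_mul]
    congr 1
    have h2 := hs j
    change _ = l (Ideal.Quotient.mk _ _ * Ideal.Quotient.mk _ (ev g)) at h2
    rw [← map_mul, ← map_mul, hl, Ideal.Quotient.eq, Ideal.mem_span_singleton] at h2
    change Ideal.Quotient.mk _ (algebraMap k[X] V (s j)) = _
    rw [Ideal.Quotient.eq, Ideal.mem_span_singleton, ← map_sub, t_def, ← map_pow]
    exact map_dvd _ h2
  · have hone : D (ev (divX^[e] F)) = 0 := by
      have := divX_iterate_eq_one hF
      rw [hdeg] at this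
      rw [this, map_one, Derivation.map_one_eq_zero]
    rw [hone, Finset.sum_congr rfl fun j _ => hstep j, Finset.sum_add_distrib,
      ← Finset.sum_mul] at htel
    have hDF : D (ev F) = N * t ^ (N - 1) * w * D t + t ^ N * D w := by
      rw [hw, Derivation.leibniz, Derivation.leibniz_pow]
      simp only [smul_eq_mul, nsmul_eq_mul]
      ring
    rw [Finset.sum_range] at htel
    simp only [Function.iterate_zero, id, pow_zero, one_mul, mul_zero, sub_zero, hDF] at htel
    have : t ^ N = t ^ (N - 1) * t := by rw [← pow_succ, Nat.sub_add_cancel hN]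
    rw [this] at htel
    linear_combination htel

end Uniformizer

end

/-! ### Contracting the Noether different with a Frobenius functional -/

section
open Polynomial TensorProduct

section NoetherFrobenius

variable {R O Q : Type*} [CommRing R] [CommRing O] [CommRing Q] [Algebra R O] [Algebra R Q]

/-- If `δ` annihilates the diagonal ideal of `O ⊗ O`, and `Q` is a Frobenius algebra which agrees
with its subring `O` up to a denominator `s`, then, up to `s`, the elements `δ / h` multiply `Q`
into `O`, where `h` is the product of the dual bases of `Q`. -/
theorem noetherDifferent_mul_frobenius (φ : O →ₐ[R] Q) (𝔟 : Ideal R)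
    (h𝔟 : ∀ r ∈ 𝔟, algebraMap R Q r = 0) (l : Q →ₗ[R] R ⧸ 𝔟) {ι : Type*} [Fintype ι]
    (u v : ι → Q)
    (hdual : ∀ q : Q, ∀ r : ι → R, (∀ j, Ideal.Quotient.mk 𝔟 (r j) = l (v j * q)) →
      ∑ j, algebraMap R Q (r j) * u j = q)
    (δ : O ⊗[R] O) (hδ : ∀ b : O, δ * (b ⊗ₜ[R] 1) = δ * (1 ⊗ₜ[R] b))
    (s : O) (hs : ∀ q : Q, ∃ o : O, φ o = φ s * q) :
    (∀ y : Q, ∃ o : O, φ s * (∑ j, u j * v j) * φ o =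
        φ s * φ (Algebra.TensorProduct.lmul' R δ) * y) ∧
      ∃ c : Q, φ s * (∑ j, u j * v j) * c = φ s * φ (Algebra.TensorProduct.lmul' R δ) := by
  let ψ : (R ⧸ 𝔟) →ₗ[R] Q := 𝔟.liftQ (Algebra.linearMap R Q) (fun r hr => h𝔟 r hr)
  have hψ : ∀ r, ψ (Ideal.Quotient.mk 𝔟 r) = algebraMap R Q r := fun r => rfl
  -- Apply the functional `l (y * ·)` to the second factor and multiply into the first; the values
  -- lie in the image of `O`.
  let Φ : Q → (O ⊗[R] O →ₗ[R] Q) := fun y => LinearMap.mul' R Q ∘ₗ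
    TensorProduct.map φ.toLinearMap (ψ ∘ₗ l ∘ₗ LinearMap.mulLeft R y ∘ₗ φ.toLinearMap)
  have hΦ : ∀ y a b, Φ y (a ⊗ₜ[R] b) = φ a * ψ (l (y * φ b)) := fun y a b => by
    simp [Φ]
  have hleft : ∀ y o x, Φ y (x * (o ⊗ₜ[R] 1)) = φ o * Φ y x := by
    intro y o x
    induction x with
    | zero => simp
    | add a b ha hb => simp only [add_mul, map_add, ha, hb, mul_add]
    | tmul a b => rw [Algebra.TensorProduct.tmul_mul_tmul, hΦ, hΦ, map_mul, mul_one]; ring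
  have hright : ∀ y o x, Φ y (x * (1 ⊗ₜ[R] o)) = Φ (y * φ o) x := by
    intro y o x
    induction x with
    | zero => simp
    | add a b ha hb => simp only [add_mul, map_add, ha, hb]
    | tmul a b =>
      rw [Algebra.TensorProduct.tmul_mul_tmul, hΦ, hΦ, mul_one, mul_assoc y,
        ← map_mul φ, mul_comm o]
  -- Because `δ` does not distinguish the two factors, `Φ · δ` is `O`-linear; after multiplication
  -- by `s` it becomes `Q`-linear, as `s Q` comes from `O`.
  have hlin : ∀ y o, Φ (y * φ o) δ = φ o * Φ y δ := fun y o => by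
    rw [← hright, ← hδ, hleft]
  have hrange : ∀ y x, ∃ o, Φ y x = φ o := by
    intro y x
    induction x with
    | zero => exact ⟨0, by simp⟩
    | add a b ha hb =>
      obtain ⟨o, ho⟩ := ha
      obtain ⟨o', ho'⟩ := hb
      exact ⟨o + o', by rw [map_add, map_add, ho, ho']⟩
    | tmul a b =>
      obtain ⟨r, hr⟩ := Ideal.Quotient.mk_surjective (l (y * φ b))
      exact ⟨a * algebraMap R O r, by rw [hΦ, ← hr, hψ, map_mul, AlgHom.commutes]⟩
  have hsum : ∀ x, ∑ j, u j * Φ (v j) x = φ (Algebra.TensorProduct.lmul' R x) := by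
    intro x
    induction x with
    | zero => simp
    | add a b ha hb => simp only [map_add, mul_add, Finset.sum_add_distrib, ha, hb]
    | tmul a b =>
      choose r hr using fun j => Ideal.Quotient.mk_surjective (l (v j * φ b))
      rw [Algebra.TensorProduct.lmul'_apply_tmul, map_mul]
      rw [← hdual (φ b) r hr]
      rw [Finset.mul_sum]
      refine Finset.sum_congr rfl fun j _ => ?_
      rw [hΦ, ← hr j, hψ]
      ring
  have hmul : ∀ y q, φ s * Φ (y * q) δ = φ s * (q * Φ y δ) := by
    intro y q
    obtain ⟨o, ho⟩ := hs q
    rw [← hlin, mul_assoc, mul_comm q, ← ho, hlin, ho, mul_assoc]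
  -- Writing `Φ (v j) δ` as `v j * Φ 1 δ`, up to `s`, in the dual basis identity `hsum` identifies
  -- `Φ 1 δ` with the product of `δ` divided by `∑ u j * v j`.
  have hone : φ s * (∑ j, u j * v j) * Φ 1 δ = φ s * φ (Algebra.TensorProduct.lmul' R δ) := by
    rw [← hsum, mul_assoc, Finset.sum_mul, Finset.mul_sum, Finset.mul_sum]
    refine Finset.sum_congr rfl fun j _ => ?_
    have := hmul 1 (v j)
    rw [one_mul] at this
    linear_combination - u j * this
  refine ⟨fun y => ?_, Φ 1 δ, hone⟩
  obtain ⟨o, ho⟩ := hrange y δ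
  refine ⟨o, ?_⟩
  have := hmul 1 y
  rw [one_mul] at this
  rw [← ho]
  linear_combination (∑ j, u j * v j) * this + y * hone

/-- The Frobenius structure of a finite product. -/
theorem frobenius_pi {P : Type*} [Fintype P] [DecidableEq P] {Q : P → Type*}
    [∀ p, CommRing (Q p)] [∀ p, Algebra R (Q p)] (𝔟 : Ideal R) (l : ∀ p, Q p →ₗ[R] R ⧸ 𝔟)
    {e : P → ℕ} (u v : ∀ p, Fin (e p) → Q p)
    (hdual : ∀ p, ∀ q : Q p, ∀ r : Fin (e p) → R,
      (∀ j, Ideal.Quotient.mk 𝔟 (r j) = l p (v p j * q)) →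
        ∑ j, algebraMap R (Q p) (r j) * u p j = q)
    (q : ∀ p, Q p) (r : (Σ p, Fin (e p)) → R)
    (hr : ∀ j, Ideal.Quotient.mk 𝔟 (r j) =
      (∑ p, l p ∘ₗ LinearMap.proj p) (Pi.single j.1 (v j.1 j.2) * q)) :
    ∑ j, algebraMap R (∀ p, Q p) (r j) * Pi.single j.1 (u j.1 j.2) = q := by
  have h1 : ∀ p j, Ideal.Quotient.mk 𝔟 (r ⟨p, j⟩) = l p (v p j * q p) := by
    intro p j
    rw [hr, LinearMap.sum_apply, Finset.sum_eq_single p]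
    · simp
    · intro p' _ hp'
      simp [Pi.single_eq_of_ne hp']
    · simp
  funext p
  rw [← hdual p (q p) (fun j => r ⟨p, j⟩) (h1 p), Fintype.sum_sigma, Finset.sum_apply,
    Finset.sum_eq_single p]
  · rw [Finset.sum_apply]
    refine Finset.sum_congr rfl fun j _ => ?_
    simp
  · intro p' _ hp'
    rw [Finset.sum_apply]
    exact Finset.sum_eq_zero fun j _ => by simp [Pi.single_eq_of_ne hp'.symm]
  · simp

end NoetherFrobenius

/-! ### Generic choices and cancellation of bounded valuations -/

section Generic

/-- Over an infinite field a vector space is not a finite union of proper subspaces. This turns a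
choice that works at each point separately into one that works at all points. -/
theorem exists_forall_notMem_of_ne_top {k E : Type*} [Field k] [Infinite k] [AddCommGroup E]
    [Module k E] {P : Type*} [Finite P] (U : P → Submodule k E) (hU : ∀ p, U p ≠ ⊤) :
    ∃ v : E, ∀ p, v ∉ U p := by
  classical
  cases nonempty_fintype P
  have := Subspace.biUnion_ne_univ_of_top_notMem (s := Finset.univ.image U) (by simpa using hU)
  obtain ⟨v, hv⟩ := (Set.ne_univ_iff_exists_notMem _).1 this
  exact ⟨v, fun p hp => hv (by simpa using ⟨p, hp⟩)⟩

/-- Dividing by an element of valuation at most `w` costs at most `w` in precision. -/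
theorem pow_dvd_of_pow_dvd_mul_of_not_dvd {V : Type*} [CommRing V] [IsDomain V]
    {τ : V} (hτ : Prime τ) {w M N : ℕ} {x y : V} (hx : ¬ τ ^ (w + 1) ∣ x)
    (hxy : τ ^ N ∣ x * y) (hN : M + w ≤ N) : τ ^ M ∣ y := by
  obtain ⟨i, hi, hi'⟩ : ∃ i, τ ^ i ∣ x ∧ ¬ τ ^ (i + 1) ∣ x := by
    by_contra! h
    exact hx (Nat.rec (by simp) h (w + 1))
  obtain ⟨x', rfl⟩ := hi
  have hiw : i ≤ w := by
    by_contra! h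
    exact hx ((pow_dvd_pow τ h).trans (dvd_mul_right _ _))
  have hx' : ¬ τ ∣ x' := fun h => hi' (by rw [pow_succ]; exact mul_dvd_mul_left _ h)
  have h1 : τ ^ i * τ ^ (N - i) ∣ τ ^ i * (x' * y) := by
    rw [← pow_add, Nat.add_sub_cancel' (by omega), ← mul_assoc]; exact hxy
  rw [mul_dvd_mul_iff_left (pow_ne_zero _ hτ.ne_zero)] at h1
  exact (pow_dvd_pow τ (by omega)).trans (hτ.pow_dvd_of_dvd_mul_left _ hx' h1)

end Generic

end

/-! ### Elements of small valuation in the Noether different -/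

section
open Polynomial TensorProduct

section Approximation

variable {k O : Type*} [Field k] [CommRing O] [Algebra k O]

/-- A minor of a relation matrix of `Ω_{O/k}` whose valuation is at most `J` yields an element of
the Noether different of `O` over `k[t]` with the same property, if the valuation of `D t` is the
smallest possible. -/
theorem exists_noetherDifferent_not_dvd [Algebra.EssFiniteType k O] [Algebra k[X] O]
    [IsScalarTower k k[X] O] {V : Type*} [CommRing V] [IsDomain V] [Algebra k V] [Algebra O V]
    [IsScalarTower k O V] {τ : V} (hτ : Prime τ) (D : Derivation k V V) {K J : ℕ}
    (hK : ∀ o : O, τ ^ K ∣ D (algebraMap O V o))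
    (ht : ¬ τ ^ (K + 1) ∣ D (algebraMap O V (algebraMap k[X] O X)))
    (hJ : ∃ d ∈ fittingIdeal O (Ω[O⁄k]) 1, ¬ τ ^ (J + 1) ∣ algebraMap O V d) :
    ∃ δ : O ⊗[k[X]] O, (∀ b : O, δ * (b ⊗ₜ[k[X]] 1) = δ * (1 ⊗ₜ[k[X]] b)) ∧
      ¬ τ ^ (J + 1) ∣ algebraMap O V (Algebra.TensorProduct.lmul' k[X] δ) := by
  set t : O := algebraMap k[X] O X with t_def
  have : Algebra.EssFiniteType k[X] O := Algebra.EssFiniteType.of_comp k k[X] O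
  obtain ⟨d, ⟨m, x, A, c, hx, hA, rfl⟩, hd⟩ :
      ∃ d ∈ {d | ∃ (m : ℕ) (x : Fin (m + 1) → Ω[O⁄k]) (A : Matrix (Fin m) (Fin (m + 1)) O)
        (c : Fin m → Fin (m + 1)), Submodule.span O (Set.range x) = ⊤ ∧
          (∀ r, ∑ j, A r j • x j = 0) ∧ d = (A.submatrix id c).det},
        ¬ τ ^ (J + 1) ∣ algebraMap O V d := by
    by_contra! h
    obtain ⟨d, hd, hd'⟩ := hJ
    refine hd' ?_
    rw [← Ideal.mem_span_singleton]
    have : fittingIdeal O (Ω[O⁄k]) 1 ≤ (Ideal.span {τ ^ (J + 1)}).comap (algebraMap O V) :=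
      Ideal.span_le.2 fun d hd => Ideal.mem_span_singleton.2 (h d hd)
    exact this hd
  have hc : Function.Injective c := by
    by_contra hc
    rw [Function.Injective] at hc
    push Not at hc
    obtain ⟨i, j, hij, hne⟩ := hc
    refine hd ?_
    rw [Matrix.det_zero_of_column_eq hne (by intro r; simp [hij]), map_zero]
    exact dvd_zero _
  -- The one column omitted by the minor; the new row will be expanded along it.
  obtain ⟨c₀, hc₀⟩ : ∃ c₀, c₀ ∉ Set.range c := by
    by_contra! h
    have := Fintype.card_le_of_surjective c h
    simp at this
  obtain ⟨g, hg⟩ := (Submodule.mem_span_range_iff_exists_fun O).1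
    (hx ▸ Submodule.mem_top : KaehlerDifferential.D k O t ∈ Submodule.span O (Set.range x))
  -- Over `k[t]` the differential `dt` vanishes, so its coordinates `g` are one more relation and
  -- the matrix becomes square.
  let B : Matrix (Fin (m + 1)) (Fin (m + 1)) O := Matrix.of (Matrix.vecCons g A)
  have hB0 : ∀ j, B 0 j = g j := fun j => rfl
  have hBs : ∀ i j, B (Fin.succ i) j = A i j := fun i j => rfl
  let π := KaehlerDifferential.map k k[X] O O
  obtain ⟨δ, hδ, hδ'⟩ := KaehlerDifferential.exists_noetherDifferent (A := k[X])
    (fun j => π (x j))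
    (by
      have h1 : Set.range (fun j => π (x j)) = π '' Set.range x := by
        rw [← Set.range_comp]; rfl
      rw [h1, Submodule.span_image, hx, Submodule.map_top, LinearMap.range_eq_top]
      exact KaehlerDifferential.map_surjective k k[X] O)
    B
    (by
      intro r
      refine Fin.cases ?_ (fun r => ?_) r
      · simp only [hB0, ← map_smul, ← map_sum, hg]
        simp [π, t_def]
      · simp only [hBs, ← map_smul, ← map_sum, hA, map_zero])
  refine ⟨δ, hδ, fun hdvd => hd ?_⟩
  rw [hδ'] at hdvd
  let D' : Ω[O⁄k] →ₗ[O] V := (D.compAlgebraMap O).liftKaehlerDifferential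
  have hD' : ∀ o, D' (KaehlerDifferential.D k O o) = D (algebraMap O V o) := fun o => by
    simp [D']
  have hD'K : ∀ y, τ ^ K ∣ D' y := by
    intro y
    have : y ∈ Submodule.span O (Set.range (KaehlerDifferential.D k O)) := by
      rw [KaehlerDifferential.span_range_derivation]; trivial
    induction this using Submodule.span_induction with
    | mem y hy => obtain ⟨o, rfl⟩ := hy; rw [hD']; exact hK o
    | zero => simp
    | add a b _ _ ha hb => rw [map_add]; exact ha.add hb
    | smul a b _ hb => rw [map_smul, Algebra.smul_def]; exact hb.mul_left _
  let ρ : Fin (m + 1) → V := fun j => D' (x j)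
  set f := algebraMap O V with f_def
  have hρ : ∑ j, f (g j) * ρ j = D (f t) := by
    rw [← hD', ← hg, map_sum]
    exact Finset.sum_congr rfl fun j _ => by rw [map_smul, Algebra.smul_def]
  have hAρ : ∀ r, ∑ j, f (A r j) * ρ j = 0 := by
    intro r
    rw [← map_zero D', ← hA r, map_sum]
    exact Finset.sum_congr rfl fun j _ => by rw [map_smul, Algebra.smul_def]
  have hρ0 : ρ ≠ 0 := by
    intro h
    refine ht ?_
    rw [← hρ, h]
    simp
  let BV : Matrix (Fin (m + 1)) (Fin (m + 1)) V := B.map f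
  let E : Fin (m + 1) → V := Pi.single c₀ 1
  -- Cramer's rule: the nonzero vector `ρ` is killed by the rows of `A` and pairs with `g` to `D t`,
  -- so it is killed by the matrix whose first row is `ρ c₀ • g - D t • E`.
  have hdet : ρ c₀ * BV.det = D (f t) * (BV.updateRow 0 E).det := by
    have h0 : (BV.updateRow 0 (ρ c₀ • (fun j => f (g j)) + (-D (f t)) • E)).det = 0 := by
      refine Matrix.exists_mulVec_eq_zero_iff.1 ⟨ρ, hρ0, ?_⟩
      funext i
      refine Fin.cases ?_ (fun i => ?_) i
      · simp only [Matrix.mulVec, dotProduct, Matrix.updateRow_self, Pi.add_apply, Pi.smul_apply,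
          smul_eq_mul, add_mul, Finset.sum_add_distrib, mul_assoc, ← Finset.mul_sum, hρ,
          Pi.zero_apply, E]
        simp [Pi.single_apply]
        ring
      · simp only [Matrix.mulVec, dotProduct,
          Matrix.updateRow_ne (Fin.succ_ne_zero i), Pi.zero_apply]
        exact hAρ i
    rw [Matrix.det_updateRow_add, Matrix.det_updateRow_smul, Matrix.det_updateRow_smul] at h0
    have : BV.updateRow 0 (fun j => f (g j)) = BV := by
      conv_rhs => rw [← Matrix.updateRow_eq_self BV 0]
      rfl
    rw [this] at h0
    linear_combination h0
  let σ : Fin (m + 1) → Fin (m + 1) := Fin.cons c₀ c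
  have hσ : Function.Bijective σ := by
    refine Finite.injective_iff_bijective.1 (Fin.cons_injective_iff.2 ⟨hc₀, hc⟩)
  have hminor : ((BV.updateRow 0 E).submatrix id σ).det = f (A.submatrix id c).det := by
    rw [Matrix.det_succ_row_zero, Finset.sum_eq_single 0]
    · rw [RingHom.map_det]
      simp only [Fin.val_zero, pow_zero, one_mul, Matrix.submatrix_apply, id,
        Matrix.updateRow_self, E, σ, Fin.cons_zero, Pi.single_eq_same]
      congr 1
    · intro j _ hj
      obtain ⟨j, rfl⟩ := Fin.exists_succ_eq.2 hj
      have : c j ≠ c₀ := fun h => hc₀ ⟨j, h⟩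
      simp [E, σ, this]
    · simp
  have hperm : ((BV.updateRow 0 E).submatrix id σ).det =
      Equiv.Perm.sign (Equiv.ofBijective σ hσ) * (BV.updateRow 0 E).det :=
    Matrix.det_permute' (Equiv.ofBijective σ hσ) _
  rw [← hminor, hperm]
  refine Dvd.dvd.mul_left ?_ _
  -- The factor `ρ c₀` has valuation at least `K` while `D t` has valuation at most `K`, so the
  -- minor inherits the divisibility assumed for the determinant.
  refine pow_dvd_of_pow_dvd_mul_of_not_dvd hτ ht (N := K + (J + 1)) ?_ (by omega)
  rw [← hdet, pow_add]
  refine mul_dvd_mul (hD'K _) ?_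
  rwa [f_def, RingHom.map_det] at hdvd

end Approximation

end

/-! ### Approximation of elements of valuation at least `J - K` by the local ring -/

section
open Polynomial TensorProduct

section Approximation

/-- The Noether different of `O` over `R`. -/
def noetherDifferent (R O : Type*) [CommRing R] [CommRing O] [Algebra R O] : Ideal O where
  carrier := {d | ∃ δ : O ⊗[R] O, (∀ b : O, δ * (b ⊗ₜ[R] 1) = δ * (1 ⊗ₜ[R] b)) ∧
    Algebra.TensorProduct.lmul' R δ = d}
  zero_mem' := ⟨0, by simp, by simp⟩
  add_mem' := by
    rintro _ _ ⟨δ, h, rfl⟩ ⟨δ', h', rfl⟩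
    exact ⟨δ + δ', fun b => by rw [add_mul, add_mul, h, h'], map_add _ _ _⟩
  smul_mem' := by
    rintro o _ ⟨δ, h, rfl⟩
    exact ⟨(o ⊗ₜ[R] 1) * δ, fun b => by rw [mul_assoc, mul_assoc, h], by simp⟩

/-- Let `O` be a local ring of a curve over `k`, and `V p` the discrete valuation rings of its
normalization.  If `D p = d/dτ p`, the exponents `K p` are those of the relative Jacobian ideal and
the exponents `J p` those of the Jacobian ideal of `O`, then every family of elements of valuation
at least `J p - K p` is approximated by elements of `O`. -/
theorem exists_approximation {k O : Type*} [Field k] [Infinite k] [CommRing O] [Algebra k O]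
    [Algebra.EssFiniteType k O] {P : Type*} [Finite P] {V : P → Type*} [∀ p, CommRing (V p)]
    [∀ p, IsDomain (V p)] [∀ p, IsDiscreteValuationRing (V p)] [∀ p, Algebra k (V p)]
    [∀ p, Algebra O (V p)] [∀ p, IsScalarTower k O (V p)] (τ : ∀ p, V p)
    (hτ : ∀ p, Irreducible (τ p)) (hres : ∀ p, ∀ a : V p, ∃ c : k, τ p ∣ a - algebraMap k _ c)
    (D : ∀ p, Derivation k (V p) (V p)) (hD : ∀ p, D p (τ p) = 1) (K J : P → ℕ)
    (hK : ∀ p, ∀ o : O, τ p ^ K p ∣ D p (algebraMap O _ o))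
    (hK' : ∀ p, ∃ o : O, ¬ τ p ^ (K p + 1) ∣ D p (algebraMap O _ o))
    (hJ : ∀ p, ∃ d ∈ fittingIdeal O (Ω[O⁄k]) 1, ¬ τ p ^ (J p + 1) ∣ algebraMap O (V p) d)
    (hloc : ∀ o : O, ∃ c : k, ∀ p, τ p ∣ algebraMap O (V p) (o - algebraMap k O c))
    (g : O) (hg : ∀ p, algebraMap O (V p) g ≠ 0)
    (hcond : ∀ (z : ∀ p, V p) (M : ℕ), ∃ o : O, ∀ p,
      τ p ^ M ∣ algebraMap O (V p) o - algebraMap O (V p) g * z p)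
    (b : ∀ p, V p) (M : ℕ) :
    ∃ o : O, ∀ p, τ p ^ M ∣ τ p ^ K p * algebraMap O (V p) o - τ p ^ J p * b p := by
  classical
  cases nonempty_fintype P
  have hpr : ∀ p, Prime (τ p) := fun p => (hτ p).prime
  obtain ⟨t, ht, htτ⟩ : ∃ t : O, (∀ p, ¬ τ p ^ (K p + 1) ∣ D p (algebraMap O _ t)) ∧
      ∀ p, τ p ∣ algebraMap O (V p) t := by
    obtain ⟨t, ht⟩ := exists_forall_notMem_of_ne_top (fun p =>
      ((Ideal.span {τ p ^ (K p + 1)}).restrictScalars k).comap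
        ((D p : V p →ₗ[k] V p) ∘ₗ (IsScalarTower.toAlgHom k O (V p)).toLinearMap)) (fun p h => by
          obtain ⟨o, ho⟩ := hK' p
          have : o ∈ (⊤ : Submodule k O) := trivial
          rw [← h] at this
          exact ho (Ideal.mem_span_singleton.1 this))
    -- Subtracting the common residue puts `t` in all the maximal ideals without changing its
    -- derivatives.
    obtain ⟨c, hc⟩ := hloc t
    refine ⟨t - algebraMap k O c, fun p h => ht p (Ideal.mem_span_singleton.2 ?_), hc⟩
    rw [map_sub, map_sub, ← IsScalarTower.algebraMap_apply k O (V p), Derivation.map_algebraMap,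
      sub_zero] at h
    exact h
  let _ : Algebra k[X] O := (aeval t).toAlgebra
  let _ : ∀ p, Algebra k[X] (V p) := fun p => (aeval (algebraMap O (V p) t)).toAlgebra
  have hXO : algebraMap k[X] O X = t := aeval_X t
  have hXV : ∀ p, algebraMap k[X] (V p) X = algebraMap O (V p) t := fun p => aeval_X _
  have : IsScalarTower k k[X] O := IsScalarTower.of_algebraMap_eq fun c => (aeval_C t c).symm
  have : ∀ p, IsScalarTower k k[X] (V p) := fun p =>
    IsScalarTower.of_algebraMap_eq fun c => (aeval_C _ c).symm
  have : ∀ p, IsScalarTower k[X] O (V p) := fun p =>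
    IsScalarTower.of_algebraMap_eq fun q => by
      change aeval (algebraMap O (V p) t) q = algebraMap O (V p) (aeval t q)
      rw [aeval_algebraMap_apply]
  obtain ⟨d, ⟨δ, hδ, hδd⟩, hd⟩ : ∃ d ∈ noetherDifferent k[X] O,
      ∀ p, ¬ τ p ^ (J p + 1) ∣ algebraMap O (V p) d := by
    obtain ⟨d, hd⟩ := exists_forall_notMem_of_ne_top
      (E := (noetherDifferent k[X] O).restrictScalars k) (fun p =>
      ((Ideal.span {τ p ^ (J p + 1)}).restrictScalars k).comap
        ((IsScalarTower.toAlgHom k O (V p)).toLinearMap ∘ₗ Submodule.subtype _)) (fun p h => by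
          obtain ⟨δ, hδ, hδ'⟩ := exists_noetherDifferent_not_dvd (hpr p) (D p) (hK p)
            (by rw [hXO]; exact ht p) (hJ p)
          have : (⟨_, δ, hδ, rfl⟩ : (noetherDifferent k[X] O).restrictScalars k) ∈
            (⊤ : Submodule k ((noetherDifferent k[X] O).restrictScalars k)) := trivial
          rw [← h] at this
          exact hδ' (Ideal.mem_span_singleton.1 this))
    exact ⟨d, d.2, fun p h => hd p (Ideal.mem_span_singleton.2 h)⟩
  have ht0 : ∀ p, algebraMap O (V p) t ≠ 0 := fun p h =>
    ht p (by rw [h, map_zero]; exact dvd_zero _)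
  choose e he using fun p => IsDiscreteValuationRing.associated_pow_irreducible (ht0 p) (hτ p)
  have he0 : ∀ p, 0 < e p := by
    intro p
    by_contra h
    have h1 := he p
    rw [show e p = 0 by omega, pow_zero, associated_one_iff_isUnit] at h1
    exact (hτ p).not_isUnit (isUnit_of_dvd_unit (htτ p) h1)
  obtain ⟨w, hw⟩ : ∃ w : P → ℕ, ∀ p, ¬ τ p ^ (w p + 1) ∣ algebraMap O (V p) g := by
    choose w hw using fun p => IsDiscreteValuationRing.associated_pow_irreducible (hg p) (hτ p)
    refine ⟨w, fun p h => ?_⟩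
    exact absurd ((pow_dvd_pow_iff (hpr p).ne_zero (hτ p).not_isUnit).1 (h.trans (hw p).dvd))
      (by omega)
  -- Room for the wanted precision `M` and for all losses: the term `t ^ (N - 1)` must not spoil
  -- divisibility by `τ ^ K`, and `g`, of valuation at most `w`, and `h'`, of valuation at most `J`,
  -- are cancelled later.
  let N : ℕ := 1 + M + ∑ p, (K p + J p + w p + 1)
  have hN : ∀ p, 1 + M + (K p + J p + w p + 1) ≤ N := fun p =>
    Nat.add_le_add_left (Finset.single_le_sum (f := fun p => K p + J p + w p + 1)
      (fun _ _ => Nat.zero_le _) (Finset.mem_univ p)) _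
  choose l u v a c hdual hh using fun p => exists_frobenius_quotient (hpr p) (hres p) (he0 p)
    (by rw [hXV]; exact he p) (N := N) (by omega) (D p) (hD p)
  let Q : P → Type _ := fun p => V p ⧸ Ideal.span {algebraMap k[X] (V p) X ^ N}
  let φ : O →ₐ[k[X]] (∀ p, Q p) := AlgHom.pi fun p =>
    (Ideal.Quotient.mkₐ k[X] (Ideal.span {algebraMap k[X] (V p) X ^ N})).comp
      (IsScalarTower.toAlgHom k[X] O (V p))
  have hφ : ∀ o p, φ o p = Ideal.Quotient.mk _ (algebraMap O (V p) o) := fun o p => rfl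
  have hQ : ∀ p (x y : V p), (Ideal.Quotient.mk _ x : Q p) = Ideal.Quotient.mk _ y →
      τ p ^ N ∣ x - y := by
    intro p x y hxy
    rw [Ideal.Quotient.eq, Ideal.mem_span_singleton, hXV] at hxy
    exact (pow_dvd_pow_of_dvd (htτ p) N).trans hxy
  obtain ⟨h1, h2⟩ := noetherDifferent_mul_frobenius φ (Ideal.span {(X : k[X]) ^ N})
    (by
      intro r hr
      funext p
      obtain ⟨r, rfl⟩ := Ideal.mem_span_singleton.1 hr
      change Ideal.Quotient.mk _ (algebraMap k[X] (V p) _) = 0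
      rw [Ideal.Quotient.eq_zero_iff_mem, Ideal.mem_span_singleton, map_mul, map_pow]
      exact dvd_mul_right _ _)
    (∑ p, l p ∘ₗ LinearMap.proj p)
    (fun j : Σ p, Fin (e p) => (Pi.single j.1 (Ideal.Quotient.mk _ (u j.1 j.2)) : ∀ p, Q p))
    (fun j => Pi.single j.1 (Ideal.Quotient.mk _ (v j.1 j.2)))
    (fun q r hr => frobenius_pi _ l (fun p j => Ideal.Quotient.mk _ (u p j))
      (fun p j => Ideal.Quotient.mk _ (v p j)) hdual q r hr)
    δ hδ g (by
      intro q
      choose q' hq' using fun p => Ideal.Quotient.mk_surjective (q p)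
      -- Divisibility by `t ^ N` is divisibility by `τ p ^ (e p * N)`.
      obtain ⟨o, ho⟩ := hcond q' (∑ p, e p * N)
      refine ⟨o, funext fun p => ?_⟩
      rw [Pi.mul_apply, hφ, hφ, ← hq', ← map_mul, Ideal.Quotient.eq, Ideal.mem_span_singleton, hXV]
      refine ((he p).pow_pow (n := N)).dvd.trans (Dvd.dvd.trans ?_ (ho p))
      rw [← pow_mul]
      exact pow_dvd_pow _ (Finset.single_le_sum (f := fun p => e p * N)
        (fun _ _ => Nat.zero_le _) (Finset.mem_univ p)))
  rw [hδd] at h1 h2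
  let h : ∀ p, V p := fun p => ∑ j, u p j * v p j
  have hsum : (∑ j : Σ p, Fin (e p), (Pi.single j.1 (Ideal.Quotient.mk _ (u j.1 j.2)) : ∀ p, Q p) *
      Pi.single j.1 (Ideal.Quotient.mk _ (v j.1 j.2))) = fun p => Ideal.Quotient.mk _ (h p) := by
    funext p
    rw [Fintype.sum_sigma, Finset.sum_apply, Finset.sum_eq_single p]
    · simp [h]
    · intro p' _ hp'
      rw [Finset.sum_apply]
      exact Finset.sum_eq_zero fun j _ => by simp [Pi.single_eq_of_ne hp'.symm]
    · simp
  rw [hsum] at h1 h2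
  have hh' : ∀ p, τ p ^ K p ∣ h p := by
    intro p
    simp only [h]
    rw [hh]
    refine (Dvd.dvd.mul_left ?_ _).add (Dvd.dvd.mul_right ?_ _)
    · rw [hXV]; exact hK p t
    · rw [hXV]
      exact (pow_dvd_pow _ (by have := hN p; omega)).trans (pow_dvd_pow_of_dvd (htτ p) (N - 1))
  choose h' hh' using hh'
  have hdJ : ∀ p, algebraMap O (V p) d ∣ τ p ^ J p := by
    intro p
    have hd0 : algebraMap O (V p) d ≠ 0 := fun h => hd p (by rw [h]; exact dvd_zero _)
    obtain ⟨j, hj⟩ := IsDiscreteValuationRing.associated_pow_irreducible hd0 (hτ p)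
    refine hj.dvd.trans (pow_dvd_pow _ ?_)
    by_contra! hlt
    exact hd p ((pow_dvd_pow _ hlt).trans hj.symm.dvd)
  choose d' hd' using hdJ
  -- With `h = τ ^ K * h'` and `τ ^ J = d * d'`, this argument makes `h * o ≡ d * (h' * d' * b)`
  -- read `h' * (τ ^ K * o - τ ^ J * b) ≡ 0`, up to the factor `g`.
  obtain ⟨o, ho⟩ := h1 fun p => Ideal.Quotient.mk _ (h' p * d' p * b p)
  obtain ⟨y, hy⟩ := h2
  refine ⟨o, fun p => ?_⟩
  have e1 := hQ p (algebraMap O (V p) g * h p * algebraMap O (V p) o)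
    (algebraMap O (V p) g * algebraMap O (V p) d * (h' p * d' p * b p)) (by
      rw [map_mul, map_mul, map_mul _ (_ * _) (_ * _), map_mul]
      exact congrFun ho p)
  -- From the congruence `g * h * y ≡ g * d`: a larger valuation of `g * h'` would force `d` to have
  -- valuation above `J`.
  have e2 : ¬ τ p ^ (w p + J p + 1) ∣ algebraMap O (V p) g * h' p := by
    intro hdvd
    obtain ⟨y', hy'⟩ := Ideal.Quotient.mk_surjective (y p)
    have e3 := hQ p (algebraMap O (V p) g * h p * y') (algebraMap O (V p) g * algebraMap O (V p) d)
      (by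
        rw [map_mul, map_mul, map_mul, hy']
        exact congrFun hy p)
    have e4 : τ p ^ (J p + 1 + w p) ∣ algebraMap O (V p) g * algebraMap O (V p) d := by
      rw [← dvd_sub_right (a := τ p ^ (J p + 1 + w p)) (b := algebraMap O (V p) g * h p * y')]
      · exact (pow_dvd_pow _ (by have := hN p; omega)).trans e3
      · rw [hh', show J p + 1 + w p = w p + J p + 1 by omega]
        refine hdvd.trans ⟨τ p ^ K p * y', by ring⟩
    exact hd p (pow_dvd_of_pow_dvd_mul_of_not_dvd (hpr p) (hw p) e4 le_rfl)
  refine pow_dvd_of_pow_dvd_mul_of_not_dvd (hpr p) e2 (N := N) ?_ (by have := hN p; omega)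
  refine e1.trans (dvd_of_eq ?_)
  rw [hd', hh']
  ring

end Approximation

end

/-! ### The derivation `d/dτ` of a discrete valuation ring over `k` -/

section
open Polynomial TensorProduct

section DVR

/-- A discrete valuation ring essentially of finite type over a field `k`, with residue field `k`,
has a derivation `d/dτ` for a uniformizer `τ`, and its module of differentials is free on `dτ`. -/
theorem exists_derivation_uniformizer {k V : Type u} [Field k] [CommRing V] [IsDomain V]
    [IsLocalRing V] [Algebra k V] [Algebra.EssFiniteType k V] {τ : V} (hτ : Prime τ)
    (hres : ∀ a : V, ∃ c : k, τ ∣ a - algebraMap k V c) :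
    Submodule.span V {KaehlerDifferential.D k V τ} = ⊤ ∧
      ∃ D : Derivation k V V, D τ = 1 := by
  have hτm : τ ∈ IsLocalRing.maximalIdeal V := (IsLocalRing.mem_maximalIdeal _).2 hτ.not_isUnit
  have hspan : Submodule.span V {KaehlerDifferential.D k V τ} = ⊤ := by
    rw [eq_top_iff]
    -- Nakayama: writing `a = c + τ b` gives `da = b dτ + τ db`.
    refine Submodule.le_of_le_smul_of_le_jacobson_bot (I := IsLocalRing.maximalIdeal V)
      Module.Finite.fg_top (IsLocalRing.maximalIdeal_le_jacobson _) ?_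
    rw [← KaehlerDifferential.span_range_derivation, Submodule.span_le]
    rintro _ ⟨a, rfl⟩
    obtain ⟨c, b, hb⟩ := hres a
    have : KaehlerDifferential.D k V a =
        b • KaehlerDifferential.D k V τ + τ • KaehlerDifferential.D k V b := by
      have h1 : a = algebraMap k V c + τ * b := by rw [← hb]; ring
      rw [h1, map_add, Derivation.map_algebraMap, Derivation.leibniz, zero_add, add_comm]
    rw [this]
    refine Submodule.add_mem_sup (Submodule.smul_mem _ _ (Submodule.mem_span_singleton_self _))
      (Submodule.smul_mem_smul hτm ?_)
    rw [KaehlerDifferential.span_range_derivation]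
    trivial
  refine ⟨hspan, ?_⟩
  -- If `dτ` were torsion, the fraction field would have no differentials over `k`, hence be
  -- algebraic over `k`. But a polynomial vanishing at `τ` is divisible by every power of `X`.
  have hinj : ∀ a : V, a • KaehlerDifferential.D k V τ = 0 → a = 0 := by
    intro a ha
    by_contra ha0
    let L := FractionRing V
    have : Algebra.EssFiniteType V L :=
      Algebra.EssFiniteType.of_isLocalization _ (nonZeroDivisors V)
    have : Algebra.EssFiniteType k L := Algebra.EssFiniteType.comp k V L
    have hsub : Subsingleton (Ω[L⁄k]) := by
      have hloc := KaehlerDifferential.isLocalizedModule_map k V L (nonZeroDivisors V)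
      refine subsingleton_of_forall_eq 0 fun y => ?_
      obtain ⟨⟨m, s⟩, hm⟩ := IsLocalizedModule.surj (nonZeroDivisors V)
        (KaehlerDifferential.map k k V L) y
      obtain ⟨c, rfl⟩ := Submodule.mem_span_singleton.1
        (hspan ▸ Submodule.mem_top : m ∈ Submodule.span V {KaehlerDifferential.D k V τ})
      have h0 : a • (c • KaehlerDifferential.D k V τ) = 0 := by
        rw [smul_comm, ha, smul_zero]
      have h1 : (a * s) • y = 0 := by
        rw [mul_smul]
        change a • (s • y) = 0
        rw [hm, ← map_smul, h0, map_zero]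
      have h2 : algebraMap V L (a * s) ≠ 0 := by
        rw [Ne, IsFractionRing.to_map_eq_zero_iff]
        exact mul_ne_zero ha0 (nonZeroDivisors.ne_zero s.2)
      rw [← algebraMap_smul L] at h1
      exact (smul_eq_zero.1 h1).resolve_left h2
    have hunr : Algebra.FormallyUnramified k L := ⟨hsub⟩
    have hsep : Algebra.IsSeparable k L := Algebra.FormallyUnramified.isSeparable k L
    obtain ⟨f, hf0, hf⟩ := hsep.isAlgebraic.isAlgebraic (algebraMap V L τ)
    rw [aeval_algebraMap_apply, IsFractionRing.to_map_eq_zero_iff] at hf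
    have hdvd : ∀ e, X ^ e ∣ f := fun e => X_pow_dvd_of_pow_dvd_aeval hτ e f (by
      rw [hf]; exact dvd_zero _)
    have := Polynomial.natDegree_le_of_dvd (hdvd (f.natDegree + 1)) hf0
    rw [natDegree_X_pow] at this
    omega
  let ψ : V ≃ₗ[V] Ω[V⁄k] := LinearEquiv.ofBijective
    (LinearMap.toSpanSingleton V _ (KaehlerDifferential.D k V τ))
    ⟨(injective_iff_map_eq_zero _).2 hinj, by
      rw [← LinearMap.range_eq_top, LinearMap.range_toSpanSingleton, hspan]⟩
  refine ⟨ψ.symm.toLinearMap.compDer (KaehlerDifferential.D k V), ?_⟩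
  change ψ.symm (KaehlerDifferential.D k V τ) = 1
  rw [LinearEquiv.symm_apply_eq]
  exact (one_smul V _).symm

end DVR

end

/-! ### Finiteness of integral closures over a perfect field -/

section
section FiniteIntegralClosure

/-- The Frobenius endomorphisms of a finitely generated algebra over a perfect field are finite. -/
theorem iterateFrobenius_finite {k R : Type*} [Field k] [CommRing R] [Algebra k R]
    [Algebra.FiniteType k R] (q : ℕ) [ExpChar k q] [PerfectRing k q] [ExpChar R q] (n : ℕ) :
    (iterateFrobenius R q n).Finite := by
  have hint : (iterateFrobenius R q n).IsIntegral := by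
    intro r
    refine ⟨Polynomial.X ^ q ^ n - Polynomial.C r,
      Polynomial.monic_X_pow_sub_C r (expChar_pow_pos k q n).ne', ?_⟩
    simp [iterateFrobenius_def]
  refine RingHom.IsIntegral.to_finite hint ?_
  have h1 : ((iterateFrobenius R q n).comp (algebraMap k R)).FiniteType := by
    have h2 : (iterateFrobenius R q n).comp (algebraMap k R) =
        (algebraMap k R).comp (iterateFrobeniusEquiv k q n : k →+* k) := by
      ext c
      simp [iterateFrobenius_def]
    rw [h2]
    exact RingHom.FiniteType.comp (RingHom.finiteType_algebraMap.2 inferInstance)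
      (RingHom.FiniteType.of_surjective _ (iterateFrobeniusEquiv k q n).surjective)
  exact RingHom.FiniteType.of_comp_finiteType h1

theorem RingHom.Finite.of_comp_injective {R B C : Type*} [CommRing R] [IsNoetherianRing R]
    [CommRing B] [CommRing C] {f : R →+* B} {g : B →+* C} (hg : Function.Injective g)
    (h : (g.comp f).Finite) : f.Finite := by
  algebraize [f, g, g.comp f]
  exact Module.Finite.of_injective (IsScalarTower.toAlgHom R B C).toLinearMap hg

/-- The integral closure of a normal finitely generated algebra over a perfect field in a finite
extension of its field of fractions is finite. -/
theorem finite_integralClosure_of_isIntegrallyClosed {k R K L : Type*} [Field k] [PerfectField k]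
    [CommRing R] [IsDomain R] [IsIntegrallyClosed R] [Algebra k R] [Algebra.FiniteType k R]
    [Field K] [Algebra R K] [IsFractionRing R K] [Field L] [Algebra R L] [Algebra K L]
    [IsScalarTower R K L] [FiniteDimensional K L] : Module.Finite R (integralClosure R L) := by
  have : IsNoetherianRing R := Algebra.FiniteType.isNoetherianRing k R
  obtain ⟨q, hq⟩ := ExpChar.exists k
  have : PerfectRing k q := inferInstance
  have : ExpChar R q := expChar_of_injective_algebraMap (algebraMap k R).injective q
  have : ExpChar K q := expChar_of_injective_algebraMap (IsFractionRing.injective R K) q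
  have : ExpChar L q := expChar_of_injective_algebraMap (algebraMap K L).injective q
  let M := separableClosure K L
  have : ExpChar M q := expChar_of_injective_algebraMap (algebraMap K M).injective q
  let n := IsPurelyInseparable.exponent M L
  let C := integralClosure R M
  have hCfin : Module.Finite R C := IsIntegralClosure.finite R K M C
  let φ := iterateFrobenius R q n
  have hφ : φ.Finite := iterateFrobenius_finite (k := k) q n
  have : IsScalarTower R M L := IsScalarTower.of_algebraMap_eq fun r => by
    rw [IsScalarTower.algebraMap_apply R K L, IsScalarTower.algebraMap_apply R K M]
    rfl
  -- The `q ^ n`-th power maps the integral closure in `L` injectively into `C`, the one in the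
  -- separable closure, which is finite over `R`. The `R`-structures match after twisting by the
  -- Frobenius of `R`, a finite map.
  let F : L →+* M := IsPurelyInseparable.iterateFrobenius M L q le_rfl
  have hF : ∀ x, algebraMap M L (F x) = x ^ q ^ n :=
    IsPurelyInseparable.algebraMap_iterateFrobenius M q le_rfl
  let ψ : integralClosure R L →+* C :=
    (F.comp (integralClosure R L).val.toRingHom).codRestrict C fun b => by
      change IsIntegral R _
      rw [← isIntegral_algebraMap_iff (algebraMap M L).injective]
      refine (hF b.1).symm ▸ b.2.pow _
  have hψ : Function.Injective ψ := fun x y hxy =>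
    Subtype.ext (F.injective (congrArg Subtype.val hxy))
  refine RingHom.finite_algebraMap.1 (RingHom.Finite.of_comp_injective hψ ?_)
  have : ψ.comp (algebraMap R (integralClosure R L)) = (algebraMap R C).comp φ := by
    refine RingHom.ext fun r => Subtype.ext ((algebraMap M L).injective ?_)
    change algebraMap M L (F (algebraMap R L r)) = algebraMap M L (algebraMap R M (φ r))
    rw [hF, ← IsScalarTower.algebraMap_apply R M L, iterateFrobenius_def, map_pow]
  rw [this]
  exact (RingHom.finite_algebraMap.2 hCfin).comp hφ

/-- Noether normalization reduces to the integral closure of a polynomial ring, which is normal, in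
a finite extension of its fraction field. -/
theorem finite_integralClosure_of_finiteType (k A : Type*) {L : Type*} [Field k] [PerfectField k]
    [CommRing A] [IsDomain A] [Algebra k A] [Algebra.FiniteType k A] [Field L] [Algebra A L]
    [IsFractionRing A L] : Module.Finite A (integralClosure A L) := by
  obtain ⟨s, g, hginj, hg⟩ := exists_finite_inj_algHom_of_fg k A
  let R := MvPolynomial (Fin s) k
  let _ : Algebra R A := g.toRingHom.toAlgebra
  have : Module.Finite R A := hg
  let _ : Algebra R L := ((algebraMap A L).comp (algebraMap R A)).toAlgebra
  have : IsScalarTower R A L := IsScalarTower.of_algebraMap_eq fun _ => rfl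
  have hRL : Function.Injective (algebraMap R L) := (IsFractionRing.injective A L).comp hginj
  have : FaithfulSMul R L := (faithfulSMul_iff_algebraMap_injective R L).2 hRL
  have : FaithfulSMul R A := (faithfulSMul_iff_algebraMap_injective R A).2 hginj
  let K := FractionRing R
  let _ : Algebra K L := FractionRing.liftAlgebra R L
  have : IsScalarTower R K L := FractionRing.isScalarTower_liftAlgebra R L
  have : IsLocalization (Algebra.algebraMapSubmonoid A (nonZeroDivisors R)) L := inferInstance
  have : FiniteDimensional K L := Module.Finite.of_isLocalization R A (nonZeroDivisors R)
  have hfin : Module.Finite R (integralClosure R L) :=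
    finite_integralClosure_of_isIntegrallyClosed (k := k) (K := K)
  have : IsNoetherianRing R := Algebra.FiniteType.isNoetherianRing k R
  have hle : ∀ x ∈ integralClosure A L, x ∈ integralClosure R L := fun x hx =>
    isIntegral_trans (A := A) x hx
  have : Module.Finite R (integralClosure A L) :=
    Module.Finite.of_injective (Submodule.inclusion (p :=
      (Subalgebra.toSubmodule (integralClosure A L)).restrictScalars R)
      (p' := Subalgebra.toSubmodule (integralClosure R L)) hle)
      (Submodule.inclusion_injective _)
  exact Module.Finite.of_restrictScalars_finite R A _

end FiniteIntegralClosure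

end

/-! ### Fitting ideals -/

section
section Fitting

variable {R M : Type*} [CommRing R] [AddCommGroup M] [Module R M]

theorem fittingIdeal_one_eq_top_of_span_singleton {y : M} (hy : Submodule.span R {y} = ⊤) :
    fittingIdeal R M 1 = ⊤ := by
  rw [Ideal.eq_top_iff_one]
  refine Ideal.subset_span ⟨0, fun _ => y, 0, Fin.elim0, ?_, fun r => r.elim0, ?_⟩
  · rw [Set.range_const, hy]
  · simp

theorem fittingIdeal_zero_eq_top_of_subsingleton [Subsingleton M] : fittingIdeal R M 0 = ⊤ := by
  rw [Ideal.eq_top_iff_one]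
  exact Ideal.subset_span ⟨0, Fin.elim0, 0, Fin.elim0, Subsingleton.elim _ _, fun r => r.elim0,
    by simp⟩

theorem mem_fittingIdeal_zero_of_span_singleton {y : M} (hy : Submodule.span R {y} = ⊤) {r : R}
    (hr : r • y = 0) : r ∈ fittingIdeal R M 0 := by
  refine Ideal.subset_span ⟨1, fun _ => y, fun _ _ => r, id, ?_, fun _ => ?_, ?_⟩
  · rw [Set.range_const, hy]
  · simpa using hr
  · simp [Matrix.det_unique]
    rfl

/-- Multiply the relations by the adjugate matrix. A column selection that is not injective has zero
determinant; an injective one is a permutation. -/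
theorem fittingIdeal_zero_le_annihilator : fittingIdeal R M 0 ≤ Module.annihilator R M := by
  refine Ideal.span_le.2 ?_
  rintro _ ⟨m, x, A, c, hx, hA, rfl⟩
  have hAB : ∀ r, ∑ j, A.submatrix id c r j • x (c j) = 0 ∨ (A.submatrix id c).det = 0 := by
    by_cases hc : Function.Injective c
    · intro r
      left
      rw [← hA r]
      exact (Finite.injective_iff_bijective.1 hc).sum_comp (fun j => A r j • x j)
    · intro r
      right
      rw [Function.Injective] at hc
      push Not at hc
      obtain ⟨i, j, hij, hne⟩ := hc
      exact Matrix.det_zero_of_column_eq hne (by intro r; simp [hij])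
  by_cases h0 : (A.submatrix id c).det = 0
  · rw [h0]; exact zero_mem _
  have hc : Function.Injective c := by
    by_contra hc
    rw [Function.Injective] at hc
    push Not at hc
    obtain ⟨i, j, hij, hne⟩ := hc
    exact h0 (Matrix.det_zero_of_column_eq hne (by intro r; simp [hij]))
  set B := A.submatrix id c with hB
  have hdet : ∀ j, B.det • x (c j) = 0 := by
    intro j
    have h1 : ∑ i, B.adjugate j i • ∑ l, B i l • x (c l) = 0 :=
      Finset.sum_eq_zero fun i _ => by rw [(hAB i).resolve_right h0, smul_zero]
    simp only [Finset.smul_sum, smul_smul] at h1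
    rw [Finset.sum_comm] at h1
    simp only [← Finset.sum_smul] at h1
    have h2 : ∀ l, ∑ i, B.adjugate j i * B i l = if j = l then B.det else 0 := fun l => by
      have := congrFun (congrFun (Matrix.adjugate_mul B) j) l
      rw [Matrix.mul_apply] at this
      rw [this, Matrix.smul_apply, Matrix.one_apply]
      simp
    simpa [h2, ite_smul] using h1
  rw [SetLike.mem_coe, Module.mem_annihilator]
  intro y
  have : y ∈ Submodule.span R (Set.range x) := hx ▸ Submodule.mem_top
  induction this using Submodule.span_induction with
  | mem y hy =>
    obtain ⟨j, rfl⟩ := hy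
    obtain ⟨j, rfl⟩ := (Finite.injective_iff_bijective.1 hc).2 j
    exact hdet j
  | zero => simp
  | add a b _ _ ha hb => rw [smul_add, ha, hb, add_zero]
  | smul a b _ hb => rw [smul_comm, hb, smul_zero]

theorem fittingIdeal_le_of_surjective {N : Type*} [AddCommGroup N] [Module R N] (f : M →ₗ[R] N)
    (hf : Function.Surjective f) (i : ℕ) : fittingIdeal R M i ≤ fittingIdeal R N i := by
  refine Ideal.span_mono ?_
  rintro _ ⟨m, x, A, c, hx, hA, rfl⟩
  refine ⟨m, f ∘ x, A, c, ?_, fun r => ?_, rfl⟩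
  · rw [Set.range_comp, Submodule.span_image, hx, Submodule.map_top, LinearMap.range_eq_top]
    exact hf
  · rw [← map_zero f, ← hA r, map_sum]
    simp

/-- If a localization of a finite module is cyclic, its first Fitting ideal contains a
denominator. -/
theorem exists_mem_fittingIdeal_one_of_isLocalizedModule [Module.Finite R M] (S : Submonoid R)
    {R' N : Type*} [CommRing R'] [Algebra R R'] [IsLocalization S R'] [AddCommGroup N] [Module R N]
    [Module R' N] [IsScalarTower R R' N] (f : M →ₗ[R] N) [IsLocalizedModule S f]
    {y : N} (hy : Submodule.span R' {y} = ⊤) : ∃ s ∈ S, s ∈ fittingIdeal R M 1 := by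
  obtain ⟨⟨y₀, b⟩, hb⟩ := IsLocalizedModule.surj S f y
  have hfrac : ∀ x : M, ∃ s ∈ S, ∃ a : R, s • x = a • y₀ := by
    intro x
    obtain ⟨c, hc⟩ := Submodule.mem_span_singleton.1
      (hy ▸ Submodule.mem_top : f x ∈ Submodule.span R' {y})
    obtain ⟨⟨a, t⟩, ha⟩ := IsLocalization.surj S c
    have h1 : f ((b * t : R) • x) = f (a • y₀) := by
      rw [map_smul, map_smul, ← hb, ← hc, Submonoid.smul_def, ← algebraMap_smul R' (b * t : R),
        ← algebraMap_smul R' a, ← algebraMap_smul R' (b : R), smul_smul, smul_smul, ← ha, map_mul]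
      congr 1
      ring
    obtain ⟨u, hu⟩ := (IsLocalizedModule.eq_iff_exists S f).1 h1
    refine ⟨u * (b * t), S.mul_mem u.2 (S.mul_mem b.2 t.2), u * a, ?_⟩
    rw [mul_smul (u : R), mul_smul (u : R)]
    exact hu
  obtain ⟨m, x, hx⟩ := Module.Finite.exists_fin (R := R) (M := M)
  choose s hs a hsa using fun j => hfrac (x j)
  -- The generators are `y₀` and the `x i`, with relations `s i • x i = a i • y₀`. Omitting the
  -- column of `y₀` leaves a diagonal minor.
  refine ⟨∏ j, s j, S.prod_mem fun j _ => hs j, Ideal.subset_span ⟨m, Fin.cons y₀ x,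
    fun i => Fin.cons (- a i) (Pi.single i (s i)), Fin.succ, ?_, fun i => ?_, ?_⟩⟩
  · rw [eq_top_iff, ← hx]
    refine Submodule.span_mono ?_
    rintro _ ⟨j, rfl⟩
    exact ⟨j.succ, by simp⟩
  · rw [Fin.sum_univ_succ]
    simp only [Fin.cons_zero, Fin.cons_succ]
    rw [Finset.sum_eq_single i]
    · simp [hsa]
    · intro j _ hj
      simp [Pi.single_eq_of_ne hj]
    · simp
  · rw [← Matrix.det_diagonal]
    congr 1
    ext i j
    change Matrix.diagonal s i j = (Pi.single i (s i) : Fin m → R) j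
    simp [Matrix.diagonal, Pi.single_apply, eq_comm]

/-- The Jacobian ideal only depends on the image of the base ring. -/
theorem differentialFitting_eq_of_surjective {k A B : Type u} [CommRing k] [CommRing A]
    [CommRing B] [Algebra k B] (σ : k →+* A) (hσ : Function.Surjective σ) (φ : A →+* B)
    (h : φ.comp σ = algebraMap k B) (d : ℕ) :
    differentialFitting φ d = fittingIdeal B (Ω[B⁄k]) d := by
  let _ : Algebra A B := φ.toAlgebra
  let _ : Algebra k A := σ.toAlgebra
  have : IsScalarTower k A B := IsScalarTower.of_algebraMap_eq' h.symm
  change fittingIdeal B (Ω[B⁄A]) d = _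
  refine le_antisymm ?_ (fittingIdeal_le_of_surjective (KaehlerDifferential.map k A B B)
    (KaehlerDifferential.map_surjective k A B) d)
  -- The universal derivation over `k` is `A`-linear since `A` is the image of `k`; it gives the
  -- comparison map in the other direction.
  let D : Derivation A B (Ω[B⁄k]) :=
    { toFun := KaehlerDifferential.D k B
      map_add' := map_add _
      map_smul' := fun a b => by
        obtain ⟨c, rfl⟩ := hσ a
        have h1 : σ c • b = c • b := algebraMap_smul A c b
        rw [h1, RingHom.id_apply, Derivation.map_smul]
        rw [← algebraMap_smul B c, ← algebraMap_smul B (σ c), ← h]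
        rfl
      map_one_eq_zero' := Derivation.map_one_eq_zero _
      leibniz' := Derivation.leibniz _ }
  refine fittingIdeal_le_of_surjective D.liftKaehlerDifferential ?_ d
  rw [← LinearMap.range_eq_top, eq_top_iff, ← KaehlerDifferential.span_range_derivation,
    Submodule.span_le]
  rintro _ ⟨b, rfl⟩
  exact ⟨KaehlerDifferential.D A B b, D.liftKaehlerDifferential_comp_D b⟩

end Fitting

end

/-! ### The order of the relative Jacobian ideal in terms of `d/dτ`, and the local theorem -/

section
open IsLocalRing

section RelativeJacobian

variable {k O V : Type*} [Field k] [CommRing O] [CommRing V] [Algebra k V] [Algebra O V] {τ : V}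

/-- The differentials over `O` are generated by `dτ`, subject to `(D o) dτ = do = 0`. -/
theorem derivation_algebraMap_mem_fittingIdeal [Algebra k O] [IsScalarTower k O V]
    (hτ : Submodule.span V {KaehlerDifferential.D k V τ} = ⊤) (D : Derivation k V V)
    (hD : D τ = 1) (o : O) : D (algebraMap O V o) ∈ fittingIdeal V (Ω[V⁄O]) 0 := by
  let π := KaehlerDifferential.map k O V V
  refine mem_fittingIdeal_zero_of_span_singleton (y := π (KaehlerDifferential.D k V τ)) ?_ ?_
  · rw [← Set.image_singleton, Submodule.span_image, hτ, Submodule.map_top, LinearMap.range_eq_top]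
    exact KaehlerDifferential.map_surjective k O V
  · obtain ⟨c, hc⟩ := Submodule.mem_span_singleton.1 (hτ ▸ Submodule.mem_top :
      KaehlerDifferential.D k V (algebraMap O V o) ∈ Submodule.span V {KaehlerDifferential.D k V τ})
    have h1 : c = D (algebraMap O V o) := by
      have := congrArg D.liftKaehlerDifferential hc
      simpa [hD] using this
    rw [← h1, ← map_smul, hc]
    simp [π]

/-- Otherwise `D` modulo `τ ^ (K + 1)` would be `O`-linear and factor through differentials killed
by `τ ^ K`, although it sends `τ` to `1`. -/
theorem exists_not_pow_dvd_derivation_algebraMap [IsDomain V] (hτ : Prime τ) (D : Derivation k V V)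
    (hD : D τ = 1) {K : ℕ} (hK : τ ^ K ∈ fittingIdeal V (Ω[V⁄O]) 0) :
    ∃ o : O, ¬ τ ^ (K + 1) ∣ D (algebraMap O V o) := by
  by_contra! h
  let I : Ideal V := Ideal.span {τ ^ (K + 1)}
  let D' : Derivation O V (V ⧸ I) :=
    { toFun := fun v => Ideal.Quotient.mk I (D v)
      map_add' := by simp
      map_smul' := fun o v => by
        have : Ideal.Quotient.mk I (D (algebraMap O V o)) = 0 :=
          Ideal.Quotient.eq_zero_iff_mem.2 (Ideal.mem_span_singleton.2 (h o))
        rw [Algebra.smul_def, Derivation.leibniz, smul_eq_mul, smul_eq_mul, map_add, map_mul,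
          map_mul, this, mul_zero, add_zero, RingHom.id_apply, ← algebraMap_smul V o]
        rfl
      map_one_eq_zero' := by simp
      leibniz' := fun a b => by
        change Ideal.Quotient.mk I (D (a * b)) = _
        rw [Derivation.leibniz, map_add]
        rfl }
  have h1 := Module.mem_annihilator.1 (fittingIdeal_zero_le_annihilator hK)
    (KaehlerDifferential.D O V τ)
  have h2 := congrArg D'.liftKaehlerDifferential h1
  rw [map_smul, Derivation.liftKaehlerDifferential_comp_D, map_zero] at h2
  change Ideal.Quotient.mk I (τ ^ K * D τ) = 0 at h2
  rw [hD, mul_one, Ideal.Quotient.eq_zero_iff_mem, Ideal.mem_span_singleton,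
    pow_dvd_pow_iff hτ.ne_zero hτ.not_isUnit] at h2
  omega

theorem exists_derivation_algebraMap_ne_zero [IsDomain V]
    (hfrac : ∀ v : V, ∃ a b : O, algebraMap O V b ≠ 0 ∧ algebraMap O V b * v = algebraMap O V a)
    (D : Derivation k V V) (hD : D ≠ 0) : ∃ o : O, D (algebraMap O V o) ≠ 0 := by
  by_contra! h
  refine hD (Derivation.ext fun v => ?_)
  obtain ⟨a, b, hb, hab⟩ := hfrac v
  have := congrArg D hab
  rw [Derivation.leibniz, h, h, smul_zero, add_zero, smul_eq_mul] at this
  exact (mul_eq_zero.1 this).resolve_left hb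

end RelativeJacobian

/-- Rational functions of valuation at least `J - K`, where `K` is the order of the relative
Jacobian ideal of the normalization and `J` that of the Jacobian ideal, are regular up to elements
of the conductor. -/
theorem exists_approximation_of_fittingIdeal {k O : Type u} [Field k] [Infinite k] [CommRing O]
    [Algebra k O] [Algebra.EssFiniteType k O] {P : Type u} [Finite P] {V L : P → Type u}
    [∀ p, CommRing (V p)] [∀ p, IsDomain (V p)] [∀ p, IsDiscreteValuationRing (V p)]
    [∀ p, Algebra k (V p)] [∀ p, Algebra.EssFiniteType k (V p)]
    [∀ p, Algebra O (V p)] [∀ p, IsScalarTower k O (V p)] [∀ p, CommRing (L p)]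
    [∀ p, IsDomain (L p)] (ι : ∀ p, V p →+* L p) (hι : ∀ p, Function.Injective (ι p))
    (hres : ∀ p, ∀ a : V p, ∃ c : k, a - algebraMap k _ c ∈ maximalIdeal (V p)) (K J : P → ℕ)
    (hK : ∀ p, fittingIdeal (V p) (Ω[V p⁄O]) 0 = maximalIdeal (V p) ^ K p)
    (hJ : ∀ p, (fittingIdeal O (Ω[O⁄k]) 1).map (algebraMap O (V p)) = maximalIdeal (V p) ^ J p)
    (hloc : ∀ o : O, ∃ c : k, ∀ p, algebraMap O (V p) (o - algebraMap k O c) ∈ maximalIdeal (V p))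
    (g : O) (hg : ∀ p, algebraMap O (V p) g ≠ 0)
    (hcond : ∀ (z : ∀ p, V p) (M : ℕ), ∃ o : O, ∀ p,
      algebraMap O (V p) o - algebraMap O (V p) g * z p ∈ maximalIdeal (V p) ^ M)
    (z : ∀ p, L p) (hz : ∀ p, ∀ a ∈ maximalIdeal (V p) ^ (K p - J p),
      ∃ b ∈ maximalIdeal (V p) ^ (J p - K p), ι p b = ι p a * z p) :
    ∃ o : O, ∀ p, ∃ c : V p, z p - ι p (algebraMap O (V p) o) = ι p (algebraMap O (V p) g * c) := by
  choose τ hτ using fun p => IsDiscreteValuationRing.exists_irreducible (V p)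
  have hpr : ∀ p, Prime (τ p) := fun p => (hτ p).prime
  have hm : ∀ p, maximalIdeal (V p) = Ideal.span {τ p} := fun p => (hτ p).maximalIdeal_eq
  have hmn : ∀ p n a, a ∈ maximalIdeal (V p) ^ n ↔ τ p ^ n ∣ a := fun p n a => by
    rw [hm, Ideal.span_singleton_pow, Ideal.mem_span_singleton]
  have hm1 : ∀ p a, a ∈ maximalIdeal (V p) ↔ τ p ∣ a := fun p a => by
    rw [hm, Ideal.mem_span_singleton]
  simp only [hm1, hmn] at hres hloc hcond hz
  choose hspan D hD using fun p => exists_derivation_uniformizer (hpr p) (hres p)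
  -- Restores the common factor lost in the two truncated differences of exponents.
  have hb : ∀ p, ∃ b : V p, ι p (τ p ^ K p) * z p = ι p (τ p ^ J p * b) := by
    intro p
    obtain ⟨_, ⟨b, rfl⟩, hb⟩ := hz p (τ p ^ (K p - J p)) dvd_rfl
    refine ⟨b, ?_⟩
    rcases le_total (K p) (J p) with h | h
    · rw [Nat.sub_eq_zero_of_le h, pow_zero, map_one, one_mul] at hb
      rw [← hb, ← map_mul, ← mul_assoc, ← pow_add, Nat.add_sub_cancel' h]
    · rw [Nat.sub_eq_zero_of_le h, pow_zero, one_mul] at hb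
      rw [map_mul, hb, ← mul_assoc, ← map_mul, ← pow_add, Nat.add_sub_cancel' h]
  choose b hb using hb
  -- Precision `K p + w p` suffices: cancelling `τ ^ K` leaves a multiple of `τ ^ w`, that is, of
  -- `g`.
  choose w hw using fun p => IsDiscreteValuationRing.associated_pow_irreducible (hg p) (hτ p)
  classical
  cases nonempty_fintype P
  obtain ⟨o, ho⟩ := exists_approximation τ hτ hres D hD K J
    (fun p o => by
      rw [← hmn, ← hK]
      exact derivation_algebraMap_mem_fittingIdeal (hspan p) (D p) (hD p) o)
    (fun p => exists_not_pow_dvd_derivation_algebraMap (hpr p) (D p) (hD p)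
      (by rw [hK, hmn]))
    (fun p => by
      by_contra! h
      have h1 : maximalIdeal (V p) ^ J p ≤ Ideal.span {τ p ^ (J p + 1)} := by
        rw [← hJ, Ideal.map_le_iff_le_comap]
        exact fun d hd => Ideal.mem_span_singleton.2 (h d hd)
      have h2 := Ideal.mem_span_singleton.1 (h1 ((hmn p _ _).2 dvd_rfl))
      rw [pow_dvd_pow_iff (hpr p).ne_zero (hpr p).not_isUnit] at h2
      omega)
    hloc g hg hcond b (∑ p, (K p + w p))
  refine ⟨o, fun p => ?_⟩
  have hle : K p + w p ≤ ∑ p, (K p + w p) :=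
    Finset.single_le_sum (f := fun p => K p + w p) (fun _ _ => Nat.zero_le _) (Finset.mem_univ p)
  obtain ⟨c, hc⟩ := (pow_dvd_pow (τ p) hle).trans (ho p)
  obtain ⟨c', hc'⟩ := (hw p).dvd
  refine ⟨- (c' * c), ?_⟩
  have h0 : ι p (τ p ^ K p) ≠ 0 := by
    rw [Ne, map_eq_zero_iff _ (hι p)]
    exact pow_ne_zero _ (hpr p).ne_zero
  refine mul_left_cancel₀ h0 ?_
  rw [mul_sub, hb, ← map_mul, ← map_mul, ← map_sub]
  congr 1
  rw [← neg_sub, hc, pow_add, hc']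
  ring

end

/-! ### Approximation in a semilocal setting and descent through the conductor -/

section
open IsLocalRing

section AffineCurve

variable {S S' : Type*} [CommRing S] [CommRing S'] [Algebra S S']

theorem exists_pow_mul_mem_range [Module.Finite S S'] (h : S)
    (hh : ∀ s' : S', ∃ n : ℕ, algebraMap S S' (h ^ n) * s' ∈ (algebraMap S S').range) :
    ∃ n : ℕ, ∀ s' : S', algebraMap S S' (h ^ n) * s' ∈ (algebraMap S S').range := by
  obtain ⟨m, x, hx⟩ := Module.Finite.exists_fin (R := S) (M := S')
  choose n hn using fun j => hh (x j)
  refine ⟨∑ j, n j, fun s' => ?_⟩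
  have : s' ∈ Submodule.span S (Set.range x) := hx ▸ Submodule.mem_top
  induction this using Submodule.span_induction with
  | mem y hy =>
    obtain ⟨j, rfl⟩ := hy
    rw [← Nat.sub_add_cancel (Finset.single_le_sum (f := n) (fun _ _ => Nat.zero_le _)
      (Finset.mem_univ j)), pow_add, map_mul, mul_assoc]
    exact mul_mem ⟨_, rfl⟩ (hn j)
  | zero => simp
  | add a b _ _ ha hb => rw [mul_add]; exact add_mem ha hb
  | smul a b _ hb =>
    rw [Algebra.smul_def, mul_left_comm]
    exact mul_mem ⟨_, rfl⟩ hb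

/-- Simultaneous approximation in finitely many local rings at maximal ideals. -/
theorem exists_forall_algebraMap_sub_mem {P : Type*} [Finite P] (𝔭 : P → Ideal S')
    (hmax : ∀ p, (𝔭 p).IsMaximal) (hinj : Function.Injective 𝔭) {V : P → Type*}
    [∀ p, CommRing (V p)] [∀ p, IsLocalRing (V p)] [∀ p, Algebra S' (V p)]
    [∀ p, (𝔭 p).IsPrime] [∀ p, IsLocalization.AtPrime (V p) (𝔭 p)] (z : ∀ p, V p) (M : ℕ) :
    ∃ s : S', ∀ p, algebraMap S' (V p) s - z p ∈ maximalIdeal (V p) ^ M := by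
  have hle : ∀ p, (𝔭 p ^ M).map (algebraMap S' (V p)) ≤ maximalIdeal (V p) ^ M := by
    intro p
    rw [Ideal.map_pow]
    refine Ideal.pow_right_mono (Ideal.map_le_iff_le_comap.2 ?_) M
    exact (IsLocalization.AtPrime.under_maximalIdeal (V p) (𝔭 p)).ge
  have h1 : ∀ p, ∃ s : S', algebraMap S' (V p) s - z p ∈ maximalIdeal (V p) ^ M := by
    intro p
    obtain ⟨a, b, hab⟩ := IsLocalization.exists_mk'_eq (𝔭 p).primeCompl (z p)
    have hb : IsCoprime (Ideal.span {(b : S')}) (𝔭 p ^ M) := by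
      refine IsCoprime.pow_right ?_
      obtain ⟨c, i, hi, hci⟩ := (hmax p).exists_inv b.2
      exact Ideal.isCoprime_iff_exists.2
        ⟨c * b, Ideal.mul_mem_left _ _ (Ideal.mem_span_singleton_self _), i, hi, hci⟩
    obtain ⟨_, hi, j, hj, hij⟩ := Ideal.isCoprime_iff_exists.1 hb
    obtain ⟨c, rfl⟩ := Ideal.mem_span_singleton'.1 hi
    refine ⟨c * a, ?_⟩
    have hbz : algebraMap S' (V p) b * z p = algebraMap S' (V p) a := by
      rw [← hab, IsLocalization.mk'_spec']
    have : algebraMap S' (V p) (c * a) - z p = - (algebraMap S' (V p) j * z p) := by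
      have := congrArg (algebraMap S' (V p)) hij
      rw [map_add, map_mul, map_one] at this
      rw [map_mul, ← hbz]
      linear_combination z p * this
    rw [this]
    exact neg_mem (Ideal.mul_mem_right _ _ (hle p (Ideal.mem_map_of_mem _ hj)))
  choose s hs using h1
  have hcop : Pairwise fun p q => IsCoprime (𝔭 p ^ M) (𝔭 q ^ M) := by
    intro p q hpq
    refine IsCoprime.pow ?_
    rw [Ideal.isCoprime_iff_sup_eq]
    exact (hmax p).coprime_of_ne (hmax q) (fun h => hpq (hinj h))
  obtain ⟨r, hr⟩ := Ideal.pi_quotient_surjective hcop fun p => Ideal.Quotient.mk _ (s p)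
  replace hr : ∀ p, r - s p ∈ 𝔭 p ^ M := fun p => Ideal.Quotient.eq.1 (hr p)
  refine ⟨r, fun p => ?_⟩
  have := hle p (Ideal.mem_map_of_mem (algebraMap S' (V p)) (hr p))
  rw [map_sub] at this
  have := add_mem this (hs p)
  rwa [sub_add_sub_cancel] at this

/-- A rational function which, at all points over `𝔪`, lies in the conductor ideal generated
by `g`, is a quotient of elements of `S` with denominator prime to `𝔪`. -/
theorem exists_notMem_mul_eq_of_conductor [Algebra.IsIntegral S S'] (𝔪 : Ideal S) [𝔪.IsPrime]
    {H : Type*} {L : H → Type*} [∀ η, CommRing (L η)] (l : ∀ η, S' →+* L η) (g : S)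
    (hg : ∀ s' : S', algebraMap S S' g * s' ∈ (algebraMap S S').range) (y : ∀ η, L η)
    (hy : ∀ Q : Ideal S', Q.IsPrime → Q.comap (algebraMap S S') = 𝔪 →
      ∃ e : S', e ∉ Q ∧ ∃ a : S', ∀ η, l η e * y η = l η (algebraMap S S' g * a)) :
    ∃ s ∉ 𝔪, ∃ a : S, ∀ η, l η (algebraMap S S' s) * y η = l η (algebraMap S S' a) := by
  -- The ideal of denominators of `y` relative to `g S'`. If its trace on `S` were inside `𝔪`, a
  -- prime containing it would lie over `𝔪`, against `hy`.
  let 𝔟 : Ideal S' :=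
    { carrier := {e | ∃ a : S', ∀ η, l η e * y η = l η (algebraMap S S' g * a)}
      zero_mem' := ⟨0, by simp⟩
      add_mem' := by
        rintro e e' ⟨a, ha⟩ ⟨a', ha'⟩
        exact ⟨a + a', fun η => by rw [map_add, add_mul, ha, ha', mul_add, map_add]⟩
      smul_mem' := by
        rintro c e ⟨a, ha⟩
        exact ⟨c * a, fun η => by
          rw [smul_eq_mul, map_mul, mul_assoc, ha, ← map_mul, mul_left_comm]⟩ }
  have hle : ¬ 𝔟.comap (algebraMap S S') ≤ 𝔪 := by
    intro hle
    obtain ⟨Q, hQ, hQp, hQm⟩ := Ideal.exists_ideal_over_prime_of_isIntegral 𝔪 𝔟 hle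
    obtain ⟨e, heQ, he⟩ := hy Q hQp hQm
    exact heQ (hQ he)
  obtain ⟨s, ⟨a, ha⟩, hs⟩ := Set.not_subset.1 hle
  obtain ⟨b, hb⟩ := hg a
  exact ⟨s, hs, b, fun η => by rw [ha, hb]⟩

end AffineCurve

end

/-! ### Generic points and one-dimensional spaces -/

section
section Topology

open TopologicalSpace

variable {X : Type*} [TopologicalSpace X]

theorem mem_genericPoints_iff [QuasiSober X] [T0Space X] {η : X} :
    η ∈ genericPoints X ↔ ∀ q, q ⤳ η → q = η := by
  constructor
  · intro h q hq
    have hle : closure {η} ⊆ closure {q} := hq.closure_subset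
    have := h.2 (y := closure {q}) isIrreducible_singleton.closure hle
    exact (hq.antisymm (specializes_iff_closure_subset.2 this)).eq
  · intro h
    obtain ⟨Z, hZ, hle⟩ := exists_mem_irreducibleComponents_subset_of_isIrreducible
      (closure {η}) isIrreducible_singleton.closure
    have hcl := hZ.1.closure_genericPoint (isClosed_of_mem_irreducibleComponents Z hZ)
    have : hZ.1.genericPoint = η :=
      h _ (specializes_iff_closure_subset.2 (hcl.symm ▸ hle))
    change closure {η} ∈ irreducibleComponents X
    rwa [← this, hcl]

theorem exists_mem_genericPoints_specializes [QuasiSober X] (x : X) :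
    ∃ η ∈ genericPoints X, η ⤳ x := by
  obtain ⟨Z, hZ, hle⟩ := exists_mem_irreducibleComponents_subset_of_isIrreducible
      (closure {x}) isIrreducible_singleton.closure
  have hcl := hZ.1.closure_genericPoint (isClosed_of_mem_irreducibleComponents Z hZ)
  refine ⟨hZ.1.genericPoint, ?_, specializes_iff_closure_subset.2 (hcl.symm ▸ hle)⟩
  change closure _ ∈ irreducibleComponents X
  rwa [hcl]

/-- In a Noetherian space every irreducible component contains a nonempty open subset of the whole
space, which a dense set must meet. -/
theorem Dense.mem_of_mem_genericPoints [NoetherianSpace X] {U : Set X} (hU : Dense U)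
    (ho : IsOpen U) {η : X} (hη : η ∈ genericPoints X) : η ∈ U := by
  obtain ⟨V, hV, hne, hle⟩ :=
    NoetherianSpace.exists_isOpen_nonempty_subset_irreducibleComponent (closure {η}) hη
  obtain ⟨x, hxV, hxU⟩ := hU.inter_open_nonempty V hV hne
  exact (specializes_iff_mem_closure.2 (hle hxV)).mem_open ho hxU

/-- The irreducible components of `X` are of dimension one. -/
abbrev IsOneDimensional (X : Type*) [TopologicalSpace X] : Prop :=
  ∀ Z ∈ irreducibleComponents X, topologicalKrullDim Z = 1

/-- Three distinct points would give a chain of irreducible closed sets of length two in one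
component. -/
theorem IsOneDimensional.eq_of_specializes [T0Space X] (h : IsOneDimensional X) {a b c : X}
    (hab : a ⤳ b) (hbc : b ⤳ c) (hne : a ≠ b) : b = c := by
  obtain ⟨Z, hZ, hle⟩ := exists_mem_irreducibleComponents_subset_of_isIrreducible
      (closure {a}) isIrreducible_singleton.closure
  have mem : ∀ x, a ⤳ x → x ∈ Z := fun x hx => hle hx.mem_closure
  let pt : ∀ x : Z, IrreducibleCloseds Z := fun x =>
    ⟨closure {x}, isIrreducible_singleton.closure, isClosed_closure⟩
  have le_iff : ∀ x y : Z, pt x ≤ pt y ↔ y ⤳ x := fun x y =>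
    specializes_iff_closure_subset.symm
  have sp : ∀ x y : Z, x ⤳ y ↔ (x : X) ⤳ y := fun x y =>
    Topology.IsInducing.subtypeVal.specializes_iff.symm
  have hd : Order.krullDim (IrreducibleCloseds Z) ≤ 1 := (h Z hZ).le
  rw [Order.krullDim_le_one_iff] at hd
  rcases hd (pt ⟨b, mem b hab⟩) with hmin | hmax
  · have h1 := hmin ((le_iff ⟨c, mem c (hab.trans hbc)⟩ _).2 ((sp _ _).2 hbc))
    exact (hbc.antisymm ((sp _ _).1 ((le_iff _ _).1 h1))).eq
  · have h1 := hmax ((le_iff _ ⟨a, mem a specializes_rfl⟩).2 ((sp _ _).2 hab))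
    exact absurd (hab.antisymm ((sp _ _).1 ((le_iff _ _).1 h1))).eq hne

theorem IsOneDimensional.not_isClosed_of_mem_genericPoints (h : IsOneDimensional X) {η : X}
    (hη : η ∈ genericPoints X) : ¬ IsClosed ({η} : Set X) := by
  intro hc
  have := h _ hη
  rw [hc.closure_eq] at this
  exact absurd (this.ge.trans (topologicalKrullDim_zero_of_discreteTopology _)) (by decide)

end Topology

end

/-! ### Schemes: the locus of isomorphism, generic points, stalks of affine opens -/

section
namespace AlgebraicGeometry.Scheme

theorem isIso_app_of_isIso {X Y : Scheme.{u}} (g : X ⟶ Y) [IsIso g] (O : Y.Opens) :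
    IsIso (g.app O) := inferInstance

theorem isIso_stalkMap_of_isIso {X Y : Scheme.{u}} (g : X ⟶ Y) [IsIso g] (x : X) :
    IsIso (g.stalkMap x) := inferInstance

section IsoOver

variable {X' X : Scheme.{u}} (f : X' ⟶ X) (U : X.Opens) [IsIso (f ∣_ U)]

theorem isIso_app_of_le {O : X.Opens} (h : O ≤ U) : IsIso (f.app O) := by
  have h1 : U.ι ''ᵁ (U.ι ⁻¹ᵁ O) = O := by
    rw [Hom.image_preimage_eq_opensRange_inf, Opens.opensRange_ι, inf_eq_right.2 h]
  have h2 := morphismRestrict_app f U (U.ι ⁻¹ᵁ O)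
  have h3 : IsIso (f.app (U.ι ''ᵁ (U.ι ⁻¹ᵁ O))) := by
    have : IsIso (f.app (U.ι ''ᵁ (U.ι ⁻¹ᵁ O)) ≫
        X'.presheaf.map (eqToHom (image_morphismRestrict_preimage f U (U.ι ⁻¹ᵁ O))).op) :=
      h2 ▸ isIso_app_of_isIso (f ∣_ U) _
    exact IsIso.of_isIso_comp_right _
      (X'.presheaf.map (eqToHom (image_morphismRestrict_preimage f U (U.ι ⁻¹ᵁ O))).op)
  exact h1 ▸ h3

theorem isIso_stalkMap_of_mem (p : X') (hp : f p ∈ U) : IsIso (f.stalkMap p) := by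
  have h1 := isIso_stalkMap_of_isIso (f ∣_ U) ⟨p, hp⟩
  exact ((MorphismProperty.isomorphisms CommRingCat).arrow_mk_iso_iff
    (morphismRestrictStalkMap f U ⟨p, hp⟩)).1 h1

theorem specializes_of_specializes_of_mem {p q : X'} (hp : f p ∈ U) (h : f q ⤳ f p) : q ⤳ p := by
  have hq : f q ∈ U := h.mem_open U.2 hp
  have h1 : (f ∣_ U) (⟨q, hq⟩ : f ⁻¹ᵁ U) ⤳ (f ∣_ U) (⟨p, hp⟩ : f ⁻¹ᵁ U) := by
    refine (Topology.IsInducing.subtypeVal.specializes_iff (X := U)).1 ?_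
    have e1 := morphismRestrict_base_coe f U ⟨q, hq⟩
    have e2 := morphismRestrict_base_coe f U ⟨p, hp⟩
    exact (specializes_of_eq e1).trans (h.trans (specializes_of_eq e2.symm))
  have h2 := ((f ∣_ U).homeomorph.isInducing.specializes_iff).1 h1
  exact (Topology.IsInducing.subtypeVal.specializes_iff).2 h2

theorem exists_eq_of_mem {x : X} (hx : x ∈ U) : ∃ p, f p = x := by
  obtain ⟨p, hp⟩ := (f ∣_ U).homeomorph.surjective ⟨x, hx⟩
  exact ⟨p.1, by rw [← morphismRestrict_base_coe]; exact congrArg Subtype.val hp⟩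

theorem mem_genericPoints_of_map {p : X'} (hp : f p ∈ U) (h : f p ∈ genericPoints X) :
    p ∈ genericPoints X' := by
  rw [mem_genericPoints_iff] at h ⊢
  intro q hq
  have h1 := h (f q) (hq.map f.continuous)
  exact (hq.antisymm (specializes_of_specializes_of_mem f U (h1 ▸ hp)
    (h1 ▸ specializes_rfl))).eq

theorem map_mem_genericPoints {p : X'} (hp : f p ∈ U) (h : p ∈ genericPoints X') :
    f p ∈ genericPoints X := by
  rw [mem_genericPoints_iff] at h ⊢
  intro x hx
  obtain ⟨q, rfl⟩ := exists_eq_of_mem f U (hx.mem_open U.2 hp)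
  rw [h q (specializes_of_specializes_of_mem f U hp hx)]

end IsoOver

section Reduced

variable {X : Scheme.{u}} [IsReduced X]

/-- A nonempty basic open set contains a generic point, and there the germ of `s` would be a unit.
-/
theorem eq_zero_of_germ_genericPoints {W : X.Opens} (s : Γ(X, W))
    (h : ∀ η (hη : η ∈ W), η ∈ genericPoints X → (X.presheaf.germ W η hη).hom s = 0) : s = 0 := by
  refine eq_zero_of_basicOpen_eq_bot s ?_
  ext x
  simp only [TopologicalSpace.Opens.coe_bot, Set.mem_empty_iff_false, iff_false]
  intro hx
  obtain ⟨η, hη, hηx⟩ := exists_mem_genericPoints_specializes x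
  have h1 : η ∈ X.basicOpen s := hηx.mem_open (X.basicOpen s).2 hx
  have hW := X.basicOpen_le s h1
  rw [X.mem_basicOpen s η hW] at h1
  have := isField_stalk_of_closure_mem_irreducibleComponents X η hη
  have h2 := h η hW hη
  erw [h2] at h1
  exact h1.ne_zero rfl

end Reduced

section Germ

variable {X : Scheme.{u}} {U : X.Opens}

theorem isLocalization_germ (hU : IsAffineOpen U) {x : X} (hx : x ∈ U) :
    letI := (X.presheaf.germ U x hx).hom.toAlgebra
    IsLocalization.AtPrime (X.presheaf.stalk x) (hU.primeIdealOf ⟨x, hx⟩).asIdeal :=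
  hU.isLocalization_stalk ⟨x, hx⟩

theorem exists_germ_mul_eq_germ (hU : IsAffineOpen U) {x : X} (hx : x ∈ U)
    (z : X.presheaf.stalk x) : ∃ a b : Γ(X, U), IsUnit ((X.presheaf.germ U x hx).hom b) ∧
      (X.presheaf.germ U x hx).hom b * z = (X.presheaf.germ U x hx).hom a := by
  let := (X.presheaf.germ U x hx).hom.toAlgebra
  have := isLocalization_germ hU hx
  obtain ⟨⟨a, b⟩, hab⟩ := IsLocalization.surj (hU.primeIdealOf ⟨x, hx⟩).asIdeal.primeCompl z
  exact ⟨a, b, IsLocalization.map_units (X.presheaf.stalk x) b, (mul_comm _ _).trans hab⟩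

theorem mem_primeIdealOf_iff (hU : IsAffineOpen U) {x : X} (hx : x ∈ U) (a : Γ(X, U)) :
    a ∈ (hU.primeIdealOf ⟨x, hx⟩).asIdeal ↔
      (X.presheaf.germ U x hx).hom a ∈ IsLocalRing.maximalIdeal (X.presheaf.stalk x) := by
  let := (X.presheaf.germ U x hx).hom.toAlgebra
  have := isLocalization_germ hU hx
  exact (IsLocalization.AtPrime.to_map_mem_maximal_iff (X.presheaf.stalk x)
    (hU.primeIdealOf ⟨x, hx⟩).asIdeal a).symm

theorem specializes_iff_primeIdealOf_le (hU : IsAffineOpen U) {x y : X} (hx : x ∈ U) (hy : y ∈ U) :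
    x ⤳ y ↔ (hU.primeIdealOf ⟨x, hx⟩).asIdeal ≤ (hU.primeIdealOf ⟨y, hy⟩).asIdeal := by
  have h1 := hU.fromSpec.isOpenEmbedding.isInducing.specializes_iff
    (x := hU.primeIdealOf ⟨x, hx⟩) (y := hU.primeIdealOf ⟨y, hy⟩)
  rw [hU.fromSpec_primeIdealOf, hU.fromSpec_primeIdealOf] at h1
  exact h1.trans (PrimeSpectrum.le_iff_specializes _ _).symm

end Germ

/-! ### The `k`-algebra structure of sections and stalks -/

section StructureMap

variable {k : Type u} [Field k] {X' X : Scheme.{u}} (s : X ⟶ Spec (.of k))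

/-- The ring of sections of a `k`-scheme is a `k`-algebra. -/
noncomputable def sectionsStructureMap (W : X.Opens) : k →+* Γ(X, W) :=
  (X.presheaf.map (homOfLE (le_top : W ≤ ⊤)).op).hom.comp
    (s.appTop.hom.comp (Scheme.ΓSpecIso (.of k)).inv.hom)

/-- The local rings of a `k`-scheme are `k`-algebras. -/
noncomputable def stalkStructureMap (x : X) : k →+* X.presheaf.stalk x :=
  (X.presheaf.germ ⊤ x (TopologicalSpace.Opens.mem_top x)).hom.comp
    (s.appTop.hom.comp (Scheme.ΓSpecIso (.of k)).inv.hom)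

theorem germ_sectionsStructureMap (W : X.Opens) (x : X) (hx : x ∈ W) :
    (X.presheaf.germ W x hx).hom.comp (sectionsStructureMap s W) = stalkStructureMap s x := by
  rw [stalkStructureMap, sectionsStructureMap, ← RingHom.comp_assoc, ← CommRingCat.hom_comp,
    TopCat.Presheaf.germ_res]

theorem stalkSpecializes_stalkStructureMap {x y : X} (h : x ⤳ y) :
    (X.presheaf.stalkSpecializes h).hom.comp (stalkStructureMap s y) = stalkStructureMap s x := by
  rw [stalkStructureMap, ← RingHom.comp_assoc, ← CommRingCat.hom_comp,
    TopCat.Presheaf.germ_stalkSpecializes, stalkStructureMap]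

theorem stalkMap_stalkStructureMap (f : X' ⟶ X) (p : X') :
    (f.stalkMap p).hom.comp (stalkStructureMap s (f p)) = stalkStructureMap (f ≫ s) p := by
  have h1 := Scheme.Hom.germ_stalkMap f ⊤ p (TopologicalSpace.Opens.mem_top _)
  rw [stalkStructureMap, ← RingHom.comp_assoc, ← CommRingCat.hom_comp, h1, stalkStructureMap,
    Scheme.Hom.comp_appTop]
  rfl

theorem finiteType_sectionsStructureMap [LocallyOfFiniteType s] {W : X.Opens}
    (hW : IsAffineOpen W) : (sectionsStructureMap s W).FiniteType := by
  have h1 := s.finiteType_appLE (isAffineOpen_top _) hW le_top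
  rw [sectionsStructureMap, ← RingHom.comp_assoc]
  exact h1.comp (RingHom.FiniteType.of_surjective _
    ((Scheme.ΓSpecIso (.of k)).commRingCatIsoToRingEquiv.symm.surjective))

/-- Allows differentials over the stalk of `Spec k` to be replaced by differentials over `k` itself.
-/
theorem exists_comp_eq_stalkStructureMap (x : X) :
    ∃ σ : k →+* (Spec (.of k)).presheaf.stalk (s x), Function.Surjective σ ∧
      (s.stalkMap x).hom.comp σ = stalkStructureMap s x := by
  refine ⟨((Spec (.of k)).presheaf.germ ⊤ (s x) (TopologicalSpace.Opens.mem_top _)).hom.comp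
    (Scheme.ΓSpecIso (.of k)).inv.hom, ?_, ?_⟩
  · have hk : IsField Γ(Spec (CommRingCat.of k), ⊤) :=
      (Scheme.ΓSpecIso (.of k)).commRingCatIsoToRingEquiv.isField (Field.toIsField k)
    refine Function.Surjective.comp (g := ((Spec (CommRingCat.of k)).presheaf.germ ⊤ (s x)
      (TopologicalSpace.Opens.mem_top _)).hom) ?_
      (Scheme.ΓSpecIso (.of k)).commRingCatIsoToRingEquiv.symm.surjective
    intro z
    obtain ⟨a, b, hb, hab⟩ := exists_germ_mul_eq_germ (isAffineOpen_top (Spec (CommRingCat.of k)))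
      (TopologicalSpace.Opens.mem_top (s x)) z
    have hb0 : b ≠ 0 := fun h => by rw [h, map_zero] at hb; exact not_isUnit_zero hb
    obtain ⟨c, hc⟩ := hk.mul_inv_cancel hb0
    refine ⟨a * c, ?_⟩
    have h2 := congrArg ((Spec (CommRingCat.of k)).presheaf.germ ⊤ (s x)
      (TopologicalSpace.Opens.mem_top _)).hom hc
    rw [map_mul, map_one] at h2
    rw [map_mul, ← hab, mul_right_comm, h2, one_mul]
  · have h1 := Scheme.Hom.germ_stalkMap s ⊤ x (TopologicalSpace.Opens.mem_top _)
    rw [← RingHom.comp_assoc, ← CommRingCat.hom_comp, h1, stalkStructureMap]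
    rfl

end StructureMap

end AlgebraicGeometry.Scheme

end

/-! ### The normalization of a curve is finite -/

section
section FiniteIntegralClosure

variable {S S' : Type*} [CommRing S]

/-- The image of `S` in `L` is a domain with fraction field `L`, and integrality over `S` and over
this image agree. -/
theorem finite_integralClosure_of_exists_frac (k : Type*) [Field k] [PerfectField k]
    [Algebra k S] [Algebra.FiniteType k S] {L : Type*} [Field L] [Algebra S L]
    (hfrac : ∀ l : L, ∃ a b : S, algebraMap S L b ≠ 0 ∧ algebraMap S L b * l = algebraMap S L a) :
    Module.Finite S (integralClosure S L) := by
  let A := (algebraMap S L).range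
  let _ : Algebra k A := ((algebraMap S L).rangeRestrict.comp (algebraMap k S)).toAlgebra
  let _ : Algebra S A := (algebraMap S L).rangeRestrict.toAlgebra
  have : IsScalarTower k S A := .of_algebraMap_eq fun _ => rfl
  have : IsScalarTower S A L := .of_algebraMap_eq fun _ => rfl
  have hsurj : Function.Surjective (algebraMap S A) := (algebraMap S L).rangeRestrict_surjective
  have : Algebra.FiniteType k A :=
    Algebra.FiniteType.of_surjective (IsScalarTower.toAlgHom k S A) hsurj
  have : IsFractionRing A L := by
    refine IsFractionRing.of_field A L fun z => ?_
    obtain ⟨a, b, hb, hab⟩ := hfrac z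
    refine ⟨algebraMap S A a, algebraMap S A b, ?_⟩
    rw [← IsScalarTower.algebraMap_apply, ← IsScalarTower.algebraMap_apply, eq_div_iff hb,
      mul_comm, hab]
  have := finite_integralClosure_of_finiteType k A (L := L)
  have h1 : (Subalgebra.toSubmodule (integralClosure A L)).FG := Module.Finite.iff_fg.1 this
  obtain ⟨T, hT⟩ := h1
  have h2 : Subalgebra.toSubmodule (integralClosure S L) ≤ Submodule.span S (T : Set L) := by
    intro x hx
    rw [← Submodule.restrictScalars_span S A hsurj, hT]
    exact (show IsIntegral S x from hx).tower_top
  have : IsNoetherianRing S := Algebra.FiniteType.isNoetherianRing k S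
  have : IsNoetherian S (Submodule.span S (T : Set L)) :=
    isNoetherian_span_of_finite S T.finite_toSet
  exact Module.Finite.of_injective (Submodule.inclusion h2) (Submodule.inclusion_injective h2)

/-- By integrality `S'` embeds in the product of the integral closures of `S` in the fields `L η`, a
Noetherian `S`-module. -/
theorem finite_of_injective_pi (k : Type*) [Field k] [PerfectField k]
    [Algebra k S] [Algebra.FiniteType k S] [CommRing S'] [Algebra S S'] [Algebra.IsIntegral S S']
    {H : Type*} [Finite H] {L : H → Type*} [∀ η, Field (L η)] (ψ : ∀ η, S' →+* L η)
    (hψ : ∀ s', (∀ η, ψ η s' = 0) → s' = 0)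
    (hfrac : ∀ η, ∀ l : L η, ∃ a b : S, ψ η (algebraMap S S' b) ≠ 0 ∧
      ψ η (algebraMap S S' b) * l = ψ η (algebraMap S S' a)) : Module.Finite S S' := by
  let _ : ∀ η, Algebra S (L η) := fun η => ((ψ η).comp (algebraMap S S')).toAlgebra
  have := fun η => finite_integralClosure_of_exists_frac k (hfrac η)
  have : IsNoetherianRing S := Algebra.FiniteType.isNoetherianRing k S
  let ψ' : ∀ η, S' →ₐ[S] L η := fun η => { ψ η with commutes' := fun _ => rfl }
  let Ψ : S' →ₗ[S] ∀ η, integralClosure S (L η) := LinearMap.pi fun η =>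
    (ψ' η).toLinearMap.codRestrict (Subalgebra.toSubmodule (integralClosure S (L η)))
      fun c => (Algebra.IsIntegral.isIntegral (R := S) c).map (ψ' η)
  refine Module.Finite.of_injective Ψ ?_
  rw [injective_iff_map_eq_zero]
  exact fun s' hs => hψ s' fun η => congrArg Subtype.val (congrFun hs η)

end FiniteIntegralClosure

namespace AlgebraicGeometry.Scheme

variable {k : Type u} [Field k] {X' X : Scheme.{u}}

theorem IsNormalization.isReduced {f : X' ⟶ X} (hf : IsNormalization f) : IsReduced X' := by
  have := hf.isDomain
  exact isReduced_of_isReduced_stalk X'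

theorem isNoetherian_of_locallyOfFiniteType (s : X ⟶ Spec (.of k)) [LocallyOfFiniteType s]
    [QuasiCompact s] : AlgebraicGeometry.IsNoetherian X := by
  have := LocallyOfFiniteType.isLocallyNoetherian s
  have : CompactSpace X := by
    have := QuasiCompact.isCompact_preimage (f := s) _ isOpen_univ isCompact_univ
    rw [Set.preimage_univ] at this
    exact ⟨this⟩
  exact {}

theorem IsNormalization.isFinite [PerfectField k] (s : X ⟶ Spec (.of k)) [LocallyOfFiniteType s]
    [QuasiCompact s] [IsReduced X] {f : X' ⟶ X} (hf : IsNormalization f) : IsFinite f := by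
  have := hf.isIntegralHom
  have := hf.isReduced
  have := isNoetherian_of_locallyOfFiniteType s
  obtain ⟨U, hU, hU', hiso⟩ := hf.birational
  rw [isFinite_iff]
  refine ⟨inferInstance, fun W hW => ?_⟩
  let _ := (sectionsStructureMap s W).toAlgebra
  let _ := (f.app W).hom.toAlgebra
  have : Algebra.FiniteType k Γ(X, W) := finiteType_sectionsStructureMap s hW
  have : Algebra.IsIntegral Γ(X, W) Γ(X', f ⁻¹ᵁ W) :=
    ⟨IsIntegralHom.isIntegral_app f W hW⟩
  -- Over `U` these points correspond to generic points of `X`, so they are finitely many. They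
  -- detect zero because the preimage of `U` is dense and `X'` is reduced.
  let H := {η : X' // f η ∈ W ∧ f η ∈ U ∧ f η ∈ genericPoints X}
  have hfin : Finite H := by
    have : Finite (genericPoints X) :=
      genericPoints.finite TopologicalSpace.NoetherianSpace.finite_irreducibleComponents
    refine Finite.of_injective (fun η : H => (⟨f η.1, η.2.2.2⟩ : genericPoints X)) ?_
    intro a b hab
    have hab : f a.1 = f b.1 := congrArg Subtype.val hab
    exact Subtype.ext ((specializes_of_specializes_of_mem f U b.2.2.1
      (specializes_of_eq hab)).antisymm (specializes_of_specializes_of_mem f U a.2.2.1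
      (specializes_of_eq hab.symm))).eq
  have hfield : ∀ η : H, IsField (X'.presheaf.stalk η.1) := fun η =>
    AlgebraicGeometry.isField_stalk_of_closure_mem_irreducibleComponents X' η.1
      (mem_genericPoints_of_map f U η.2.2.1 η.2.2.2)
  let _ : ∀ η : H, Field (X'.presheaf.stalk η.1) := fun η => (hfield η).toField
  refine finite_of_injective_pi k (S := Γ(X, W)) (H := H)
    (fun η => (X'.presheaf.germ (f ⁻¹ᵁ W) η.1 η.2.1).hom) ?_ ?_
  · intro s' hs'
    refine eq_zero_of_basicOpen_eq_bot s' ?_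
    by_contra hne
    obtain ⟨p, hp, hpU⟩ := hU'.inter_open_nonempty _ (X'.basicOpen s').2
      ((TopologicalSpace.Opens.ne_bot_iff_nonempty _).1 hne)
    obtain ⟨η, hη, hηp⟩ := exists_mem_genericPoints_specializes (f p)
    have hηU := hηp.mem_open U.2 hpU
    obtain ⟨η', rfl⟩ := exists_eq_of_mem f U hηU
    have h1 : η' ∈ X'.basicOpen s' :=
      (specializes_of_specializes_of_mem f U hpU hηp).mem_open (X'.basicOpen s').2 hp
    have hW' := X'.basicOpen_le s' h1
    rw [X'.mem_basicOpen s' η' hW'] at h1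
    have := hs' ⟨η', hW', hηU, hη⟩
    erw [this] at h1
    exact not_isUnit_zero h1
  · rintro ⟨η, hηW, hηU, hη⟩ l
    have := isIso_stalkMap_of_mem f U η hηU
    obtain ⟨l, rfl⟩ := (asIso (f.stalkMap η)).commRingCatIsoToRingEquiv.surjective l
    obtain ⟨a, b, hb, hab⟩ := exists_germ_mul_eq_germ hW hηW l
    have hg : ∀ c, (X'.presheaf.germ (f ⁻¹ᵁ W) η hηW).hom ((f.app W).hom c) =
        (f.stalkMap η).hom ((X.presheaf.germ W (f η) hηW).hom c) := fun c =>
      (Scheme.Hom.germ_stalkMap_apply f W η hηW c).symm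
    refine ⟨a, b, ?_, ?_⟩
    · exact (hg b).trans_ne (hb.map (f.stalkMap η).hom).ne_zero
    · refine (congrArg (· * _) (hg b)).trans (Eq.trans ?_ (hg a).symm)
      rw [← hab, map_mul]
      rfl

end AlgebraicGeometry.Scheme

end

/-! ### Points of the normalization of a curve -/

section
namespace AlgebraicGeometry.Scheme

section Stalk

variable {X : Scheme.{u}}

theorem stalkSpecializes_germ_apply {U : X.Opens} {q p : X} (h : q ⤳ p) (hp : p ∈ U)
    (a : Γ(X, U)) : (X.presheaf.stalkSpecializes h).hom ((X.presheaf.germ U p hp).hom a) =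
      (X.presheaf.germ U q (h.mem_open U.2 hp)).hom a := by
  rw [← CommRingCat.comp_apply, TopCat.Presheaf.germ_stalkSpecializes]

theorem exists_isAffineOpen_mem_le {U : X.Opens} {x : X} (hx : x ∈ U) :
    ∃ W : X.Opens, IsAffineOpen W ∧ x ∈ W ∧ W ≤ U := by
  obtain ⟨W, hW, hxW, hWU⟩ := TopologicalSpace.Opens.isBasis_iff_nbhd.1 X.isBasis_affineOpens hx
  exact ⟨W, hW, hxW, hWU⟩

theorem stalkSpecializes_injective {q p : X} (h : q ⤳ p) [IsDomain (X.presheaf.stalk p)] :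
    Function.Injective (X.presheaf.stalkSpecializes h).hom := by
  rw [injective_iff_map_eq_zero]
  intro z hz
  obtain ⟨W, hW, hp, -⟩ := exists_isAffineOpen_mem_le (TopologicalSpace.Opens.mem_top p)
  have hq := h.mem_open W.2 hp
  obtain ⟨a, b, hb, hab⟩ := exists_germ_mul_eq_germ hW hp z
  have h1 := congrArg (X.presheaf.stalkSpecializes h).hom hab
  rw [map_mul, hz, mul_zero, stalkSpecializes_germ_apply] at h1
  let := (X.presheaf.germ W q hq).hom.toAlgebra
  have := isLocalization_germ hW hq
  obtain ⟨c, hc⟩ := (IsLocalization.map_eq_zero_iff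
    (hW.primeIdealOf ⟨q, hq⟩).asIdeal.primeCompl (X.presheaf.stalk q) a).1 h1.symm
  have hcu : IsUnit ((X.presheaf.germ W q hq).hom c) :=
    IsLocalization.map_units (X.presheaf.stalk q) c
  have h2 := congrArg (X.presheaf.germ W p hp).hom hc
  rw [map_mul, map_zero, mul_eq_zero] at h2
  rcases h2 with h2 | h2
  · rw [← stalkSpecializes_germ_apply h hp, h2, map_zero] at hcu
    exact absurd hcu not_isUnit_zero
  · rw [h2] at hab
    exact hb.mul_right_eq_zero.1 hab

theorem isField_stalk_of_mem_genericPoints [IsReduced X] {η : X} (hη : η ∈ genericPoints X) :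
    IsField (X.presheaf.stalk η) :=
  AlgebraicGeometry.isField_stalk_of_closure_mem_irreducibleComponents X η hη

/-- Both generic points are given by the kernel of the map to the domain `𝒪_p`, since this domain
embeds in the fields at `η` and `η'`. -/
theorem eq_of_specializes_of_mem_genericPoints [IsReduced X] {η η' p : X}
    [IsDomain (X.presheaf.stalk p)] (hη : η ∈ genericPoints X) (hη' : η' ∈ genericPoints X)
    (h : η ⤳ p) (h' : η' ⤳ p) : η = η' := by
  obtain ⟨W, hW, hp, -⟩ := exists_isAffineOpen_mem_le (TopologicalSpace.Opens.mem_top p)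
  have key : ∀ {η : X}, η ∈ genericPoints X → ∀ h : η ⤳ p, ∀ a : Γ(X, W),
      a ∈ (hW.primeIdealOf ⟨η, h.mem_open W.2 hp⟩).asIdeal ↔
        (X.presheaf.germ W p hp).hom a = 0 := by
    intro η hη h a
    rw [mem_primeIdealOf_iff, (IsLocalRing.isField_iff_maximalIdeal_eq.1
      (isField_stalk_of_mem_genericPoints hη)), Ideal.mem_bot,
      ← stalkSpecializes_germ_apply h hp, map_eq_zero_iff _ (stalkSpecializes_injective h)]
  have hm := h.mem_open W.2 hp
  have hm' := h'.mem_open W.2 hp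
  refine (((specializes_iff_primeIdealOf_le hW hm hm').2 fun a ha => ?_).antisymm
    ((specializes_iff_primeIdealOf_le hW hm' hm).2 fun a ha => ?_)).eq
  · exact (key hη' h' a).2 ((key hη h a).1 ha)
  · exact (key hη h a).2 ((key hη' h' a).1 ha)

end Stalk

/-- `f` is the normalization of a reduced curve `X` over `k`. -/
structure IsCurveNormalization {k : Type u} [Field k] {X' X : Scheme.{u}}
    (s : X ⟶ Spec (.of k)) (f : X' ⟶ X) : Prop where
  locallyOfFiniteType : LocallyOfFiniteType s
  quasiCompact : QuasiCompact s
  isReduced : IsReduced X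
  isOneDimensional : IsOneDimensional X
  isNormalization : IsNormalization f

namespace IsCurveNormalization

variable {k : Type u} [Field k] [IsAlgClosed k] {X' X : Scheme.{u}} {s : X ⟶ Spec (.of k)}
  {f : X' ⟶ X}

theorem isFinite (C : IsCurveNormalization s f) : IsFinite f := by
  have := C.locallyOfFiniteType
  have := C.quasiCompact
  have := C.isReduced
  exact C.isNormalization.isFinite s

theorem isNoetherian (C : IsCurveNormalization s f) : AlgebraicGeometry.IsNoetherian X := by
  have := C.locallyOfFiniteType
  have := C.quasiCompact
  exact isNoetherian_of_locallyOfFiniteType s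

theorem locallyOfFiniteType_comp (C : IsCurveNormalization s f) :
    LocallyOfFiniteType (f ≫ s) := by
  have := C.isFinite
  have := C.locallyOfFiniteType
  infer_instance

theorem isNoetherian_source (C : IsCurveNormalization s f) :
    AlgebraicGeometry.IsNoetherian X' := by
  have := C.isFinite
  have := C.quasiCompact
  have := C.locallyOfFiniteType_comp
  exact isNoetherian_of_locallyOfFiniteType (f ≫ s)

theorem isReduced_source (C : IsCurveNormalization s f) :
    IsReduced X' := C.isNormalization.isReduced

theorem isDomain (C : IsCurveNormalization s f)
    (p : X') : IsDomain (X'.presheaf.stalk p) := C.isNormalization.isDomain p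

theorem exists_isIso (C : IsCurveNormalization s f) :
    ∃ U : X.Opens, IsIso (f ∣_ U) ∧ (∀ η ∈ genericPoints X, η ∈ U) ∧
    ∀ η ∈ genericPoints X', f η ∈ U := by
  have := C.isNoetherian
  have := C.isNoetherian_source
  obtain ⟨U, hU, hU', hiso⟩ := C.isNormalization.birational
  exact ⟨U, hiso, fun η hη => hU.mem_of_mem_genericPoints U.2 hη,
    fun η hη => hU'.mem_of_mem_genericPoints (f ⁻¹ᵁ U).2 hη⟩

theorem map_mem_genericPoints (C : IsCurveNormalization s f)
    {η : X'} (hη : η ∈ genericPoints X') :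
    f η ∈ genericPoints X := by
  obtain ⟨U, _, -, hU'⟩ := C.exists_isIso
  exact Scheme.map_mem_genericPoints f U (hU' η hη) hη

theorem isIso_stalkMap (C : IsCurveNormalization s f)
    {η : X'} (hη : η ∈ genericPoints X') : IsIso (f.stalkMap η) := by
  obtain ⟨U, _, -, hU'⟩ := C.exists_isIso
  exact isIso_stalkMap_of_mem f U η (hU' η hη)

theorem exists_mem_genericPoints_eq (C : IsCurveNormalization s f)
    {x : X} (hx : x ∈ genericPoints X) :
    ∃ η ∈ genericPoints X', f η = x := by
  obtain ⟨U, _, hU, hU'⟩ := C.exists_isIso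
  obtain ⟨η, rfl⟩ := exists_eq_of_mem f U (hU x hx)
  exact ⟨η, mem_genericPoints_of_map f U (hU _ hx) hx, rfl⟩

theorem finite_genericPoints (C : IsCurveNormalization s f) : Finite (genericPoints X') := by
  have := C.isNoetherian_source
  exact genericPoints.finite TopologicalSpace.NoetherianSpace.finite_irreducibleComponents

theorem finite_fiber (C : IsCurveNormalization s f) (x : X) : Finite {p : X' // f p = x} := by
  have := C.isFinite
  exact Scheme.Hom.finite_preimage_singleton f x

theorem eq_of_specializes_of_map_eq (C : IsCurveNormalization s f)
    {p q : X'} (h : q ⤳ p) (he : f q = f p) : q = p := by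
  have := C.isFinite
  have h1 := f.isDiscrete_preimage_singleton (f p)
  have h2 := h1.to_subtype
  have : (⟨q, he⟩ : f ⁻¹' {f p}) ⤳ ⟨p, rfl⟩ := Topology.IsInducing.subtypeVal.specializes_iff.1 h
  exact congrArg Subtype.val this.eq

/-- Fibres of a finite morphism are discrete, so strict specializations stay strict in `X`, where
chains have length at most one. -/
theorem isClosed_or_mem_genericPoints (C : IsCurveNormalization s f) (p : X') :
    IsClosed ({p} : Set X') ∨ p ∈ genericPoints X' := by
  by_contra! hcon
  obtain ⟨hcl, hgen⟩ := hcon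
  obtain ⟨η, hη, hηp⟩ := exists_mem_genericPoints_specializes p
  refine hcl (closure_subset_iff_isClosed.1 fun q hq => ?_)
  have hpq : p ⤳ q := specializes_iff_mem_closure.2 hq
  have hne : f η ≠ f p := fun h => hgen (C.eq_of_specializes_of_map_eq hηp h ▸ hη)
  have := C.isOneDimensional.eq_of_specializes (hηp.map f.continuous) (hpq.map f.continuous) hne
  exact (C.eq_of_specializes_of_map_eq hpq this).symm

theorem isClosed_map (C : IsCurveNormalization s f)
    {p : X'} (hp : IsClosed ({p} : Set X')) : IsClosed ({f p} : Set X) := by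
  have := C.isFinite
  simpa using f.isClosedMap _ hp

theorem notMem_genericPoints_of_isClosed (C : IsCurveNormalization s f)
    {p : X'} (hp : IsClosed ({p} : Set X')) :
    p ∉ genericPoints X' := fun h =>
  C.isOneDimensional.not_isClosed_of_mem_genericPoints (C.map_mem_genericPoints h)
    (C.isClosed_map hp)

theorem isClosed_of_isClosed_map (C : IsCurveNormalization s f)
    {p : X'} (hp : IsClosed ({f p} : Set X)) :
    IsClosed ({p} : Set X') :=
  (C.isClosed_or_mem_genericPoints p).resolve_right fun h =>
    C.isOneDimensional.not_isClosed_of_mem_genericPoints (C.map_mem_genericPoints h) hp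

theorem mem_genericPoints_of_specializes (C : IsCurveNormalization s f)
    {p q : X'} (h : q ⤳ p) (hne : q ≠ p) :
    q ∈ genericPoints X' :=
  (C.isClosed_or_mem_genericPoints q).resolve_left fun hq => hne
    (Set.mem_singleton_iff.1 (hq.closure_eq ▸ specializes_iff_mem_closure.1 h :)).symm

end IsCurveNormalization

end AlgebraicGeometry.Scheme

end

/-! ### Local rings of the normalization: residue fields, valuation rings, differentials -/

section
theorem span_D_eq_top_of_exists_frac {k V W : Type*} [Field k] [CommRing V] [CommRing W]
    [Algebra k V] [Algebra k W] [Algebra V W] [IsScalarTower k V W] {τ : V}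
    (hfrac : ∀ w : W, ∃ a b : V, IsUnit (algebraMap V W b) ∧
      algebraMap V W b * w = algebraMap V W a)
    (hτ : Submodule.span V {KaehlerDifferential.D k V τ} = ⊤) :
    Submodule.span W {KaehlerDifferential.D k W (algebraMap V W τ)} = ⊤ := by
  have key : ∀ v : V, KaehlerDifferential.D k W (algebraMap V W v) ∈
      Submodule.span W {KaehlerDifferential.D k W (algebraMap V W τ)} := by
    intro v
    obtain ⟨c, hc⟩ := Submodule.mem_span_singleton.1
      (hτ ▸ Submodule.mem_top : KaehlerDifferential.D k V v ∈
        Submodule.span V {KaehlerDifferential.D k V τ})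
    have h1 := congrArg (KaehlerDifferential.map k k V W) hc
    rw [map_smul, KaehlerDifferential.map_D, KaehlerDifferential.map_D,
      ← algebraMap_smul W c] at h1
    rw [← h1]
    exact Submodule.smul_mem _ _ (Submodule.mem_span_singleton_self _)
  rw [eq_top_iff, ← KaehlerDifferential.span_range_derivation, Submodule.span_le]
  rintro _ ⟨w, rfl⟩
  obtain ⟨a, b, hb, hab⟩ := hfrac w
  have h2 := congrArg (KaehlerDifferential.D k W) hab
  rw [Derivation.leibniz, ← eq_sub_iff_add_eq] at h2
  rw [SetLike.mem_coe, ← Submodule.smul_mem_iff_of_isUnit _ hb, h2]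
  exact Submodule.sub_mem _ (key a) (Submodule.smul_mem _ _ (key b))

theorem exists_algebraMap_eq_of_field (k : Type*) {L : Type*} [Field k] [IsAlgClosed k] [Field L]
    [Algebra k L] [Algebra.FiniteType k L] (a : L) : ∃ c : k, algebraMap k L c = a := by
  have : Module.Finite k L := finite_of_finite_type_of_isJacobsonRing k L
  exact IsAlgClosed.algebraMap_bijective_of_isIntegral.2 a

namespace AlgebraicGeometry.Scheme

variable {k : Type u} [Field k] [IsAlgClosed k] {X' X : Scheme.{u}} {s : X ⟶ Spec (.of k)}
  {f : X' ⟶ X}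

theorem essFiniteType_stalkStructureMap (s : X ⟶ Spec (.of k)) [LocallyOfFiniteType s] (x : X) :
    (stalkStructureMap s x).EssFiniteType := by
  obtain ⟨σ, hσ, h⟩ := exists_comp_eq_stalkStructureMap s x
  rw [← h]
  exact (RingHom.FiniteType.of_surjective σ hσ).essFiniteType.comp
    (LocallyOfFiniteType.stalkMap s x)

/-- By the Nullstellensatz sections on an affine neighbourhood have residues in `k`; the residue of
a fraction is the quotient of the residues. -/
theorem exists_sub_stalkStructureMap_mem (s : X ⟶ Spec (.of k)) [LocallyOfFiniteType s] {x : X}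
    (hx : IsClosed ({x} : Set X)) (z : X.presheaf.stalk x) :
    ∃ c : k, z - stalkStructureMap s x c ∈ IsLocalRing.maximalIdeal (X.presheaf.stalk x) := by
  obtain ⟨W, hW, hxW, -⟩ := exists_isAffineOpen_mem_le (TopologicalSpace.Opens.mem_top x)
  have hmax := hW.primeIdealOf_isMaximal_of_isClosed ⟨x, hxW⟩ hx
  set 𝔪 := (hW.primeIdealOf ⟨x, hxW⟩).asIdeal
  have hconst : ∀ a : Γ(X, W), ∃ c : k, (X.presheaf.germ W x hxW).hom a -
      stalkStructureMap s x c ∈ IsLocalRing.maximalIdeal (X.presheaf.stalk x) := by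
    intro a
    let _ := Ideal.Quotient.field 𝔪
    let _ := ((Ideal.Quotient.mk 𝔪).comp (sectionsStructureMap s W)).toAlgebra
    have : Algebra.FiniteType k (Γ(X, W) ⧸ 𝔪) :=
      (RingHom.FiniteType.of_surjective _ Ideal.Quotient.mk_surjective).comp
        (finiteType_sectionsStructureMap s hW)
    obtain ⟨c, hc⟩ := exists_algebraMap_eq_of_field k (Ideal.Quotient.mk 𝔪 a)
    refine ⟨c, ?_⟩
    rw [← germ_sectionsStructureMap s W x hxW, RingHom.comp_apply, ← map_sub,
      ← mem_primeIdealOf_iff hW]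
    exact Ideal.Quotient.eq.1 hc.symm
  obtain ⟨a, b, hb, hab⟩ := exists_germ_mul_eq_germ hW hxW z
  obtain ⟨α, hα⟩ := hconst a
  obtain ⟨β, hβ⟩ := hconst b
  have hβ0 : β ≠ 0 := by
    rintro rfl
    rw [map_zero, sub_zero] at hβ
    exact (IsLocalRing.mem_maximalIdeal _).1 hβ hb
  refine ⟨α / β, (Ideal.unit_mul_mem_iff_mem _ hb).1 ?_⟩
  have h1 : stalkStructureMap s x α = stalkStructureMap s x β * stalkStructureMap s x (α / β) := by
    rw [← map_mul, mul_div_cancel₀ _ hβ0]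
  have h2 : (X.presheaf.germ W x hxW).hom b * (z - stalkStructureMap s x (α / β)) =
      ((X.presheaf.germ W x hxW).hom a - stalkStructureMap s x α) -
        stalkStructureMap s x (α / β) *
          ((X.presheaf.germ W x hxW).hom b - stalkStructureMap s x β) := by
    rw [mul_sub, hab, h1]
    ring
  rw [h2]
  exact sub_mem hα (Ideal.mul_mem_left _ _ hβ)

namespace IsCurveNormalization

/-- The prime `Q` is a generization `q` of `p`. If `q ≠ p`, then `q` is generic, its stalk is a
field containing the stalk at `p`, and `Q` is zero. -/
theorem eq_maximalIdeal_of_isPrime (C : IsCurveNormalization s f) (p : X')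
    (Q : Ideal (X'.presheaf.stalk p)) (hQ : Q ≠ ⊥) [hQp : Q.IsPrime] :
    Q = IsLocalRing.maximalIdeal (X'.presheaf.stalk p) := by
  have := C.isReduced_source
  have := C.isDomain p
  obtain ⟨W, hW, hp, -⟩ := exists_isAffineOpen_mem_le (TopologicalSpace.Opens.mem_top p)
  let := (X'.presheaf.germ W p hp).hom.toAlgebra
  have hloc := isLocalization_germ hW hp
  let y : Spec Γ(X', W) := ⟨Q.comap (X'.presheaf.germ W p hp).hom, inferInstance⟩
  have hqW : hW.fromSpec y ∈ W := by
    have := Set.mem_range_self (f := hW.fromSpec) y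
    rw [hW.range_fromSpec] at this
    exact this
  have hy : hW.primeIdealOf ⟨hW.fromSpec y, hqW⟩ = y :=
    hW.fromSpec.isOpenEmbedding.injective (hW.fromSpec_primeIdealOf _)
  generalize hW.fromSpec y = q at hqW hy
  have hyQ : (hW.primeIdealOf ⟨q, hqW⟩).asIdeal = Q.comap (X'.presheaf.germ W p hp).hom := by
    rw [hy]
  have hqp : q ⤳ p := by
    rw [specializes_iff_primeIdealOf_le hW hqW hp, hyQ]
    intro a ha
    exact (mem_primeIdealOf_iff hW hp a).2 (IsLocalRing.le_maximalIdeal hQp.ne_top ha)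
  have key : ∀ z, z ∈ Q ↔ (X'.presheaf.stalkSpecializes hqp).hom z ∈
      IsLocalRing.maximalIdeal (X'.presheaf.stalk q) := by
    intro z
    obtain ⟨a, b, hb, hab⟩ := exists_germ_mul_eq_germ hW hp z
    rw [← Ideal.unit_mul_mem_iff_mem Q hb, hab, ← Ideal.unit_mul_mem_iff_mem _
      (hb.map (X'.presheaf.stalkSpecializes hqp).hom), ← map_mul, hab,
      stalkSpecializes_germ_apply hqp hp, ← mem_primeIdealOf_iff hW, hyQ]
    rfl
  by_cases hne : q = p
  · subst hne
    ext z
    rw [key z, TopCat.Presheaf.stalkSpecializes_refl]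
    rfl
  · refine absurd ?_ hQ
    rw [eq_bot_iff]
    intro z hz
    rw [key z, IsLocalRing.isField_iff_maximalIdeal_eq.1 (isField_stalk_of_mem_genericPoints
      (C.mem_genericPoints_of_specializes hqp hne)), Ideal.mem_bot] at hz
    exact (map_eq_zero_iff _ (stalkSpecializes_injective hqp)).1 hz

theorem not_isField_stalk (C : IsCurveNormalization s f) {p : X'}
    (hp : IsClosed ({p} : Set X')) : ¬ IsField (X'.presheaf.stalk p) := by
  intro hfield
  obtain ⟨W, hW, hpW, -⟩ := exists_isAffineOpen_mem_le (TopologicalSpace.Opens.mem_top p)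
  obtain ⟨η, hη, hηp⟩ := exists_mem_genericPoints_specializes p
  have h1 : p ⤳ η := by
    rw [specializes_iff_primeIdealOf_le hW hpW (hηp.mem_open W.2 hpW)]
    intro a ha
    rw [mem_primeIdealOf_iff, IsLocalRing.isField_iff_maximalIdeal_eq.1 hfield,
      Ideal.mem_bot] at ha
    rw [mem_primeIdealOf_iff, ← stalkSpecializes_germ_apply hηp hpW, ha, map_zero]
    exact zero_mem _
  exact C.notMem_genericPoints_of_isClosed hp ((hηp.antisymm h1).eq ▸ hη)

theorem isDiscreteValuationRing (C : IsCurveNormalization s f) {p : X'}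
    (hp : IsClosed ({p} : Set X')) :
    haveI := C.isDomain p
    IsDiscreteValuationRing (X'.presheaf.stalk p) := by
  have := C.isNoetherian_source
  have := C.isDomain p
  have h1 : IsLocalRing.maximalIdeal (X'.presheaf.stalk p) ≠ ⊥ := fun h =>
    C.not_isField_stalk hp (IsLocalRing.isField_iff_maximalIdeal_eq.2 h)
  have h2 := (IsDiscreteValuationRing.TFAE (X'.presheaf.stalk p) (C.not_isField_stalk hp)).out 0 3
  refine h2.2 ⟨C.isNormalization.isIntegrallyClosed p, IsLocalRing.maximalIdeal _,
    ⟨h1, inferInstance⟩, fun Q hQ => ?_⟩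
  have := hQ.2
  exact C.eq_maximalIdeal_of_isPrime p Q hQ.1

/-- Specialize `p` to a closed point, where a uniformizer works, and localize back. -/
theorem exists_span_D_eq_top (C : IsCurveNormalization s f) (p : X') :
    letI := (stalkStructureMap (f ≫ s) p).toAlgebra
    ∃ τ : X'.presheaf.stalk p, Submodule.span (X'.presheaf.stalk p)
      {KaehlerDifferential.D k (X'.presheaf.stalk p) τ} = ⊤ := by
  have := C.locallyOfFiniteType_comp
  have := C.isNoetherian_source
  obtain ⟨q, hpq, hq⟩ : ∃ q, p ⤳ q ∧ IsClosed ({q} : Set X') := by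
    obtain ⟨q, hq, hq'⟩ := IsClosed.exists_closed_singleton (isClosed_closure (s := {p}))
      (Set.singleton_nonempty p).closure
    exact ⟨q, specializes_iff_mem_closure.2 hq, hq'⟩
  have := C.isDomain q
  have := C.isDiscreteValuationRing hq
  let _ := (stalkStructureMap (f ≫ s) p).toAlgebra
  let _ := (stalkStructureMap (f ≫ s) q).toAlgebra
  let _ := (X'.presheaf.stalkSpecializes hpq).hom.toAlgebra
  have : IsScalarTower k (X'.presheaf.stalk q) (X'.presheaf.stalk p) :=
    .of_algebraMap_eq' (stalkSpecializes_stalkStructureMap (f ≫ s) hpq).symm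
  have : Algebra.EssFiniteType k (X'.presheaf.stalk q) :=
    essFiniteType_stalkStructureMap (f ≫ s) q
  obtain ⟨τ, hτ⟩ := IsDiscreteValuationRing.exists_prime (X'.presheaf.stalk q)
  have hres : ∀ a, ∃ c : k, τ ∣ a - algebraMap k (X'.presheaf.stalk q) c := by
    intro a
    obtain ⟨c, hc⟩ := exists_sub_stalkStructureMap_mem (f ≫ s) hq a
    rw [hτ.irreducible.maximalIdeal_eq, Ideal.mem_span_singleton] at hc
    exact ⟨c, hc⟩
  refine ⟨_, span_D_eq_top_of_exists_frac (fun w => ?_)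
    (exists_derivation_uniformizer hτ hres).1⟩
  obtain ⟨W, hW, hqW, -⟩ := exists_isAffineOpen_mem_le (TopologicalSpace.Opens.mem_top q)
  obtain ⟨a, b, hb, hab⟩ := exists_germ_mul_eq_germ hW (hpq.mem_open W.2 hqW) w
  rw [← stalkSpecializes_germ_apply hpq hqW] at hb hab
  rw [← stalkSpecializes_germ_apply hpq hqW] at hab
  exact ⟨_, _, hb, hab⟩

end IsCurveNormalization

end AlgebraicGeometry.Scheme

end

/-! ### From ideals to divisors on the normalization -/

section
theorem TopologicalSpace.NoetherianSpace.finite_of_isClosed {X : Type*} [TopologicalSpace X]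
    [NoetherianSpace X] [QuasiSober X] {T : Set X} (hT : IsClosed T)
    (h : ∀ x ∈ T, IsClosed ({x} : Set X)) : T.Finite := by
  obtain ⟨S, hS, hcl, hirr, rfl⟩ := NoetherianSpace.exists_finite_set_isClosed_irreducible hT
  refine hS.sUnion fun t ht => ?_
  have h1 := (hirr t ht).closure_genericPoint (hcl t ht)
  have h2 : (hirr t ht).genericPoint ∈ t := by
    have := subset_closure (Set.mem_singleton (hirr t ht).genericPoint)
    rwa [h1] at this
  rw [(h _ ⟨t, ht, h2⟩).closure_eq] at h1
  rw [← h1]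
  exact Set.finite_singleton _

namespace AlgebraicGeometry.Scheme

variable {k : Type u} [Field k] [IsAlgClosed k] {X' X : Scheme.{u}} {s : X ⟶ Spec (.of k)}
  {f : X' ⟶ X}

theorem stalkSpecializes_stalkMap_hom_apply (f : X' ⟶ X) {q p : X'} (h : q ⤳ p)
    (a : X.presheaf.stalk (f p)) :
    (X'.presheaf.stalkSpecializes h).hom ((f.stalkMap p).hom a) =
      (f.stalkMap q).hom ((X.presheaf.stalkSpecializes (h.map f.continuous)).hom a) :=
  (Scheme.Hom.stalkSpecializes_stalkMap_apply f q p h a).symm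

theorem stalkMap_germ_hom_apply (f : X' ⟶ X) {W : X.Opens} {p : X'} (hp : f p ∈ W)
    (a : Γ(X, W)) : (f.stalkMap p).hom ((X.presheaf.germ W (f p) hp).hom a) =
      (X'.presheaf.germ (f ⁻¹ᵁ W) p hp).hom ((f.app W).hom a) :=
  Scheme.Hom.germ_stalkMap_apply f W p hp a

section IdealSheaf

variable (I : X.IdealSheafData)

theorem idealStalks_eq_map {W : X.Opens} (hW : IsAffineOpen W) {x : X} (hx : x ∈ W) :
    idealStalks I x = (I.ideal ⟨W, hW⟩).map (X.presheaf.germ W x hx).hom := by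
  have key : ∀ {U W : X.affineOpens} (h : U ≤ W) (hx : x ∈ U.1),
      (I.ideal W).map (X.presheaf.germ W.1 x (h hx)).hom =
        (I.ideal U).map (X.presheaf.germ U.1 x hx).hom := by
    intro U W h hx
    rw [← I.map_ideal h, Ideal.map_map, ← CommRingCat.hom_comp]
    exact congrArg (fun φ => Ideal.map (CommRingCat.Hom.hom φ) (I.ideal W))
      (X.presheaf.germ_res (show U.1 ⟶ W.1 from homOfLE h) x hx).symm
  refine le_antisymm (iSup₂_le fun U hU => ?_) (le_iSup₂_of_le ⟨W, hW⟩ hx le_rfl)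
  obtain ⟨T, hT, hxT, hTW⟩ := exists_isAffineOpen_mem_le (U := U.1 ⊓ W) (x := x) ⟨hU, hx⟩
  rw [key (U := ⟨T, hT⟩) (W := U) (hTW.trans inf_le_left) hxT,
    ← key (U := ⟨T, hT⟩) (W := ⟨W, hW⟩) (hTW.trans inf_le_right) hxT]

theorem idealStalks_eq_top_iff {W : X.Opens} (hW : IsAffineOpen W) {x : X} (hx : x ∈ W) :
    idealStalks I x = ⊤ ↔ ∃ a ∈ I.ideal ⟨W, hW⟩, x ∈ X.basicOpen a := by
  rw [idealStalks_eq_map I hW hx]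
  constructor
  · intro h
    by_contra! hcon
    refine IsLocalRing.maximalIdeal.isMaximal (X.presheaf.stalk x) |>.ne_top (top_unique ?_)
    rw [← h, Ideal.map_le_iff_le_comap]
    exact fun a ha => (IsLocalRing.mem_maximalIdeal _).2 fun hu =>
      hcon a ha ((X.mem_basicOpen a x hx).2 hu)
  · rintro ⟨a, ha, hxa⟩
    exact Ideal.eq_top_of_isUnit_mem _ (Ideal.mem_map_of_mem _ ha)
      ((X.mem_basicOpen a x hx).1 hxa)

theorem isOpen_setOf_idealStalks_eq_top : IsOpen {x | idealStalks I x = ⊤} := by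
  rw [isOpen_iff_mem_nhds]
  intro x hx
  obtain ⟨W, hW, hxW, -⟩ := exists_isAffineOpen_mem_le (TopologicalSpace.Opens.mem_top x)
  obtain ⟨a, ha, hxa⟩ := (idealStalks_eq_top_iff I hW hxW).1 hx
  filter_upwards [(X.basicOpen a).2.mem_nhds hxa] with y hy
  exact (idealStalks_eq_top_iff I hW (X.basicOpen_le a hy)).2 ⟨a, ha, hy⟩

end IdealSheaf

namespace IsCurveNormalization

/-- The complement of `V` is a finite set of closed points; at each of them a nonzero ideal of a
discrete valuation ring is a power of the maximal ideal. -/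
theorem exists_isDivisorOf (C : IsCurveNormalization s f) (I : StalkIdeals X') {V : X'.Opens}
    (hV : ∀ η ∈ genericPoints X', η ∈ V) (htop : ∀ p ∈ V, I p = ⊤)
    (hbot : ∀ p, IsClosed ({p} : Set X') → I p ≠ ⊥) :
    ∃ D : AlgebraicCycle X' ℤ, IsDivisorOf D I := by
  have := C.isNoetherian_source
  have h1 : ∀ p, ∃ n : ℕ, I p = IsLocalRing.maximalIdeal (X'.presheaf.stalk p) ^ n ∧
      (n ≠ 0 → p ∉ V) := by
    intro p
    by_cases hp : p ∈ V
    · exact ⟨0, by rw [htop p hp, pow_zero, Ideal.one_eq_top], fun h => absurd rfl h⟩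
    · have hcl := (C.isClosed_or_mem_genericPoints p).resolve_right fun h => hp (hV p h)
      have := C.isDomain p
      have := C.isDiscreteValuationRing hcl
      obtain ⟨n, hn⟩ := exists_maximalIdeal_pow_eq_of_principal (X'.presheaf.stalk p)
        (IsPrincipalIdealRing.principal _) (I p) (hbot p hcl)
      exact ⟨n, hn, fun _ => hp⟩
  choose n hn hnV using h1
  have hcl : ∀ p, p ∉ V → IsClosed ({p} : Set X') := fun p hp =>
    (C.isClosed_or_mem_genericPoints p).resolve_right fun h => hp (hV p h)
  have hfin : ((V : Set X')ᶜ).Finite :=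
    TopologicalSpace.NoetherianSpace.finite_of_isClosed V.2.isClosed_compl fun p hp => hcl p hp
  refine ⟨⟨fun p => n p, fun _ _ => trivial, fun z _ => ⟨Set.univ, Filter.univ_mem, ?_⟩⟩,
    ⟨fun p hp => ?_, fun p => Int.natCast_nonneg _, fun p => hn p⟩⟩
  · refine hfin.subset ?_
    rintro p ⟨-, hp⟩
    exact hnV p (by simpa using hp)
  · exact hcl p (hnV p (Int.natCast_ne_zero.1 hp))

theorem exists_isDivisorOf_idealStalks (C : IsCurveNormalization s f) (a : X.IdealSheafData)
    (ha : ∀ η : X, closure {η} ∈ irreducibleComponents X → idealStalks a η ≠ ⊥) :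
    ∃ Z : AlgebraicCycle X' ℤ, IsDivisorOf Z (pullbackIdeal f (idealStalks a)) := by
  have := C.isReduced
  have htop : ∀ η ∈ genericPoints X', idealStalks a (f η) = ⊤ := by
    intro η hη
    have h1 := C.map_mem_genericPoints hη
    let _ := (isField_stalk_of_mem_genericPoints h1).toField
    exact (eq_bot_or_eq_top (idealStalks a (f η))).resolve_left (ha _ h1)
  refine C.exists_isDivisorOf _ (V := f ⁻¹ᵁ ⟨_, isOpen_setOf_idealStalks_eq_top a⟩) htop
    (fun p hp => ?_) fun p _ hbot => ?_
  · have hp' : idealStalks a (f p) = ⊤ := hp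
    rw [pullbackIdeal, hp', Ideal.map_top]
  · obtain ⟨η, hη, hηp⟩ := exists_mem_genericPoints_specializes p
    obtain ⟨W, hW, hxW, -⟩ := exists_isAffineOpen_mem_le (TopologicalSpace.Opens.mem_top (f p))
    have hηW : f η ∈ W := (hηp.map f.continuous).mem_open W.2 hxW
    obtain ⟨b, hb, hηb⟩ := (idealStalks_eq_top_iff a hW hηW).1 (htop η hη)
    have h1 : (X.presheaf.germ W (f p) hxW).hom b ∈ idealStalks a (f p) := by
      rw [idealStalks_eq_map a hW hxW]
      exact Ideal.mem_map_of_mem _ hb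
    have h2 : (f.stalkMap p).hom ((X.presheaf.germ W (f p) hxW).hom b) = 0 := by
      have := Ideal.mem_map_of_mem (f.stalkMap p).hom h1
      rw [pullbackIdeal] at hbot
      rwa [hbot, Ideal.mem_bot] at this
    have h3 := congrArg (X'.presheaf.stalkSpecializes hηp).hom h2
    rw [stalkSpecializes_stalkMap_hom_apply, stalkSpecializes_germ_apply, map_zero] at h3
    have h4 : IsUnit ((X.presheaf.germ W (f η) hηW).hom b) := (X.mem_basicOpen b _ hηW).1 hηb
    have h5 := h4.map (f.stalkMap η).hom
    rw [h3] at h5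
    exact not_isUnit_zero h5

end IsCurveNormalization

end AlgebraicGeometry.Scheme

end

/-! ### The two Jacobian ideals define divisors -/

section
namespace AlgebraicGeometry.Scheme

variable {k : Type u} [Field k] [IsAlgClosed k] {X' X : Scheme.{u}} {s : X ⟶ Spec (.of k)}
  {f : X' ⟶ X}

theorem jacobianIdeal_eq_fittingIdeal (s : X ⟶ Spec (.of k)) (d : ℕ) (x : X) :
    letI := (stalkStructureMap s x).toAlgebra
    jacobianIdeal s d x =
      fittingIdeal (X.presheaf.stalk x) (KaehlerDifferential k (X.presheaf.stalk x)) d := by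
  let _ := (stalkStructureMap s x).toAlgebra
  obtain ⟨σ, hσ, h⟩ := exists_comp_eq_stalkStructureMap s x
  exact differentialFitting_eq_of_surjective σ hσ (s.stalkMap x).hom h d

/-- The stalk at `q` is a localization of the stalk at `x`, so cyclicity of the differentials at `q`
puts a denominator into the Fitting ideal at `x`. -/
theorem exists_mem_fittingIdeal_isUnit_stalkSpecializes (s : X ⟶ Spec (.of k))
    [LocallyOfFiniteType s] {q x : X} (h : q ⤳ x)
    (hq : letI := (stalkStructureMap s q).toAlgebra
      ∃ τ : X.presheaf.stalk q, Submodule.span (X.presheaf.stalk q)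
        {KaehlerDifferential.D k (X.presheaf.stalk q) τ} = ⊤) :
    ∃ a ∈ jacobianIdeal s 1 x, IsUnit ((X.presheaf.stalkSpecializes h).hom a) := by
  rw [jacobianIdeal_eq_fittingIdeal]
  obtain ⟨W, hW, hxW, -⟩ := exists_isAffineOpen_mem_le (TopologicalSpace.Opens.mem_top x)
  have hqW := h.mem_open W.2 hxW
  let _ := (stalkStructureMap s q).toAlgebra
  let _ := (stalkStructureMap s x).toAlgebra
  let _ := (X.presheaf.stalkSpecializes h).hom.toAlgebra
  let _ := (X.presheaf.germ W x hxW).hom.toAlgebra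
  let _ := (X.presheaf.germ W q hqW).hom.toAlgebra
  have : IsScalarTower k (X.presheaf.stalk x) (X.presheaf.stalk q) :=
    .of_algebraMap_eq' (stalkSpecializes_stalkStructureMap s h).symm
  have : IsScalarTower Γ(X, W) (X.presheaf.stalk x) (X.presheaf.stalk q) :=
    .of_algebraMap_eq fun a => (stalkSpecializes_germ_apply h hxW a).symm
  have h1 := isLocalization_germ hW hxW
  have h2 := isLocalization_germ hW hqW
  have hle : (hW.primeIdealOf ⟨x, hxW⟩).asIdeal.primeCompl ≤
      (hW.primeIdealOf ⟨q, hqW⟩).asIdeal.primeCompl := fun a ha haq =>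
    ha ((specializes_iff_primeIdealOf_le hW hqW hxW).1 h haq)
  have := IsLocalization.isLocalization_of_submonoid_le (X.presheaf.stalk x) (X.presheaf.stalk q)
    _ _ hle
  set N := Submonoid.map (algebraMap Γ(X, W) (X.presheaf.stalk x))
    (hW.primeIdealOf ⟨q, hqW⟩).asIdeal.primeCompl
  have : Algebra.EssFiniteType k (X.presheaf.stalk x) := essFiniteType_stalkStructureMap s x
  have := KaehlerDifferential.isLocalizedModule_map k (X.presheaf.stalk x) (X.presheaf.stalk q) N
  obtain ⟨τ, hτ⟩ := hq
  obtain ⟨a, haN, ha⟩ := exists_mem_fittingIdeal_one_of_isLocalizedModule N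
    (KaehlerDifferential.map k k (X.presheaf.stalk x) (X.presheaf.stalk q)) hτ
  exact ⟨a, ha, IsLocalization.map_units (X.presheaf.stalk q) (⟨a, haN⟩ : N)⟩

namespace IsCurveNormalization

theorem exists_stalkMap_mul_eq (C : IsCurveNormalization s f) (p : X')
    (v : X'.presheaf.stalk p) : ∃ a b : X.presheaf.stalk (f p),
      (f.stalkMap p).hom b ≠ 0 ∧ (f.stalkMap p).hom b * v = (f.stalkMap p).hom a := by
  obtain ⟨η, hη, hηp⟩ := exists_mem_genericPoints_specializes p
  have hfη : f η ⤳ f p := hηp.map f.continuous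
  have := C.isDomain p
  have := C.isDomain η
  have := C.isIso_stalkMap hη
  obtain ⟨W, hW, hxW, -⟩ := exists_isAffineOpen_mem_le (TopologicalSpace.Opens.mem_top (f p))
  obtain ⟨l, hl⟩ := (asIso (f.stalkMap η)).commRingCatIsoToRingEquiv.surjective
    ((X'.presheaf.stalkSpecializes hηp).hom v)
  replace hl : (f.stalkMap η).hom l = (X'.presheaf.stalkSpecializes hηp).hom v := hl
  obtain ⟨a, b, hb, hab⟩ := exists_germ_mul_eq_germ hW (hfη.mem_open W.2 hxW) l
  rw [← stalkSpecializes_germ_apply hfη hxW] at hb hab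
  rw [← stalkSpecializes_germ_apply hfη hxW] at hab
  refine ⟨(X.presheaf.germ W (f p) hxW).hom a, (X.presheaf.germ W (f p) hxW).hom b,
    fun h0 => ?_, stalkSpecializes_injective hηp ?_⟩
  · have h1 := congrArg (X'.presheaf.stalkSpecializes hηp).hom h0
    rw [stalkSpecializes_stalkMap_hom_apply, map_zero] at h1
    exact (hb.map (f.stalkMap η).hom).ne_zero h1
  · rw [map_mul, stalkSpecializes_stalkMap_hom_apply, stalkSpecializes_stalkMap_hom_apply, ← hl,
      ← map_mul, hab]

/-- Over the locus of isomorphism there are no relative differentials. At a closed point the ideal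
contains every `D o`, and these are not all zero because `O` and `V` have the same fractions. -/
theorem exists_isDivisorOf_jacobianIdeal_zero (C : IsCurveNormalization s f) :
    ∃ K : AlgebraicCycle X' ℤ, IsDivisorOf K (jacobianIdeal f 0) := by
  obtain ⟨U, hU, -, hU'⟩ := C.exists_isIso
  refine C.exists_isDivisorOf _ (V := f ⁻¹ᵁ U) hU' (fun p hp => ?_) fun p hp hbot => ?_
  · have := isIso_stalkMap_of_mem f U p hp
    let _ := (f.stalkMap p).hom.toAlgebra
    have := KaehlerDifferential.subsingleton_of_surjective (X.presheaf.stalk (f p))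
      (X'.presheaf.stalk p) (asIso (f.stalkMap p)).commRingCatIsoToRingEquiv.surjective
    exact fittingIdeal_zero_eq_top_of_subsingleton
  · have := C.locallyOfFiniteType_comp
    have := C.isDomain p
    have := C.isDiscreteValuationRing hp
    let _ := (f.stalkMap p).hom.toAlgebra
    let _ := (stalkStructureMap s (f p)).toAlgebra
    let _ := (stalkStructureMap (f ≫ s) p).toAlgebra
    have : IsScalarTower k (X.presheaf.stalk (f p)) (X'.presheaf.stalk p) :=
      .of_algebraMap_eq' (stalkMap_stalkStructureMap s f p).symm
    have : Algebra.EssFiniteType k (X'.presheaf.stalk p) :=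
      essFiniteType_stalkStructureMap (f ≫ s) p
    obtain ⟨τ, hτ⟩ := IsDiscreteValuationRing.exists_prime (X'.presheaf.stalk p)
    have hres : ∀ a, ∃ c : k, τ ∣ a - algebraMap k (X'.presheaf.stalk p) c := by
      intro a
      obtain ⟨c, hc⟩ := exists_sub_stalkStructureMap_mem (f ≫ s) hp a
      rw [hτ.irreducible.maximalIdeal_eq, Ideal.mem_span_singleton] at hc
      exact ⟨c, hc⟩
    obtain ⟨hspan, D, hD⟩ := exists_derivation_uniformizer hτ hres
    obtain ⟨o, ho⟩ := exists_derivation_algebraMap_ne_zero (O := X.presheaf.stalk (f p))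
      (C.exists_stalkMap_mul_eq p) D (fun h => by rw [h] at hD; exact zero_ne_one hD)
    have h1 : D (algebraMap (X.presheaf.stalk (f p)) (X'.presheaf.stalk p) o) ∈
        jacobianIdeal f 0 p := derivation_algebraMap_mem_fittingIdeal hspan D hD o
    rw [hbot, Ideal.mem_bot] at h1
    exact ho h1

theorem exists_span_D_eq_top_of_mem (C : IsCurveNormalization s f) {U : X.Opens}
    [IsIso (f ∣_ U)] {p : X'} (hp : f p ∈ U) :
    letI := (stalkStructureMap s (f p)).toAlgebra
    ∃ τ : X.presheaf.stalk (f p), Submodule.span (X.presheaf.stalk (f p))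
      {KaehlerDifferential.D k (X.presheaf.stalk (f p)) τ} = ⊤ := by
  have := isIso_stalkMap_of_mem f U p hp
  let e := (asIso (f.stalkMap p)).commRingCatIsoToRingEquiv
  obtain ⟨τ, hτ⟩ := C.exists_span_D_eq_top p
  let _ := (stalkStructureMap s (f p)).toAlgebra
  let _ := (stalkStructureMap (f ≫ s) p).toAlgebra
  let _ := e.symm.toRingHom.toAlgebra
  have : IsScalarTower k (X'.presheaf.stalk p) (X.presheaf.stalk (f p)) :=
    .of_algebraMap_eq fun c => e.injective <| by
      refine Eq.trans ?_ (e.apply_symm_apply _).symm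
      exact congrArg (· c) (congrArg DFunLike.coe (stalkMap_stalkStructureMap s f p))
  refine ⟨_, span_D_eq_top_of_exists_frac (fun w => ⟨e w, 1, ?_, ?_⟩) hτ⟩
  · rw [map_one]; exact isUnit_one
  · rw [map_one, one_mul]
    exact (e.symm_apply_apply w).symm

/-- Over the locus of isomorphism the differentials are cyclic and the ideal is the unit ideal;
elsewhere it contains an element that becomes a unit at a generic point. -/
theorem exists_isDivisorOf_jacobianIdeal_one (C : IsCurveNormalization s f) :
    ∃ J : AlgebraicCycle X' ℤ, IsDivisorOf J (pullbackIdeal f (jacobianIdeal s 1)) := by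
  obtain ⟨U, hU, -, hU'⟩ := C.exists_isIso
  refine C.exists_isDivisorOf _ (V := f ⁻¹ᵁ U) hU' (fun p hp => ?_) fun p hp hbot => ?_
  · obtain ⟨τ, hτ⟩ := C.exists_span_D_eq_top_of_mem hp
    rw [pullbackIdeal, jacobianIdeal_eq_fittingIdeal]
    rw [fittingIdeal_one_eq_top_of_span_singleton hτ, Ideal.map_top]
  · obtain ⟨η, hη, hηp⟩ := exists_mem_genericPoints_specializes p
    have := C.locallyOfFiniteType
    obtain ⟨a, ha, hau⟩ := exists_mem_fittingIdeal_isUnit_stalkSpecializes s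
      (hηp.map f.continuous) (C.exists_span_D_eq_top_of_mem (hU' η hη))
    have h1 := Ideal.mem_map_of_mem (f.stalkMap p).hom ha
    rw [pullbackIdeal] at hbot
    rw [hbot, Ideal.mem_bot] at h1
    have h2 := congrArg (X'.presheaf.stalkSpecializes hηp).hom h1
    rw [stalkSpecializes_stalkMap_hom_apply, map_zero] at h2
    have := C.isDomain η
    exact (hau.map (f.stalkMap η).hom).ne_zero h2

end IsCurveNormalization

end AlgebraicGeometry.Scheme

end

/-! ### The conductor -/

section
namespace AlgebraicGeometry.Scheme

variable {k : Type u} [Field k] [IsAlgClosed k] {X' X : Scheme.{u}} {s : X ⟶ Spec (.of k)}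
  {f : X' ⟶ X}

/-- Prime avoidance for the ideal of functions whose basic open set lies in `U`, against the primes
of the generic points in `W`. -/
theorem exists_basicOpen_le_of_genericPoints [Finite (genericPoints X)] {U W : X.Opens}
    (hW : IsAffineOpen W) (hU : ∀ η ∈ genericPoints X, η ∈ U) :
    ∃ h : Γ(X, W), X.basicOpen h ≤ U ∧ ∀ η ∈ genericPoints X, η ∈ W → η ∈ X.basicOpen h := by
  let 𝔞 : Ideal Γ(X, W) :=
    { carrier := {h | X.basicOpen h ≤ U}
      zero_mem' := by simp
      add_mem' := fun {a b} ha hb => (X.basicOpen_add_le a b).trans (sup_le ha hb)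
      smul_mem' := fun c a ha => by
        simp only [smul_eq_mul, Set.mem_ofPred_eq, Scheme.basicOpen_mul]
        exact inf_le_right.trans ha }
  by_contra! hcon
  let T : Set (Ideal Γ(X, W)) := Set.range fun η : {η : genericPoints X // η.1 ∈ W} =>
    (hW.primeIdealOf ⟨η.1.1, η.2⟩).asIdeal
  have hT : T.Finite := Set.finite_range _
  have h1 : (𝔞 : Set Γ(X, W)) ⊆ ⋃ i ∈ T, ((id i : Ideal Γ(X, W)) : Set Γ(X, W)) := by
    intro h hh
    obtain ⟨η, hη, hηW, hηh⟩ := hcon h hh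
    refine Set.mem_biUnion (Set.mem_range_self ⟨⟨η, hη⟩, hηW⟩) ?_
    refine (mem_primeIdealOf_iff hW hηW h).2 ((IsLocalRing.mem_maximalIdeal _).2 fun hu => ?_)
    exact hηh ((X.mem_basicOpen h η hηW).2 hu)
  rw [Ideal.subset_union_prime_finite hT ⊥ ⊥] at h1
  · obtain ⟨_, ⟨⟨⟨η, hη⟩, hηW⟩, rfl⟩, hle⟩ := h1
    obtain ⟨h, hhU, hηh⟩ := hW.exists_basicOpen_le (⟨η, hU η hη⟩ : U) hηW
    have h2 : h ∈ (hW.primeIdealOf ⟨η, hηW⟩).asIdeal := hle hhU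
    rw [mem_primeIdealOf_iff] at h2
    exact (IsLocalRing.mem_maximalIdeal _).1 h2 ((X.mem_basicOpen h η hηW).1 hηh)
  · rintro _ ⟨⟨⟨η, hη⟩, hηW⟩, rfl⟩ - -
    exact (hW.primeIdealOf ⟨η, hηW⟩).isPrime

theorem exists_pow_mul_eq_zero_of_map_eq_zero {U V : X.Opens} (hU : IsAffineOpen U)
    (r x : Γ(X, U)) (hV : V = X.basicOpen r) (hVU : V ≤ U)
    (h : (X.presheaf.map (homOfLE hVU).op).hom x = 0) : ∃ n : ℕ, r ^ n * x = 0 := by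
  subst hV
  exact exists_pow_mul_eq_zero_of_res_basicOpen_eq_zero_of_isCompact X hU.isCompact x r h

theorem map_app_hom_apply (f : X' ⟶ X) {V W : X.Opens} (h : V ≤ W) (a : Γ(X, W)) :
    (X'.presheaf.map (homOfLE (show f ⁻¹ᵁ V ≤ f ⁻¹ᵁ W from fun _ hx => h hx)).op).hom
      ((f.app W).hom a) = (f.app V).hom ((X.presheaf.map (homOfLE h).op).hom a) := by
  have := Scheme.Hom.naturality f (homOfLE h).op
  exact (congrArg (fun φ => φ.hom a) this).symm

theorem exists_pow_mul_mem_range_app {U W : X.Opens} [IsIso (f ∣_ U)] (hW : IsAffineOpen W)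
    (hfW : IsAffineOpen (f ⁻¹ᵁ W)) {h : Γ(X, W)} (hh : X.basicOpen h ≤ U)
    (s' : Γ(X', f ⁻¹ᵁ W)) : ∃ n : ℕ, (f.app W).hom (h ^ n) * s' ∈ (f.app W).hom.range := by
  have := isIso_app_of_le f U hh
  have hle := X.basicOpen_le h
  obtain ⟨t, ht⟩ := (asIso (f.app (X.basicOpen h))).commRingCatIsoToRingEquiv.surjective
    ((X'.presheaf.map
      (homOfLE (show f ⁻¹ᵁ X.basicOpen h ≤ f ⁻¹ᵁ W from fun _ hx => hle hx)).op).hom s')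
  replace ht : (f.app (X.basicOpen h)).hom t = _ := ht
  obtain ⟨n, a, ha⟩ := exists_eq_pow_mul_of_isAffineOpen X W hW h t
  replace ha : (X.presheaf.map (homOfLE hle).op).hom a =
    (X.presheaf.map (homOfLE hle).op).hom h ^ n * t := ha
  obtain ⟨m, hm⟩ := exists_pow_mul_eq_zero_of_map_eq_zero hfW ((f.app W).hom h)
    ((f.app W).hom (h ^ n) * s' - (f.app W).hom a) (Scheme.preimage_basicOpen f h)
    (fun _ hx => hle hx) (by
      rw [map_sub, map_mul, map_app_hom_apply f hle, map_app_hom_apply f hle, ha, ← ht, map_mul,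
        map_pow, sub_self])
  refine ⟨m + n, h ^ m * a, ?_⟩
  rw [mul_sub, sub_eq_zero] at hm
  rw [map_mul, map_pow, ← hm, ← mul_assoc, ← map_pow, ← map_mul, pow_add]

namespace IsCurveNormalization

/-- Choose `h` invertible at the generic points with `f` an isomorphism over its basic open set.
Each section upstairs is brought into the image by a power of `h`, and by finiteness one power
serves all. -/
theorem exists_conductor (C : IsCurveNormalization s f) {W : X.Opens} (hW : IsAffineOpen W) :
    ∃ g : Γ(X, W), (∀ s', (f.app W).hom g * s' ∈ (f.app W).hom.range) ∧
      ∀ η ∈ genericPoints X, ∀ hη : η ∈ W, IsUnit ((X.presheaf.germ W η hη).hom g) := by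
  have := C.isFinite
  have := C.isNoetherian
  have : Finite (genericPoints X) :=
    genericPoints.finite TopologicalSpace.NoetherianSpace.finite_irreducibleComponents
  obtain ⟨U, _, hU, -⟩ := C.exists_isIso
  obtain ⟨h, hhU, hh⟩ := exists_basicOpen_le_of_genericPoints hW hU
  let _ := (f.app W).hom.toAlgebra
  have : Module.Finite Γ(X, W) Γ(X', f ⁻¹ᵁ W) := IsFinite.finite_app f W hW
  obtain ⟨n, hn⟩ := exists_pow_mul_mem_range h
    (exists_pow_mul_mem_range_app hW (hW.preimage f) hhU)
  refine ⟨h ^ n, hn, fun η hη hηW => ?_⟩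
  rw [map_pow]
  exact ((X.mem_basicOpen h η hηW).1 (hh η hη hηW)).pow n

end IsCurveNormalization

end AlgebraicGeometry.Scheme

end

/-! ### The local theorem at the stalks of the curve -/

section
namespace AlgebraicGeometry.Scheme

variable {k : Type u} [Field k] [IsAlgClosed k] {X' X : Scheme.{u}} {s : X ⟶ Spec (.of k)}
  {f : X' ⟶ X}

/-- The map from the local ring at `x` to the local ring at a point of the fibre over `x`. -/
noncomputable def fiberStalkMap (f : X' ⟶ X) {p : X'} {x : X} (h : f p = x) :
    X.presheaf.stalk x →+* X'.presheaf.stalk p :=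
  (f.stalkMap p).hom.comp (X.presheaf.stalkSpecializes (specializes_of_eq h)).hom

theorem fiberStalkMap_rfl (f : X' ⟶ X) (p : X') :
    fiberStalkMap f (rfl : f p = f p) = (f.stalkMap p).hom := by
  rw [fiberStalkMap, TopCat.Presheaf.stalkSpecializes_refl]
  rfl

theorem fiberStalkMap_germ (f : X' ⟶ X) {p : X'} {x : X} (h : f p = x) {W : X.Opens} (hx : x ∈ W)
    (a : Γ(X, W)) : fiberStalkMap f h ((X.presheaf.germ W x hx).hom a) =
      (X'.presheaf.germ (f ⁻¹ᵁ W) p (show f p ∈ W from h ▸ hx)).hom ((f.app W).hom a) := by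
  subst h
  rw [fiberStalkMap_rfl, stalkMap_germ_hom_apply]

theorem fiberStalkMap_comp_stalkStructureMap (s : X ⟶ Spec (.of k)) {p : X'} {x : X}
    (h : f p = x) :
    (fiberStalkMap f h).comp (stalkStructureMap s x) = stalkStructureMap (f ≫ s) p := by
  subst h
  rw [fiberStalkMap_rfl, stalkMap_stalkStructureMap]

theorem differentialFitting_fiberStalkMap (f : X' ⟶ X) {p : X'} {x : X} (h : f p = x) (d : ℕ) :
    differentialFitting (fiberStalkMap f h) d = jacobianIdeal f d p := by
  subst h
  rw [fiberStalkMap_rfl]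
  rfl

theorem map_fiberStalkMap (f : X' ⟶ X) {p : X'} {x : X} (h : f p = x) (I : StalkIdeals X) :
    (I x).map (fiberStalkMap f h) = pullbackIdeal f I p := by
  subst h
  rw [fiberStalkMap_rfl]
  rfl

theorem fiberStalkMap_mem_maximalIdeal (f : X' ⟶ X) {p : X'} {x : X} (h : f p = x)
    {a : X.presheaf.stalk x} (ha : a ∈ IsLocalRing.maximalIdeal (X.presheaf.stalk x)) :
    fiberStalkMap f h a ∈ IsLocalRing.maximalIdeal (X'.presheaf.stalk p) := by
  subst h
  rw [fiberStalkMap_rfl]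
  exact (IsLocalRing.mem_maximalIdeal _).2 fun hu =>
    (IsLocalRing.mem_maximalIdeal _).1 ha (isUnit_of_map_unit (f.stalkMap p).hom a hu)

namespace IsCurveNormalization

theorem exists_stalk_approximation (C : IsCurveNormalization s f) {K J : AlgebraicCycle X' ℤ}
    (hK : IsDivisorOf K (jacobianIdeal f 0))
    (hJ : IsDivisorOf J (pullbackIdeal f (jacobianIdeal s 1))) {x : X}
    (hx : IsClosed ({x} : Set X)) (g : X.presheaf.stalk x)
    (hg : ∀ p (hp : f p = x), fiberStalkMap f hp g ≠ 0)
    (hcond : ∀ (z : ∀ p : {p // f p = x}, X'.presheaf.stalk p.1) (M : ℕ), ∃ o,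
      ∀ p : {p // f p = x}, fiberStalkMap f p.2 o - fiberStalkMap f p.2 g * z p ∈
        IsLocalRing.maximalIdeal (X'.presheaf.stalk p.1) ^ M)
    {U : X.Opens} (hxU : x ∈ U) {z : RationalFunctions X' (f ⁻¹ᵁ U)}
    (hz : z ∈ divisorSections (fun p => K p - J p) (f ⁻¹ᵁ U)) :
    ∃ o : X.presheaf.stalk x, ∀ (η : {η : X' // η ∈ f ⁻¹ᵁ U ∧
        closure {η} ∈ irreducibleComponents X'}) (p : X') (hp : f p = x) (h : η.1 ⤳ p), ∃ c,
      z η - (X'.presheaf.stalkSpecializes h).hom (fiberStalkMap f hp o) =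
        (X'.presheaf.stalkSpecializes h).hom (fiberStalkMap f hp g * c) := by
  have := C.locallyOfFiniteType
  have := C.locallyOfFiniteType_comp
  have := C.isReduced_source
  let P := {p : X' // f p = x}
  have : Finite P := C.finite_fiber x
  have hdom : ∀ p : X', IsDomain (X'.presheaf.stalk p) := C.isDomain
  have hcl : ∀ p : P, IsClosed ({p.1} : Set X') := fun p =>
    C.isClosed_of_isClosed_map (p.2.symm ▸ hx)
  have hdvr : ∀ p : P, IsDiscreteValuationRing (X'.presheaf.stalk p.1) := fun p =>
    C.isDiscreteValuationRing (hcl p)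
  choose η hη hηp using fun p : P => exists_mem_genericPoints_specializes p.1
  have hηU : ∀ p, η p ∈ f ⁻¹ᵁ U := fun p =>
    (hηp p).mem_open (f ⁻¹ᵁ U).2 (show f p.1 ∈ U from p.2.symm ▸ hxU)
  have : Infinite k := inferInstance
  let _ := (stalkStructureMap s x).toAlgebra
  let _ : ∀ p : P, Algebra k (X'.presheaf.stalk p.1) := fun p =>
    (stalkStructureMap (f ≫ s) p.1).toAlgebra
  let _ : ∀ p : P, Algebra (X.presheaf.stalk x) (X'.presheaf.stalk p.1) := fun p =>
    (fiberStalkMap f p.2).toAlgebra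
  have : ∀ p : P, IsScalarTower k (X.presheaf.stalk x) (X'.presheaf.stalk p.1) := fun p =>
    .of_algebraMap_eq' (fiberStalkMap_comp_stalkStructureMap s p.2).symm
  have : Algebra.EssFiniteType k (X.presheaf.stalk x) := essFiniteType_stalkStructureMap s x
  have : ∀ p : P, Algebra.EssFiniteType k (X'.presheaf.stalk p.1) := fun p =>
    essFiniteType_stalkStructureMap (f ≫ s) p.1
  have hnat : ∀ p, (K p - J p).toNat = (K p).toNat - (J p).toNat ∧
      (-(K p - J p)).toNat = (J p).toNat - (K p).toNat := by
    intro p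
    have := hK.nonneg p
    have := hJ.nonneg p
    omega
  obtain ⟨o, ho⟩ := exists_approximation_of_fittingIdeal (k := k) (O := X.presheaf.stalk x)
    (V := fun p : P => X'.presheaf.stalk p.1) (L := fun p : P => X'.presheaf.stalk (η p))
    (fun p => (X'.presheaf.stalkSpecializes (hηp p)).hom)
    (fun p => stalkSpecializes_injective (hηp p))
    (fun p => exists_sub_stalkStructureMap_mem (f ≫ s) (hcl p))
    (fun p => (K p.1).toNat) (fun p => (J p.1).toNat)
    (fun p => (differentialFitting_fiberStalkMap f p.2 0).trans (hK.eq_pow p.1))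
    (fun p => by
      rw [← jacobianIdeal_eq_fittingIdeal, ← hJ.eq_pow p.1]
      exact map_fiberStalkMap f p.2 _)
    (fun o => by
      obtain ⟨c, hc⟩ := exists_sub_stalkStructureMap_mem s hx o
      exact ⟨c, fun p => fiberStalkMap_mem_maximalIdeal f p.2 hc⟩)
    g (fun p => hg p.1 p.2) hcond (fun p => z ⟨η p, hηU p, hη p⟩)
    (fun p a ha => by
      have := hz p.1 (show f p.1 ∈ U from p.2.symm ▸ hxU) ⟨η p, hηU p, hη p⟩ (hηp p)
      simp only [hnat p.1] at this
      exact this a ha)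
  refine ⟨o, fun η' p hp h => ?_⟩
  obtain ⟨c, hc⟩ := ho ⟨p, hp⟩
  -- The generic point chosen over `p` is the only one, since the stalk at `p` is a domain.
  have heq : η ⟨p, hp⟩ = η'.1 :=
    eq_of_specializes_of_mem_genericPoints (hη ⟨p, hp⟩) η'.2.2 (hηp ⟨p, hp⟩) h
  obtain ⟨η', hη'⟩ := η'
  dsimp only at heq
  subst heq
  exact ⟨c, hc⟩

end IsCurveNormalization

end AlgebraicGeometry.Scheme

end

/-! ### Sections of the divisor sheaf as local fractions -/

section
namespace AlgebraicGeometry.Scheme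

variable {k : Type u} [Field k] [IsAlgClosed k] {X' X : Scheme.{u}} {s : X ⟶ Spec (.of k)}
  {f : X' ⟶ X}

namespace IsCurveNormalization

/-- Approximate `z` by a section upstairs and multiply by the conductor element, which brings it
into the image of the sections below. -/
theorem exists_stalk_sub_mem (C : IsCurveNormalization s f) {x : X}
    (hx : IsClosed ({x} : Set X)) {W : X.Opens} (hW : IsAffineOpen W) (hxW : x ∈ W)
    {g : Γ(X, W)} (hg : ∀ s', (f.app W).hom g * s' ∈ (f.app W).hom.range)
    (z : ∀ p : {p // f p = x}, X'.presheaf.stalk p.1) (M : ℕ) : ∃ o : X.presheaf.stalk x,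
      ∀ p : {p // f p = x}, fiberStalkMap f p.2 o -
        fiberStalkMap f p.2 ((X.presheaf.germ W x hxW).hom g) * z p ∈
          IsLocalRing.maximalIdeal (X'.presheaf.stalk p.1) ^ M := by
  have := C.isFinite
  have : Finite {p : X' // f p = x} := C.finite_fiber x
  have hfW : IsAffineOpen (f ⁻¹ᵁ W) := hW.preimage f
  have hp : ∀ p : {p : X' // f p = x}, p.1 ∈ f ⁻¹ᵁ W := fun p =>
    show f p.1 ∈ W from p.2.symm ▸ hxW
  let _ : ∀ p : {p : X' // f p = x}, Algebra Γ(X', f ⁻¹ᵁ W) (X'.presheaf.stalk p.1) := fun p =>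
    (X'.presheaf.germ (f ⁻¹ᵁ W) p.1 (hp p)).hom.toAlgebra
  have : ∀ p : {p : X' // f p = x}, IsLocalization.AtPrime (X'.presheaf.stalk p.1)
      (hfW.primeIdealOf ⟨p.1, hp p⟩).asIdeal := fun p => isLocalization_germ hfW (hp p)
  obtain ⟨s', hs'⟩ := exists_forall_algebraMap_sub_mem
    (fun p : {p : X' // f p = x} => (hfW.primeIdealOf ⟨p.1, hp p⟩).asIdeal)
    (fun p => hfW.primeIdealOf_isMaximal_of_isClosed ⟨p.1, hp p⟩
      (C.isClosed_of_isClosed_map (p.2.symm ▸ hx)))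
    (fun p q hpq => Subtype.ext
      (((specializes_iff_primeIdealOf_le hfW (hp p) (hp q)).2 hpq.le).antisymm
        ((specializes_iff_primeIdealOf_le hfW (hp q) (hp p)).2 hpq.ge)).eq) z M
  obtain ⟨a, ha⟩ := hg s'
  refine ⟨(X.presheaf.germ W x hxW).hom a, fun p => ?_⟩
  rw [fiberStalkMap_germ, fiberStalkMap_germ, ha, map_mul, ← mul_sub]
  exact Ideal.mul_mem_left _ _ (hs' p)

/-- A prime at `p` containing the intersection of the primes of the other generic points would
contain one of them, but only `η` specializes to `p`. The resulting `e` isolates the branch through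
`p`. -/
theorem exists_notMem_forall_germ_eq_zero (C : IsCurveNormalization s f) {W' : X'.Opens}
    (hW' : IsAffineOpen W') {p η : X'} (hp : p ∈ W') (hη : η ∈ genericPoints X') (hηp : η ⤳ p) :
    ∃ e : Γ(X', W'), IsUnit ((X'.presheaf.germ W' p hp).hom e) ∧
      ∀ η' ∈ genericPoints X', ∀ h : η' ∈ W', η' ≠ η → (X'.presheaf.germ W' η' h).hom e = 0 := by
  classical
  have := C.isReduced_source
  have := C.isDomain p
  have := C.finite_genericPoints
  let H := {η' : genericPoints X' // η'.1 ∈ W' ∧ η'.1 ≠ η}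
  have := Fintype.ofFinite H
  let 𝔮 : H → Ideal Γ(X', W') := fun η' => (hW'.primeIdealOf ⟨η'.1.1, η'.2.1⟩).asIdeal
  have hle : ¬ Finset.univ.inf 𝔮 ≤ (hW'.primeIdealOf ⟨p, hp⟩).asIdeal := by
    rw [Ideal.IsPrime.inf_le' (hW'.primeIdealOf ⟨p, hp⟩).isPrime]
    rintro ⟨η', -, h⟩
    exact η'.2.2 (eq_of_specializes_of_mem_genericPoints η'.1.2 hη
      ((specializes_iff_primeIdealOf_le hW' η'.2.1 hp).2 h) hηp)
  obtain ⟨e, he, hep⟩ := Set.not_subset.1 hle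
  refine ⟨e, ?_, fun η' hη' h hne => ?_⟩
  · by_contra hu
    exact hep ((mem_primeIdealOf_iff hW' hp e).2 ((IsLocalRing.mem_maximalIdeal _).2 hu))
  · have h1 : e ∈ (hW'.primeIdealOf ⟨η', h⟩).asIdeal :=
      (Finset.inf_le (Finset.mem_univ (⟨⟨η', hη'⟩, h, hne⟩ : H)) : Finset.univ.inf 𝔮 ≤ _) he
    rwa [mem_primeIdealOf_iff, IsLocalRing.isField_iff_maximalIdeal_eq.1
      (isField_stalk_of_mem_genericPoints hη'), Ideal.mem_bot] at h1

theorem exists_germ_mul_eq_of_mem_divisorSections (C : IsCurveNormalization s f)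
    {K J : AlgebraicCycle X' ℤ} (hK : IsDivisorOf K (jacobianIdeal f 0))
    (hJ : IsDivisorOf J (pullbackIdeal f (jacobianIdeal s 1))) {x : X}
    (hx : IsClosed ({x} : Set X)) {U : X.Opens} {z : RationalFunctions X' (f ⁻¹ᵁ U)}
    (hz : z ∈ divisorSections (fun p => K p - J p) (f ⁻¹ᵁ U)) {W : X.Opens}
    (hW : IsAffineOpen W) (hWU : W ≤ U) (hxW : x ∈ W) :
    ∃ d n : Γ(X, W), IsUnit ((X.presheaf.germ W x hxW).hom d) ∧
      ∀ (η : X') (hη : η ∈ genericPoints X') (hηW : η ∈ f ⁻¹ᵁ W),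
        (X'.presheaf.germ (f ⁻¹ᵁ W) η hηW).hom ((f.app W).hom d) * z ⟨η, hWU hηW, hη⟩ =
          (X'.presheaf.germ (f ⁻¹ᵁ W) η hηW).hom ((f.app W).hom n) := by
  have := C.isFinite
  have hfW : IsAffineOpen (f ⁻¹ᵁ W) := hW.preimage f
  obtain ⟨g, hg, hgu⟩ := C.exists_conductor hW
  have hgp : ∀ p (hp : f p = x), fiberStalkMap f hp ((X.presheaf.germ W x hxW).hom g) ≠ 0 := by
    intro p hp h0
    obtain ⟨η, hη, hηp⟩ := exists_mem_genericPoints_specializes p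
    have hpW : p ∈ f ⁻¹ᵁ W := show f p ∈ W from hp.symm ▸ hxW
    have hηW : η ∈ f ⁻¹ᵁ W := hηp.mem_open (f ⁻¹ᵁ W).2 hpW
    have := C.isDomain η
    rw [fiberStalkMap_germ] at h0
    have h1 := congrArg (X'.presheaf.stalkSpecializes hηp).hom h0
    rw [stalkSpecializes_germ_apply hηp hpW, map_zero, ← stalkMap_germ_hom_apply f hηW] at h1
    exact ((hgu _ (C.map_mem_genericPoints hη) hηW).map (f.stalkMap η).hom).ne_zero h1
  obtain ⟨o, ho⟩ := C.exists_stalk_approximation hK hJ hx _ hgp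
    (C.exists_stalk_sub_mem hx hW hxW hg) (hWU hxW) hz
  obtain ⟨a, b, hb, hab⟩ := exists_germ_mul_eq_germ hW hxW o
  let _ := (f.app W).hom.toAlgebra
  have : Algebra.IsIntegral Γ(X, W) Γ(X', f ⁻¹ᵁ W) := ⟨IsIntegralHom.isIntegral_app f W hW⟩
  let H := {η : X' // η ∈ f ⁻¹ᵁ W ∧ η ∈ genericPoints X'}
  let l : ∀ η : H, Γ(X', f ⁻¹ᵁ W) →+* X'.presheaf.stalk η.1 := fun η =>
    (X'.presheaf.germ (f ⁻¹ᵁ W) η.1 η.2.1).hom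
  -- With `o = a / b` the stalk approximation of `z`, this is `b * (z - o)`, which lies in `g V` at
  -- each point over `x`. A fraction `n / d` for it gives `(n + d a) / (d b)` for `z`.
  let y : ∀ η : H, X'.presheaf.stalk η.1 := fun η =>
    l η ((f.app W).hom b) * z ⟨η.1, hWU η.2.1, η.2.2⟩ - l η ((f.app W).hom a)
  suffices key : ∃ d ∉ (hW.primeIdealOf ⟨x, hxW⟩).asIdeal, ∃ n : Γ(X, W), ∀ η,
      l η ((f.app W).hom d) * y η = l η ((f.app W).hom n) by
    obtain ⟨d, hd, n, hn⟩ := key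
    refine ⟨d * b, n + d * a, ?_, fun η hη hηW => ?_⟩
    · rw [map_mul]
      refine IsUnit.mul ?_ hb
      by_contra hu
      exact hd ((mem_primeIdealOf_iff hW hxW d).2 ((IsLocalRing.mem_maximalIdeal _).2 hu))
    · have h1 : l ⟨η, hηW, hη⟩ ((f.app W).hom d) * (l ⟨η, hηW, hη⟩ ((f.app W).hom b) *
          z ⟨η, hWU hηW, hη⟩ - l ⟨η, hηW, hη⟩ ((f.app W).hom a)) =
            l ⟨η, hηW, hη⟩ ((f.app W).hom n) := hn ⟨η, hηW, hη⟩
      change l ⟨η, hηW, hη⟩ _ * _ = l ⟨η, hηW, hη⟩ _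
      rw [map_mul, map_mul, map_add, map_add, map_mul, map_mul, ← h1]
      ring
  refine exists_notMem_mul_eq_of_conductor (hW.primeIdealOf ⟨x, hxW⟩).asIdeal l g hg y ?_
  intro Q hQ hQx
  let q : Spec Γ(X', f ⁻¹ᵁ W) := ⟨Q, hQ⟩
  have hpW : hfW.fromSpec q ∈ f ⁻¹ᵁ W := by
    have := Set.mem_range_self (f := hfW.fromSpec) q
    rw [hfW.range_fromSpec] at this
    exact this
  have hq : hfW.primeIdealOf ⟨hfW.fromSpec q, hpW⟩ = q :=
    hfW.fromSpec.isOpenEmbedding.injective (hfW.fromSpec_primeIdealOf _)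
  generalize hfW.fromSpec q = p at hpW hq
  have hpx : f p = x := by
    have h1 := IsAffineOpen.comap_primeIdealOf_appLE W hW (f ⁻¹ᵁ W) hfW le_rfl hpW
    have h2 : (hW.primeIdealOf ⟨f p, hpW⟩).asIdeal = (hW.primeIdealOf ⟨x, hxW⟩).asIdeal := by
      rw [← h1, hq, ← hQx]
      simp only [Scheme.Hom.appLE_eq_app]
      rfl
    exact (((specializes_iff_primeIdealOf_le hW hpW hxW).2 h2.le).antisymm
      ((specializes_iff_primeIdealOf_le hW hxW hpW).2 h2.ge)).eq
  have hQp : ∀ e, IsUnit ((X'.presheaf.germ (f ⁻¹ᵁ W) p hpW).hom e) → e ∉ Q := by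
    intro e he heQ
    have h1 : e ∈ (hfW.primeIdealOf ⟨p, hpW⟩).asIdeal := by rw [hq]; exact heQ
    exact (IsLocalRing.mem_maximalIdeal _).1 ((mem_primeIdealOf_iff hfW hpW e).1 h1) he
  obtain ⟨η, hη, hηp⟩ := exists_mem_genericPoints_specializes p
  have hηW : η ∈ f ⁻¹ᵁ W := hηp.mem_open (f ⁻¹ᵁ W).2 hpW
  obtain ⟨c, hc⟩ := ho ⟨η, hWU hηW, hη⟩ p hpx hηp
  obtain ⟨a₁, e₁, he₁, hae₁⟩ := exists_germ_mul_eq_germ hfW hpW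
    ((X'.presheaf.germ (f ⁻¹ᵁ W) p hpW).hom ((f.app W).hom b) * c)
  obtain ⟨e₂, he₂, he₂'⟩ := C.exists_notMem_forall_germ_eq_zero hfW hpW hη hηp
  -- Here `e₁` clears the denominator at `p`, and `e₂` makes both sides vanish at the generic points
  -- not passing through `p`.
  refine ⟨e₁ * e₂, hQp _ (by rw [map_mul]; exact he₁.mul he₂), a₁ * e₂, ?_⟩
  rintro ⟨η', hη'W, hη'⟩
  by_cases hne : η' = η
  · subst hne
    have hl : ∀ r, l ⟨η', hη'W, hη'⟩ r = (X'.presheaf.stalkSpecializes hηp).hom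
        ((X'.presheaf.germ (f ⁻¹ᵁ W) p hpW).hom r) := fun r =>
      (stalkSpecializes_germ_apply hηp hpW r).symm
    have ha : l ⟨η', hη'W, hη'⟩ ((f.app W).hom a) = (X'.presheaf.stalkSpecializes hηp).hom
        ((X'.presheaf.germ (f ⁻¹ᵁ W) p hpW).hom ((f.app W).hom b) * fiberStalkMap f hpx o) := by
      rw [hl, ← fiberStalkMap_germ f hpx hxW, ← fiberStalkMap_germ f hpx hxW, ← map_mul, hab]
    have hy : y ⟨η', hη'W, hη'⟩ = (X'.presheaf.stalkSpecializes hηp).hom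
        ((X'.presheaf.germ (f ⁻¹ᵁ W) p hpW).hom ((f.app W).hom g) *
          ((X'.presheaf.germ (f ⁻¹ᵁ W) p hpW).hom ((f.app W).hom b) * c)) := by
      change l ⟨η', hη'W, hη'⟩ _ * z ⟨η', hWU hηW, hη⟩ - l ⟨η', hη'W, hη'⟩ _ = _
      rw [ha, hl, map_mul, ← mul_sub, hc, fiberStalkMap_germ, ← map_mul, mul_left_comm]
    change l ⟨η', hη'W, hη'⟩ _ * _ = l ⟨η', hη'W, hη'⟩ ((f.app W).hom g * (a₁ * e₂))
    rw [hy, hl, hl, ← map_mul]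
    congr 1
    rw [map_mul, map_mul, map_mul, ← hae₁]
    ring
  · have h0 : l ⟨η', hη'W, hη'⟩ e₂ = 0 := he₂' η' hη' hη'W hne
    change l ⟨η', hη'W, hη'⟩ _ * _ = l ⟨η', hη'W, hη'⟩ ((f.app W).hom g * (a₁ * e₂))
    rw [map_mul, map_mul, map_mul, h0]
    ring

end IsCurveNormalization

end AlgebraicGeometry.Scheme

end

/-! ### Gluing, and the ideal property -/

section
namespace AlgebraicGeometry.Scheme

variable {k : Type u} [Field k] [IsAlgClosed k] {X' X : Scheme.{u}} {s : X ⟶ Spec (.of k)}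
  {f : X' ⟶ X}

theorem regularToRational_apply (f : X' ⟶ X) {U : X.Opens} (t : Γ(X, U))
    (η : {η : X' // η ∈ f ⁻¹ᵁ U ∧ closure {η} ∈ irreducibleComponents X'}) :
    regularToRational f U t η = (f.stalkMap η.1).hom ((X.presheaf.germ U (f η.1) η.2.1).hom t) :=
  (stalkMap_germ_hom_apply f η.2.1 t).symm

theorem germ_map_apply {V W : X.Opens} (h : V ≤ W) {x : X} (hx : x ∈ V) (a : Γ(X, W)) :
    (X.presheaf.germ V x hx).hom ((X.presheaf.map (homOfLE h).op).hom a) =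
      (X.presheaf.germ W x (h hx)).hom a :=
  X.presheaf.germ_res_apply (homOfLE h) x hx a

theorem divisorSections_mono {X : Scheme.{u}} {D E : X → ℤ} (h : ∀ p, D p ≤ E p) (V : X.Opens) :
    (divisorSections D V : Set (RationalFunctions X V)) ⊆ divisorSections E V := by
  intro z hz p hp η hη a ha
  obtain ⟨b, hb, e⟩ := hz p hp η hη a
    (Ideal.pow_le_pow_right (by have := h p; omega) ha)
  exact ⟨b, Ideal.pow_le_pow_right (by have := h p; omega) hb, e⟩

namespace IsCurveNormalization

theorem eq_of_regularToRational (C : IsCurveNormalization s f) {V : X.Opens} {t t' : Γ(X, V)}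
    (h : ∀ (η : X'), η ∈ genericPoints X' → ∀ hη : f η ∈ V,
      (f.stalkMap η).hom ((X.presheaf.germ V (f η) hη).hom t) =
        (f.stalkMap η).hom ((X.presheaf.germ V (f η) hη).hom t')) : t = t' := by
  have := C.isReduced
  rw [← sub_eq_zero]
  refine eq_zero_of_germ_genericPoints _ fun x hx hxg => ?_
  obtain ⟨η, hη, rfl⟩ := C.exists_mem_genericPoints_eq hxg
  have := C.isIso_stalkMap hη
  rw [map_sub, sub_eq_zero]
  exact (asIso (f.stalkMap η)).commRingCatIsoToRingEquiv.injective (h η hη hx)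

/-- On the basic open set of the denominator `d` the fraction `n / d` is a section. -/
theorem exists_section_of_mem_divisorSections (C : IsCurveNormalization s f)
    {K J : AlgebraicCycle X' ℤ} (hK : IsDivisorOf K (jacobianIdeal f 0))
    (hJ : IsDivisorOf J (pullbackIdeal f (jacobianIdeal s 1))) {x : X}
    (hx : IsClosed ({x} : Set X)) {U : X.Opens} (hxU : x ∈ U)
    {z : RationalFunctions X' (f ⁻¹ᵁ U)}
    (hz : z ∈ divisorSections (fun p => K p - J p) (f ⁻¹ᵁ U)) :
    ∃ (V : X.Opens) (hVU : V ≤ U) (t : Γ(X, V)), x ∈ V ∧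
      ∀ (η : X') (hη : η ∈ genericPoints X') (hηV : f η ∈ V),
        (f.stalkMap η).hom ((X.presheaf.germ V (f η) hηV).hom t) = z ⟨η, hVU hηV, hη⟩ := by
  obtain ⟨W, hW, hxW, hWU⟩ := exists_isAffineOpen_mem_le hxU
  obtain ⟨d, n, hd, hdn⟩ := C.exists_germ_mul_eq_of_mem_divisorSections hK hJ hx hz hW hWU hxW
  have hle := X.basicOpen_le d
  have hunit : IsUnit ((X.presheaf.map (homOfLE hle).op).hom d) :=
    RingedSpace.isUnit_res_basicOpen _ d
  obtain ⟨e, he⟩ := hunit.exists_right_inv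
  refine ⟨X.basicOpen d, hle.trans hWU, (X.presheaf.map (homOfLE hle).op).hom n * e,
    (X.mem_basicOpen d x hxW).2 hd, fun η hη hηV => ?_⟩
  have h1 := hdn η hη (hle hηV)
  rw [← stalkMap_germ_hom_apply f (hle hηV), ← stalkMap_germ_hom_apply f (hle hηV),
    ← germ_map_apply hle hηV, ← germ_map_apply hle hηV] at h1
  have h2 := congrArg (fun r => (f.stalkMap η).hom ((X.presheaf.germ _ (f η) hηV).hom r)) he
  simp only [map_mul, map_one] at h2
  rw [map_mul, map_mul, ← h1, mul_right_comm, h2, one_mul]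

/-- Neighbourhoods of the closed points of `U` cover `U`, as `X` is a Jacobson space. The local
sections agree on overlaps because they agree at the generic points and `X` is reduced. -/
theorem divisorSections_subset_range (C : IsCurveNormalization s f)
    {K J : AlgebraicCycle X' ℤ} (hK : IsDivisorOf K (jacobianIdeal f 0))
    (hJ : IsDivisorOf J (pullbackIdeal f (jacobianIdeal s 1))) (U : X.Opens) :
    (divisorSections (fun p => K p - J p) (f ⁻¹ᵁ U) : Set _) ⊆
      Set.range (regularToRational f U) := by
  intro z hz
  have := C.locallyOfFiniteType
  have : JacobsonSpace X := LocallyOfFiniteType.jacobsonSpace s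
  let A := {x : X // IsClosed ({x} : Set X) ∧ x ∈ U}
  choose V hVU t hxV ht using fun x : A =>
    C.exists_section_of_mem_divisorSections hK hJ x.2.1 x.2.2 hz
  have hcover : U ≤ iSup V := by
    by_contra hcon
    have h1 : ((U : Set X) ∩ (iSup V : X.Opens)ᶜ).Nonempty := by
      obtain ⟨x, hxU, hx⟩ := Set.not_subset.1 hcon
      exact ⟨x, hxU, hx⟩
    obtain ⟨x, ⟨hxU, hx⟩, hxcl⟩ := nonempty_inter_closedPoints h1
      ⟨U, (iSup V : X.Opens)ᶜ, U.2, (iSup V).2.isClosed_compl, rfl⟩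
    exact hx (TopologicalSpace.Opens.mem_iSup.2 ⟨⟨x, hxcl, hxU⟩, hxV ⟨x, hxcl, hxU⟩⟩)
  obtain ⟨r, hr, -⟩ := X.sheaf.existsUnique_gluing' V U (fun x => homOfLE (hVU x)) hcover t (by
    intro x y
    refine C.eq_of_regularToRational fun η hη hηV => ?_
    have h1 := germ_map_apply (inf_le_left : V x ⊓ V y ≤ V x) hηV (t x)
    have h2 := germ_map_apply (inf_le_right : V x ⊓ V y ≤ V y) hηV (t y)
    exact (congrArg (f.stalkMap η).hom h1).trans ((ht x η hη hηV.1).trans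
      ((ht y η hη hηV.2).symm.trans (congrArg (f.stalkMap η).hom h2.symm))))
  refine ⟨r, funext fun η => ?_⟩
  obtain ⟨x, hx⟩ := TopologicalSpace.Opens.mem_iSup.1 (hcover η.2.1)
  have h1 := germ_map_apply (hVU x) hx r
  refine (regularToRational_apply f r η).trans
    ((congrArg (f.stalkMap η.1).hom h1.symm).trans (Eq.trans ?_ (ht x η.1 η.2.2 hx)))
  exact congrArg (fun a => (f.stalkMap η.1).hom ((X.presheaf.germ _ (f η.1) hx).hom a)) (hr x)

/-- The ideal is the preimage of the module of sections. It maps onto that module because `⌊tZ⌋ ≥ 0`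
places the module inside the case without `Z`, whose sections are already regular. -/
theorem exists_ideal_image_eq_mjSections (C : IsCurveNormalization s f)
    {K J Z : AlgebraicCycle X' ℤ} (hK : IsDivisorOf K (jacobianIdeal f 0))
    (hJ : IsDivisorOf J (pullbackIdeal f (jacobianIdeal s 1))) (hZ : ∀ p, 0 ≤ Z p) {t : ℝ}
    (ht : 0 ≤ t) (U : X.Opens) :
    ∃ I : Ideal Γ(X, U), regularToRational f U '' I = mjSections f K J Z t U := by
  let M := divisorSections (fun p => K p - J p - ⌊t * (Z p : ℝ)⌋) (f ⁻¹ᵁ U)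
  refine ⟨{ carrier := regularToRational f U ⁻¹' M
            zero_mem' := by simp [M.zero_mem]
            add_mem' := fun {a b} ha hb => by
              rw [Set.mem_preimage, map_add]
              exact M.add_mem ha hb
            smul_mem' := fun c a ha => by
              rw [smul_eq_mul, Set.mem_preimage, map_mul]
              exact M.smul_mem ((f.app U).hom c) ha }, ?_⟩
  have hle : (M : Set _) ⊆ Set.range (regularToRational f U) := by
    refine (divisorSections_mono (fun p => ?_) _).trans (C.divisorSections_subset_range hK hJ U)
    have : 0 ≤ ⌊t * (Z p : ℝ)⌋ :=
      Int.floor_nonneg.2 (mul_nonneg ht (Int.cast_nonneg (hZ p)))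
    omega
  exact Set.image_preimage_eq_of_subset hle

end IsCurveNormalization

end AlgebraicGeometry.Scheme

theorem propositionp {k : Type u} [Field k] [IsAlgClosed k] {X X' : Scheme.{u}}
    (s : X ⟶ Spec (.of k)) [IsSeparated s] [LocallyOfFiniteType s] [QuasiCompact s]
    [IsReduced X] (hdim : ∀ Z ∈ irreducibleComponents X, topologicalKrullDim Z = 1)
    (f : X' ⟶ X) (hf : Scheme.IsNormalization f) :
    ∃ K J : AlgebraicCycle X' ℤ,
      Scheme.IsDivisorOf K (Scheme.jacobianIdeal f 0) ∧
      Scheme.IsDivisorOf J (Scheme.pullbackIdeal f (Scheme.jacobianIdeal s 1)) ∧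
      (∀ U : X.Opens, (Scheme.divisorSections (fun p => K p - J p) (f ⁻¹ᵁ U) : Set _) ⊆
        Set.range (Scheme.regularToRational f U)) ∧
      (∀ a : X.IdealSheafData,
        (∀ η : X, closure {η} ∈ irreducibleComponents X → Scheme.idealStalks a η ≠ ⊥) →
        ∃ Z : AlgebraicCycle X' ℤ,
          Scheme.IsDivisorOf Z (Scheme.pullbackIdeal f (Scheme.idealStalks a)) ∧
          ∀ t : ℝ, 0 ≤ t → ∀ U : X.Opens, ∃ I : Ideal Γ(X, U),
            Scheme.regularToRational f U '' I = Scheme.mjSections f K J Z t U) := by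
  have C : Scheme.IsCurveNormalization s f := ⟨‹_›, ‹_›, ‹_›, hdim, hf⟩
  obtain ⟨K, hK⟩ := C.exists_isDivisorOf_jacobianIdeal_zero
  obtain ⟨J, hJ⟩ := C.exists_isDivisorOf_jacobianIdeal_one
  refine ⟨K, J, hK, hJ, C.divisorSections_subset_range hK hJ, fun a ha => ?_⟩
  obtain ⟨Z, hZ⟩ := C.exists_isDivisorOf_idealStalks a ha
  exact ⟨Z, hZ, fun t ht U => C.exists_ideal_image_eq_mjSections hK hJ hZ.nonneg ht U⟩

end
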